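/- Let $(M,g)$ be a four-dimensional smooth spacetime with metric of signature $(-,+,+,+)$, let $\xi$ be a smooth time-like Killing vector field on $M$, $|\xi|=\sqrt{-g(\xi,\xi)}$, $u=\xi/|\xi|$ and $\alpha=\ln|\xi|$. Vectors and 1-forms are identified through $g$, $(x,y)=g(x,y)$, $x^2=(x,x)$, $*$ is the Hodge dual and $i(x)$ the interior product. Put $$a=i(u)\nabla u,\quad \theta=\nabla\cdot u,\quad w=*(u\wedge du),\quad v=*(a\wedge da).$$ For smooth functions $\rho,p$ on an open set $V$ with $\rho+p\neq0$ everywhere on $V$, the tensor $T=(\rho+p)\,u\otimes u+p\,g$ is called a perfect energy tensor with velocity $u$ if $\nabla\cdot T=0$ on $V$; then $\{\rho,p\}$ is called a solution on $V$. **Classes.** A unit time-like field $u$ is of class $C_n$ ($n=1,\dots,18$) on an open set if there the relations in the following list hold at every point. The concomitants in it are: $b=-u+a^{-2}i(a)du$, $c=a^{-2}i(a)da$, $z=-a^{-2}i(a)db$, $y=-a^{-2}i(a)dc$, $\gamma=(v,w)/w^2$; for a vector $x$, $x_u=-(x,u)$, $x_a=(x,a)/a^2$, $x_b=(x,b)/b^2$;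 for a function $f$, $\dot f=-(df)_u$, $f^*=(df)_a$, $\tilde f=(df)_b$; $\Omega=\theta-c_u$, $\nu=\Omega+2c_b$, $\pi=\gamma+\gamma^*+\tilde\Omega-\gamma z_b$; $\ell_1=\nu u-2a$, $\ell_2=\pi u+\Omega a-\gamma b$, $\ell_3=b-u$, $\ell_4=\Omega u-a+c$; $e_4=\Omega u+2c$, $e_5=2b+z$; $f_1=-\gamma^{-1}[\nu^*+2(\theta+c_b-2c_u)]a-2b-z$, $f_2=\Omega^*u-\gamma^{-1}[\pi^*+\dot\Omega+\gamma z_u+2(\Omega c_b+\pi)]a+2\Omega b-c-y$, $f_3=\Omega u-\gamma^{-1}[\gamma^*+3\gamma+\pi]a+2c$; $\phi_1=\tilde\nu-5\gamma+\pi-\gamma z_b$, $\phi_2=\tilde\pi-\dot\gamma-\gamma(c_u+4c_b-3\theta+y_b)+\pi c_b$, $\phi_3=\tilde\gamma+2\gamma c_b$; for functions $k_1,k_2$, $Q(k_1,k_2)=dk_1+k_1(\ell_1-k_1\gamma u)+k_2(\ell_3-k_1a)+f_1-k_1f_3$; $h_1=Q(\phi_1/\phi_3,\phi_2/\phi_3)$;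 $\kappa_i=i(u)i(a)K_i$ with $K_1=df_1+\ell_1\wedge f_1+\ell_3\wedge f_2+f_1\wedge f_3$, $K_2=df_2+\ell_2\wedge f_1+\ell_4\wedge f_2+f_2\wedge f_3$, $K_3=df_3+\gamma u\wedge f_1+a\wedge f_2$; $q_1=Q(\kappa_1/\kappa_3,\kappa_2/\kappa_3)$; $\varphi_1=\nu^*+2(\theta+c_b-2c_u)$, $\varphi_2=\tilde\Omega^*+\dot\Omega+2(\Omega c_b+\tilde\Omega)$, and, with $k_i=\varphi_i/\tilde\Omega$, $n_1=dk_1+k_2\ell_3+k_1(\ell_1-k_1\gamma u)+(2k_1-k_1^*)a-k_1e_4-e_5$; $\Upsilon=v^{-2}*(d\theta\wedge u\wedge a\wedge v)$. The relations are: $C_1$: $a=0$. $C_2$: $a\ne0$, $(a,w)\neq0$. $C_3$: $a\neq0$, $(a,w)=0$, $(c,w)\ne0$. For $C_4$–$C_{15}$: $a\neq0$, $w\ne0$, $(a,w)=(c,w)=0$, together with, for $C_4$–$C_{10}$, $v\neq0$ and $[C_4]$ $\phi_3\ne0$, $h_1\neq0$; $[C_5]$ $\phi_3\neq0$, $h_1=0$;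 $[C_6]$ $\phi_3=0$, $\phi_1\neq0$; $[C_7]$ $\phi_3=\phi_1=0$, $\kappa_3\ne0$, $q_1\neq0$; $[C_8]$ $\phi_3=\phi_1=0$, $\kappa_3\neq0$, $q_1=0$; $[C_9]$ $\phi_3=\phi_1=\kappa_3=0$, $\kappa_1\neq0$; $[C_{10}]$ $\phi_3=\phi_1=\kappa_3=\kappa_1=0$; and, for $C_{11}$–$C_{15}$, $v=0$ and $[C_{11}]$ $\tilde{c_b}+\tilde\Omega\neq0$; $[C_{12}]$ $\tilde{c_b}=-\tilde\Omega\neq0$, $n_1\ne0$; $[C_{13}]$ $\tilde{c_b}=-\tilde\Omega\neq0$, $n_1=0$; $[C_{14}]$ $\tilde{c_b}=\tilde\Omega=0$, $\varphi_1\neq0$; $[C_{15}]$ $\tilde{c_b}=\tilde\Omega=0$, $\varphi_1=0$. $C_{16}$: $a\neq0$, $w=0$, $v\neq0$, $\Upsilon\neq0$. $C_{17}$: $a\neq0$, $w=0$, $v\ne0$, $\Upsilon=0$. $C_{18}$: $a\neq0$, $w=0$, $v=0$. **Statement.** (A) There are smooth functions $\rho,p$ on $M$ such that $\{\rho,p\}$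 is a solution on $M$: $u$ is always the velocity of a perfect energy tensor. (B) If $u$ is of class $C_n$ on a non-empty open set $U$, then $n\in\{1,2,15,18\}$. Moreover, on every open set, $u$ is of class $C_1$ iff $a=0$; of class $C_2$ iff $(w,a)\neq0$ at every point; of class $C_{15}$ iff $a\neq0$ and $w\neq0$ at every point and $(w,a)=0$; of class $C_{18}$ iff $a\neq0$ at every point and $w=0$. (C) Let $U$ be an open set on which one of the following cases holds. (An inequality is required at every point.) * $a=0$, $w\neq0$, $U$ connected. The solutions on $U$ are exactly the pairs in which $p=p_0$ is a constant and $\rho$ is a smooth $u$-invariant function, $u(\rho)=0$, with $\rho+p\neq0$. In the other cases, every point of $U$ has an open neighbourhood $V\subseteq U$ with the following property (functions of one variable are smooth on the range, over $V$, of their argument). * $a=0$, $w=0$. There is a smooth function $\tau$ on $V$ with $u=-d\tau$, and the solutions on $V$ are exactly the pairs with $p=p(\tau)$ an arbitrary function of $\tau$ and $\rho$ a smooth $u$-invariant function, with $\rho+p\neq0$. * $(w,a)\neq0$. The solutions on $V$ are exactly the pairs $p=p(\alpha)$, $\rho=-p(\alpha)-p'(\alpha)$, with $p(\alpha)$ an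 arbitrary function such that $\rho+p\neq0$. * $a\neq0$, $w\neq0$, $(w,a)=0$. There are smooth functions $\tau,\mu$ on $V$ with $u=-d\tau+\mu\,d\alpha$, and the solutions on $V$ are exactly the pairs $p=c_1\tau e^{-2\alpha}+p_1(\alpha)$, $\rho=c_1(\tau-\mu)e^{-2\alpha}-p_1(\alpha)-p_1'(\alpha)$, with $c_1$ a constant and $p_1(\alpha)$ an arbitrary function such that $\rho+p\neq0$. * $a\neq0$, $w=0$. There is a smooth function $\tau$ on $V$ with $u=-e^{\alpha}d\tau$, and the solutions on $V$ are exactly the pairs $p=p_0(\tau)e^{-\alpha}+p_1(\alpha)$, $\rho=-p_1(\alpha)-p_1'(\alpha)$, with $p_0(\tau),p_1(\alpha)$ arbitrary functions such that $\rho+p\neq0$. -/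

import Mathlib

open scoped Manifold ContDiff Topology

namespace PerfectFluid

noncomputable section

/-! ## Tensor calculus on a coordinate domain of a four-dimensional spacetime

Scalar fields are functions `Coord → ℝ`, vector fields and 1-forms are given by their components
`Coord → Fin 4 → ℝ`, the metric and the other tensors of rank two by matrices of components. -/

/-- The coordinate space `ℝ⁴`. -/
abbrev Coord : Type := EuclideanSpace ℝ (Fin 4)

/-- Scalar fields in coordinates. -/
abbrev Scal : Type := Coord → ℝ

/-- Components of a vector field or of a 1-form in coordinates. -/
abbrev Vec : Type := Coord → Fin 4 → ℝ

/-- Components of a tensor field of rank two in coordinates. -/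
abbrev Ten : Type := Coord → Matrix (Fin 4) (Fin 4) ℝ

/-- The partial derivative `∂ᵢ f`. -/
def pd (i : Fin 4) (f : Scal) : Scal :=
  fun y => fderiv ℝ f y (EuclideanSpace.single i (1 : ℝ))

/-- The differential `df` of a function. -/
def grad (f : Scal) : Vec := fun y i => pd i f y

/-- The exterior derivative `(dx)ᵢⱼ = ∂ᵢ xⱼ - ∂ⱼ xᵢ` of a 1-form. -/
def extD (x : Vec) : Ten :=
  fun y => Matrix.of fun i j => pd i (fun q => x q j) y - pd j (fun q => x q i) y

/-- The exterior product `(x ∧ y)ᵢⱼ = xᵢ yⱼ - xⱼ yᵢ` of two 1-forms. -/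
def wedge (x y : Vec) : Ten := fun q => Matrix.of fun i j => x q i * y q j - x q j * y q i

/-- Christoffel symbols `Γᵏᵢⱼ` of the metric `G`. -/
def christoffel (G : Ten) (k i j : Fin 4) : Scal := fun y =>
  (1 / 2) * ∑ l, (G y)⁻¹ k l *
    (pd i (fun q => G q j l) y + pd j (fun q => G q i l) y - pd l (fun q => G q i j) y)

/-- The covariant derivative `∇ᵢ Xʲ` of a vector field. -/
def covD (G : Ten) (X : Vec) (i j : Fin 4) : Scal := fun y =>
  pd i (fun q => X q j) y + ∑ k, christoffel G j i k y * X y k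

/-- The covariant divergence `∇ᵢ Tⁱʲ` of a contravariant tensor of rank two. -/
def divT (G T : Ten) : Vec := fun y j =>
  ∑ i, (pd i (fun q => T q i j) y
    + ∑ k, (christoffel G i i k y * T y k j + christoffel G j i k y * T y i k))

/-- Lowering an index. -/
def lower (G : Ten) (X : Vec) : Vec := fun y i => ∑ j, G y i j * X y j

/-- Raising an index. -/
def raise (G : Ten) (x : Vec) : Vec := fun y i => ∑ j, (G y)⁻¹ i j * x y j

/-- The metric product `(x, y)` of two 1-forms. -/
def ip (G : Ten) (x y : Vec) : Scal := fun q => ∑ i, ∑ j, (G q)⁻¹ i j * x q i * y q j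

/-- The interior product `i(x)F` of (the vector associated with) the 1-form `x` and a 2-form. -/
def inter (G : Ten) (x : Vec) (F : Ten) : Vec := fun y j => ∑ i, raise G x y i * F y i j

/-- The Levi-Civita symbol `ε_{ijkl}`. -/
def eps (i j k l : Fin 4) : ℝ :=
  Matrix.det (Matrix.of fun r c : Fin 4 => if ![i, j, k, l] r = c then (1 : ℝ) else 0)

/-- The metric volume element `η_{ijkl}`. -/
def vol (G : Ten) (i j k l : Fin 4) : Scal := fun y => Real.sqrt |(G y).det| * eps i j k l

/-- The Hodge dual `*(x ∧ F)` of the exterior product of a 1-form and a 2-form: its components are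
`(1/6) (x ∧ F)ⁱʲᵏ η_{ijkl} = (1/2) xⁱ Fʲᵏ η_{ijkl}`. -/
def star3 (G : Ten) (x : Vec) (F : Ten) : Vec := fun y l =>
  (1 / 2) * ∑ i, ∑ j, ∑ k,
    raise G x y i * ((G y)⁻¹ * F y * ((G y)⁻¹).transpose) j k * vol G i j k l y

/-- The Hodge dual `*(x₁ ∧ x₂ ∧ x₃ ∧ x₄)` of the exterior product of four 1-forms. -/
def star4 (G : Ten) (x₁ x₂ x₃ x₄ : Vec) : Scal := fun y =>
  ∑ i, ∑ j, ∑ k, ∑ l,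
    raise G x₁ y i * raise G x₂ y j * raise G x₃ y k * raise G x₄ y l * vol G i j k l y

/-- Components of the Lie derivative of the metric:
`(ℒ_X g)ᵢⱼ = Xᵏ ∂ₖ gᵢⱼ + gₖⱼ ∂ᵢ Xᵏ + gᵢₖ ∂ⱼ Xᵏ`. -/
def lieMetric (G : Ten) (X : Vec) : Ten := fun y => Matrix.of fun i j =>
  ∑ k, (X y k * pd k (fun q => G q i j) y + G y k j * pd i (fun q => X q k) y
    + G y i k * pd j (fun q => X q k) y)

/-- The energy tensor `T = (ρ + p) u ⊗ u + p g`, contravariant components. -/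
def energyT (G : Ten) (u : Vec) (ρ p : Scal) : Ten := fun y => Matrix.of fun i j =>
  (ρ y + p y) * u y i * u y j + p y * (G y)⁻¹ i j

/-! ## Differential concomitants of a unit vector field

In what follows `G` is the metric and `u` is the (contravariant) unit vector field. All the
vectorial concomitants are given by their covariant components. -/

section Concomitants

variable (G : Ten) (u : Vec)

/-- The 1-form associated with `u`. -/
def uF : Vec := lower G u

/-- The acceleration `a = i(u)∇u`. -/
def acc : Vec := lower G fun y j => ∑ i, u y i * covD G u i j y

/-- The expansion `θ = ∇ · u`. -/
def expan : Scal := fun y => ∑ i, covD G u i i y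

/-- The rotation vector `w = *(u ∧ du)`. -/
def rot : Vec := star3 G (uF G u) (extD (uF G u))

/-- The rotation vector `v = *(a ∧ da)` of the acceleration. -/
def rotAcc : Vec := star3 G (acc G u) (extD (acc G u))

/-- `a² = (a, a)`. -/
def accSq : Scal := ip G (acc G u) (acc G u)

/-- `b = -u + a⁻² i(a) du`. -/
def vb : Vec := -uF G u + (accSq G u)⁻¹ • inter G (acc G u) (extD (uF G u))

/-- `c = a⁻² i(a) da`. -/
def vc : Vec := (accSq G u)⁻¹ • inter G (acc G u) (extD (acc G u))

/-- `z = -a⁻² i(a) db`. -/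
def vz : Vec := -((accSq G u)⁻¹ • inter G (acc G u) (extD (vb G u)))

/-- `y = -a⁻² i(a) dc`. -/
def vy : Vec := -((accSq G u)⁻¹ • inter G (acc G u) (extD (vc G u)))

/-- `γ = (v, w) / w²`. -/
def gam : Scal := ip G (rotAcc G u) (rot G u) / ip G (rot G u) (rot G u)

/-- `x_u = -(x, u)`. -/
def cu (x : Vec) : Scal := -ip G x (uF G u)

/-- `x_a = (x, a) / a²`. -/
def ca (x : Vec) : Scal := ip G x (acc G u) / accSq G u

/-- `x_b = (x, b) / b²`. -/
def cb (x : Vec) : Scal := ip G x (vb G u) / ip G (vb G u) (vb G u)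

/-- The derivative of a function along `u` (a dot in the usual notation): `φ̇ = -(dφ)_u`. -/
def ddot (f : Scal) : Scal := -cu G u (grad f)

/-- `φ* = (dφ)_a`. -/
def dstar (f : Scal) : Scal := ca G u (grad f)

/-- `φ̃ = (dφ)_b`. -/
def dtilde (f : Scal) : Scal := cb G u (grad f)

/-- `Ω = θ - c_u`. -/
def Om : Scal := expan G u - cu G u (vc G u)

/-- `ν = Ω + 2 c_b`. -/
def nu : Scal := Om G u + 2 * cb G u (vc G u)

/-- `π = γ + γ* + Ω̃ - γ z_b`. -/
def pic : Scal :=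
  gam G u + dstar G u (gam G u) + dtilde G u (Om G u) - gam G u * cb G u (vz G u)

/-- `ℓ₁ = ν u - 2 a`. -/
def l1 : Vec := nu G u • uF G u - (2 : ℝ) • acc G u

/-- `ℓ₂ = π u + Ω a - γ b`. -/
def l2 : Vec := pic G u • uF G u + Om G u • acc G u - gam G u • vb G u

/-- `ℓ₃ = b - u`. -/
def l3 : Vec := vb G u - uF G u

/-- `ℓ₄ = Ω u - a + c`. -/
def l4 : Vec := Om G u • uF G u - acc G u + vc G u

/-- `e₄ = Ω u + 2 c`. -/
def e4 : Vec := Om G u • uF G u + (2 : ℝ) • vc G u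

/-- `e₅ = 2 b + z`. -/
def e5 : Vec := (2 : ℝ) • vb G u + vz G u

/-- `e₆ = c + y - Ω* u - 2 Ω b`. -/
def e6 : Vec :=
  vc G u + vy G u - dstar G u (Om G u) • uF G u - (2 * Om G u) • vb G u

/-- `f₁ = -γ⁻¹ [ν* + 2 (θ + c_b - 2 c_u)] a - 2 b - z`. -/
def f1 : Vec :=
  -(((gam G u)⁻¹ * (dstar G u (nu G u)
      + 2 * (expan G u + cb G u (vc G u) - 2 * cu G u (vc G u)))) • acc G u)
    - (2 : ℝ) • vb G u - vz G u

/-- `f₂ = Ω* u - γ⁻¹ [π* + Ω̇ + γ z_u + 2 (Ω c_b + π)] a + 2 Ω b - c - y`. -/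
def f2 : Vec :=
  dstar G u (Om G u) • uF G u
    - ((gam G u)⁻¹ * (dstar G u (pic G u) + ddot G u (Om G u) + gam G u * cu G u (vz G u)
      + 2 * (Om G u * cb G u (vc G u) + pic G u))) • acc G u
    + (2 * Om G u) • vb G u - vc G u - vy G u

/-- `f₃ = Ω u - γ⁻¹ [γ* + 3 γ + π] a + 2 c`. -/
def f3 : Vec :=
  Om G u • uF G u
    - ((gam G u)⁻¹ * (dstar G u (gam G u) + 3 * gam G u + pic G u)) • acc G u
    + (2 : ℝ) • vc G u

/-- `φ₁ = ν̃ - 5 γ + π - γ z_b`. -/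
def phi1 : Scal :=
  dtilde G u (nu G u) - 5 * gam G u + pic G u - gam G u * cb G u (vz G u)

/-- `φ₂ = π̃ - γ̇ - γ (c_u + 4 c_b - 3 θ + y_b) + π c_b`. -/
def phi2 : Scal :=
  dtilde G u (pic G u) - ddot G u (gam G u)
    - gam G u * (cu G u (vc G u) + 4 * cb G u (vc G u) - 3 * expan G u + cb G u (vy G u))
    + pic G u * cb G u (vc G u)

/-- `φ₃ = γ̃ + 2 γ c_b`. -/
def phi3 : Scal := dtilde G u (gam G u) + 2 * gam G u * cb G u (vc G u)

/-- The common form of the vectorial concomitants `h₁` and `q₁`: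
`dk₁ + k₁ [ℓ₁ - k₁ γ u] + k₂ [ℓ₃ - k₁ a] + f₁ - k₁ f₃`. -/
def hq1 (k₁ k₂ : Scal) : Vec :=
  grad k₁ + k₁ • (l1 G u - (k₁ * gam G u) • uF G u) + k₂ • (l3 G u - k₁ • acc G u)
    + f1 G u - k₁ • f3 G u

/-- `h₁`, obtained with `k₁ = φ₁ / φ₃`, `k₂ = φ₂ / φ₃`. -/
def h1 : Vec := hq1 G u (phi1 G u / phi3 G u) (phi2 G u / phi3 G u)

/-- `K₁ = df₁ + ℓ₁ ∧ f₁ + ℓ₃ ∧ f₂ + f₁ ∧ f₃`. -/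
def K1 : Ten :=
  extD (f1 G u) + wedge (l1 G u) (f1 G u) + wedge (l3 G u) (f2 G u) + wedge (f1 G u) (f3 G u)

/-- `K₂ = df₂ + ℓ₂ ∧ f₁ + ℓ₄ ∧ f₂ + f₂ ∧ f₃`. -/
def K2 : Ten :=
  extD (f2 G u) + wedge (l2 G u) (f1 G u) + wedge (l4 G u) (f2 G u) + wedge (f2 G u) (f3 G u)

/-- `K₃ = df₃ + γ u ∧ f₁ + a ∧ f₂`. -/
def K3 : Ten :=
  extD (f3 G u) + wedge (gam G u • uF G u) (f1 G u) + wedge (acc G u) (f2 G u)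

/-- `i(u) i(a) K`. -/
def iuia (K : Ten) : Scal := fun y => ∑ j, u y j * inter G (acc G u) K y j

/-- `κ₁ = i(u) i(a) K₁`. -/
def kap1 : Scal := iuia G u (K1 G u)

/-- `κ₂ = i(u) i(a) K₂`. -/
def kap2 : Scal := iuia G u (K2 G u)

/-- `κ₃ = i(u) i(a) K₃`. -/
def kap3 : Scal := iuia G u (K3 G u)

/-- `q₁`, obtained with `k₁ = κ₁ / κ₃`, `k₂ = κ₂ / κ₃`. -/
def q1 : Vec := hq1 G u (kap1 G u / kap3 G u) (kap2 G u / kap3 G u)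

/-- `Ω̃`. -/
def OmT : Scal := dtilde G u (Om G u)

/-- The derivative `(d c_b)_b` of the component `c_b`. -/
def cbT : Scal := dtilde G u (cb G u (vc G u))

/-- `φ₁` of the case `v = 0` (a variant letter phi): `ν* + 2 (θ + c_b - 2 c_u)`. -/
def vphi1 : Scal :=
  dstar G u (nu G u) + 2 * (expan G u + cb G u (vc G u) - 2 * cu G u (vc G u))

/-- `φ₂` of the case `v = 0` (a variant letter phi): `(Ω̃)* + Ω̇ + 2 (Ω c_b + Ω̃)`. -/
def vphi2 : Scal :=
  dstar G u (OmT G u) + ddot G u (Om G u) + 2 * (Om G u * cb G u (vc G u) + OmT G u)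

/-- `n₁ = dk₁ + k₂ ℓ₃ + k₁ (ℓ₁ - k₁ γ u) + (2 k₁ - k₁*) a - k₁ e₄ - e₅` for given `k₁`, `k₂`. -/
def n1Aux (k₁ k₂ : Scal) : Vec :=
  grad k₁ + k₂ • l3 G u + k₁ • (l1 G u - (k₁ * gam G u) • uF G u)
    + (2 * k₁ - dstar G u k₁) • acc G u - k₁ • e4 G u - e5 G u

/-- `n₁`, obtained by dividing the variant `φ₁` and `φ₂` by `Ω̃`. -/
def n1 : Vec := n1Aux G u (vphi1 G u / OmT G u) (vphi2 G u / OmT G u)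

/-- `Υ = v⁻² *(dθ ∧ u ∧ a ∧ v)`. -/
def Ups : Scal :=
  (ip G (rotAcc G u) (rotAcc G u))⁻¹
    * star4 G (grad (expan G u)) (uF G u) (acc G u) (rotAcc G u)

/-- Shared relations of the classes `C₄`, …, `C₁₅`:
`a ≠ 0`, `w ≠ 0`, `(a, w) = (c, w) = 0`. -/
def RotRel (y : Coord) : Prop :=
  acc G u y ≠ 0 ∧ rot G u y ≠ 0 ∧ ip G (acc G u) (rot G u) y = 0 ∧ ip G (vc G u) (rot G u) y = 0

/-- The relations, at a point, that define the eighteen classes `Cₙ`, `n = 1, …, 18`. -/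
def ClassRel (n : ℕ) (y : Coord) : Prop :=
  match n with
  | 1 => acc G u y = 0
  | 2 => acc G u y ≠ 0 ∧ ip G (acc G u) (rot G u) y ≠ 0
  | 3 => acc G u y ≠ 0 ∧ ip G (acc G u) (rot G u) y = 0 ∧ ip G (vc G u) (rot G u) y ≠ 0
  | 4 => RotRel G u y ∧ rotAcc G u y ≠ 0 ∧ phi3 G u y ≠ 0 ∧ h1 G u y ≠ 0
  | 5 => RotRel G u y ∧ rotAcc G u y ≠ 0 ∧ phi3 G u y ≠ 0 ∧ h1 G u y = 0
  | 6 => RotRel G u y ∧ rotAcc G u y ≠ 0 ∧ phi3 G u y = 0 ∧ phi1 G u y ≠ 0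
  | 7 => RotRel G u y ∧ rotAcc G u y ≠ 0 ∧ phi3 G u y = 0 ∧ phi1 G u y = 0 ∧ kap3 G u y ≠ 0
      ∧ q1 G u y ≠ 0
  | 8 => RotRel G u y ∧ rotAcc G u y ≠ 0 ∧ phi3 G u y = 0 ∧ phi1 G u y = 0 ∧ kap3 G u y ≠ 0
      ∧ q1 G u y = 0
  | 9 => RotRel G u y ∧ rotAcc G u y ≠ 0 ∧ phi3 G u y = 0 ∧ phi1 G u y = 0 ∧ kap3 G u y = 0
      ∧ kap1 G u y ≠ 0
  | 10 => RotRel G u y ∧ rotAcc G u y ≠ 0 ∧ phi3 G u y = 0 ∧ phi1 G u y = 0 ∧ kap3 G u y = 0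
      ∧ kap1 G u y = 0
  | 11 => RotRel G u y ∧ rotAcc G u y = 0 ∧ cbT G u y + OmT G u y ≠ 0
  | 12 => RotRel G u y ∧ rotAcc G u y = 0 ∧ cbT G u y = -OmT G u y ∧ OmT G u y ≠ 0
      ∧ n1 G u y ≠ 0
  | 13 => RotRel G u y ∧ rotAcc G u y = 0 ∧ cbT G u y = -OmT G u y ∧ OmT G u y ≠ 0
      ∧ n1 G u y = 0
  | 14 => RotRel G u y ∧ rotAcc G u y = 0 ∧ cbT G u y = 0 ∧ OmT G u y = 0 ∧ vphi1 G u y ≠ 0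
  | 15 => RotRel G u y ∧ rotAcc G u y = 0 ∧ cbT G u y = 0 ∧ OmT G u y = 0 ∧ vphi1 G u y = 0
  | 16 => acc G u y ≠ 0 ∧ rot G u y = 0 ∧ rotAcc G u y ≠ 0 ∧ Ups G u y ≠ 0
  | 17 => acc G u y ≠ 0 ∧ rot G u y = 0 ∧ rotAcc G u y ≠ 0 ∧ Ups G u y = 0
  | 18 => acc G u y ≠ 0 ∧ rot G u y = 0 ∧ rotAcc G u y = 0
  | _ => False

end Concomitants

/-! ## Spacetimes -/

section Spacetime

variable {M : Type*} [TopologicalSpace M] [ChartedSpace (EuclideanSpace ℝ (Fin 4)) M]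
  [IsManifold (𝓡 4) ∞ M]

variable (M) in
/-- A smooth metric of signature `(-,+,+,+)` on a four-dimensional manifold. -/
structure LorentzMetric where
  /-- The metric product of two tangent vectors. -/
  val (x : M) : TangentSpace (𝓡 4) x →L[ℝ] TangentSpace (𝓡 4) x →L[ℝ] ℝ
  symm (x : M) (X Y : TangentSpace (𝓡 4) x) : val x X Y = val x Y X
  signature (x : M) : ∃ e : Module.Basis (Fin 4) ℝ (TangentSpace (𝓡 4) x),
    ∀ i j, val x (e i) (e j) = if i = j then (if i = 0 then -1 else 1) else 0
  contMDiff : ContMDiff (𝓡 4)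
    ((𝓡 4).prod 𝓘(ℝ, EuclideanSpace ℝ (Fin 4) →L[ℝ] EuclideanSpace ℝ (Fin 4) →L[ℝ] ℝ)) ∞
    (fun x => Bundle.TotalSpace.mk'
      (EuclideanSpace ℝ (Fin 4) →L[ℝ] EuclideanSpace ℝ (Fin 4) →L[ℝ] ℝ)
      (E := fun x : M => TangentSpace (𝓡 4) x →L[ℝ] TangentSpace (𝓡 4) x →L[ℝ] ℝ) x (val x))

/-- Smooth vector fields. -/
def SmoothField (X : ∀ x : M, TangentSpace (𝓡 4) x) : Prop :=
  ContMDiff (𝓡 4) (𝓡 4).tangent ∞ (fun x => (⟨x, X x⟩ : TangentBundle (𝓡 4) M))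

/-- The components `g(∂ᵢ, ∂ⱼ)` of the metric in a chart. -/
def metricIn (g : LorentzMetric M) (φ : OpenPartialHomeomorph M (EuclideanSpace ℝ (Fin 4))) : Ten :=
  fun y => Matrix.of fun i j =>
    g.val (φ.symm y)
      (mfderiv (𝓡 4) (𝓡 4) φ.symm y (EuclideanSpace.single i (1 : ℝ) : EuclideanSpace ℝ (Fin 4)))
      (mfderiv (𝓡 4) (𝓡 4) φ.symm y (EuclideanSpace.single j (1 : ℝ) : EuclideanSpace ℝ (Fin 4)))

/-- The contravariant components of a vector field in a chart. -/
def fieldIn (X : ∀ x : M, TangentSpace (𝓡 4) x)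
    (φ : OpenPartialHomeomorph M (EuclideanSpace ℝ (Fin 4))) : Vec :=
  fun y i =>
    (show EuclideanSpace ℝ (Fin 4) from mfderiv (𝓡 4) (𝓡 4) φ (φ.symm y) (X (φ.symm y))) i

/-- A relation between the metric, the vector field `X` and their derivatives holds at all the
points of `U`, in all the charts of the smooth structure. -/
def HoldsOn (g : LorentzMetric M) (X : ∀ x : M, TangentSpace (𝓡 4) x) (U : Set M)
    (P : Ten → Vec → Coord → Prop) : Prop :=
  ∀ φ ∈ IsManifold.maximalAtlas (𝓡 4) ∞ M, ∀ x ∈ U, x ∈ φ.source →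
    P (metricIn g φ) (fieldIn X φ) (φ x)

/-- Killing vector fields: `ℒ_X g = 0`. -/
def IsKilling (g : LorentzMetric M) (X : ∀ x : M, TangentSpace (𝓡 4) x) : Prop :=
  HoldsOn g X Set.univ fun G X y => lieMetric G X y = 0

/-- Time-like vector fields. -/
def IsTimelike (g : LorentzMetric M) (X : ∀ x : M, TangentSpace (𝓡 4) x) : Prop :=
  ∀ x, g.val x (X x) (X x) < 0

/-- The norm `|X| = √(-g(X, X))` of a time-like vector field. -/
def fieldNorm (g : LorentzMetric M) (X : ∀ x : M, TangentSpace (𝓡 4) x) (x : M) : ℝ :=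
  Real.sqrt (-(g.val x (X x) (X x)))

/-- The unit vector field `X / |X|`. -/
def unitField (g : LorentzMetric M) (X : ∀ x : M, TangentSpace (𝓡 4) x) (x : M) :
    TangentSpace (𝓡 4) x :=
  (fieldNorm g X x)⁻¹ • X x

/-- The function `ln |X|`. -/
def logNorm (g : LorentzMetric M) (X : ∀ x : M, TangentSpace (𝓡 4) x) (x : M) : ℝ :=
  Real.log (fieldNorm g X x)

/-- On the open set `U`, the tensor `T = (ρ + p) u ⊗ u + p g` is a perfect energy tensor with unit
velocity `u`: `u` is unit and time-like, `ρ` and `p` are smooth, `ρ + p ≠ 0` and `∇ · T = 0`. -/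
structure IsPerfectEnergyTensor (g : LorentzMetric M) (u : ∀ x : M, TangentSpace (𝓡 4) x)
    (U : Set M) (ρ p : M → ℝ) : Prop where
  unit : ∀ x ∈ U, g.val x (u x) (u x) = -1
  smooth_density : ContMDiffOn (𝓡 4) 𝓘(ℝ, ℝ) ∞ ρ U
  smooth_pressure : ContMDiffOn (𝓡 4) 𝓘(ℝ, ℝ) ∞ p U
  ne_zero : ∀ x ∈ U, ρ x + p x ≠ 0
  conserved : ∀ φ ∈ IsManifold.maximalAtlas (𝓡 4) ∞ M, ∀ x ∈ U, x ∈ φ.source →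
    divT (metricIn g φ)
      (energyT (metricIn g φ) (fieldIn u φ) (ρ ∘ φ.symm) (p ∘ φ.symm)) (φ x) = 0

/-- On the set `U` the unit vector field `u` is of class `Cₙ`. -/
def IsOfClass (g : LorentzMetric M) (u : ∀ x : M, TangentSpace (𝓡 4) x) (U : Set M) (n : ℕ) :
    Prop :=
  HoldsOn g u U fun G u y => ClassRel G u n y

/-- `a = 0` on `U`. -/
def AccZero (g : LorentzMetric M) (u : ∀ x : M, TangentSpace (𝓡 4) x) (U : Set M) : Prop :=
  HoldsOn g u U fun G u y => acc G u y = 0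

/-- `a ≠ 0` at every point of `U`. -/
def AccNeZero (g : LorentzMetric M) (u : ∀ x : M, TangentSpace (𝓡 4) x) (U : Set M) : Prop :=
  HoldsOn g u U fun G u y => acc G u y ≠ 0

/-- `w = 0` on `U`. -/
def RotZero (g : LorentzMetric M) (u : ∀ x : M, TangentSpace (𝓡 4) x) (U : Set M) : Prop :=
  HoldsOn g u U fun G u y => rot G u y = 0

/-- `w ≠ 0` at every point of `U`. -/
def RotNeZero (g : LorentzMetric M) (u : ∀ x : M, TangentSpace (𝓡 4) x) (U : Set M) : Prop :=
  HoldsOn g u U fun G u y => rot G u y ≠ 0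

/-- `(w, a) = 0` on `U`. -/
def RotAccZero (g : LorentzMetric M) (u : ∀ x : M, TangentSpace (𝓡 4) x) (U : Set M) : Prop :=
  HoldsOn g u U fun G u y => ip G (rot G u) (acc G u) y = 0

/-- `(w, a) ≠ 0` at every point of `U`. -/
def RotAccNeZero (g : LorentzMetric M) (u : ∀ x : M, TangentSpace (𝓡 4) x) (U : Set M) : Prop :=
  HoldsOn g u U fun G u y => ip G (rot G u) (acc G u) y ≠ 0

/-- Smooth real functions on a subset of the spacetime. -/
def SmoothOn (f : M → ℝ) (V : Set M) : Prop := ContMDiffOn (𝓡 4) 𝓘(ℝ, ℝ) ∞ f V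

/-- The differential of a function at a point, applied to a tangent vector. -/
def dAt (f : M → ℝ) (x : M) (X : TangentSpace (𝓡 4) x) : ℝ :=
  mfderiv (𝓡 4) 𝓘(ℝ, ℝ) f x X

end Spacetime

end

end PerfectFluid

/-!
# Perfect fluids at rest in a stationary spacetime

Let `ξ` be the time-like Killing field, `α = ln |ξ|`, `u = e^{-α} ξ`, and let `χ = e^{-α} g(u, ·)`.
The Killing equation gives `a = dα` and `θ = 0` (`IsStationary.acc_eq`,
`IsStationary.expan_eq_zero`), and `χ` satisfies `χ(ξ) = -1` and `i(ξ) dχ = 0`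
(`IsStationary.sum_field_extD_invForm`).

*Classes.* Since `da = 0`, the concomitants `v`, `c`, `Ω`, `ν` and their derivatives vanish, which
excludes all the classes but four and reduces the relations of these four to conditions on `a`, `w`
and `(w, a)` (`IsStationary.class_mem` and its companions).

*Conservation equations.* Solved for the gradient of the pressure, `∇ · T = 0` becomes `ξ(ρ) = 0`
and `dp = -ξ(p) χ - (ρ + p) dα` (`IsStationary.divT_eq_zero_iff`). The exterior derivative of the
second equation gives `ξ(p) dχ + dρ ∧ dα = 0` (`IsFluid.integrability`), and it shows that the
differential of `k = e^α ξ(p)` is a multiple of `χ`, hence zero where `dχ ≠ 0`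
(`IsFluid.fderiv_rate`, `IsFluid.fderiv_rate_eq_zero`). On the other hand, `w` vanishes exactly
where `dχ` does, and, where `a ≠ 0`, `(w, a)` vanishes exactly where `dχ` is divisible by `dα`
(`IsStationary.rot_eq_zero_iff`, `IsStationary.ip_rot_acc_eq_zero`,
`IsStationary.exists_extD_invForm`). This settles every case:

* if `(w, a) ≠ 0`, or if `a = 0` and `w ≠ 0`, then `ξ(p) = 0` and `dp = -(ρ + p) dα`;
* if `w ≠ 0` and `a ≠ 0` is orthogonal to `w`, then `k` is a constant, and `g(u, ·) = -dτ + μ dα`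
  because `g(u, ·)` is closed on the level sets of `α`;
* if `w = 0`, then `χ = -dτ` and `k` is a function of `τ`.

In each case `p` minus an explicit term has a differential proportional to `dα` (or to `dτ`, if `a =
w = 0`; or zero, if `a = 0` and `w ≠ 0`). The local statements are integrated on a chart with convex
target in which `α`, `τ`, or both, are linear functions (`exists_chart_linear`). On such a domain a
function with a differential proportional to `dα` is a smooth function of `α`
(`exists_comp_linear`), and `τ` comes from a Poincaré lemma along the translates of a subspace
(`exists_primitive_along`).
-/

namespace PerfectFluid

noncomputable section

/-! ### Partial derivatives -/

theorem pd_congr {f f' : Scal} {y : Coord} (h : f =ᶠ[𝓝 y] f') (i : Fin 4) :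
    pd i f y = pd i f' y := by
  rw [pd, pd, h.fderiv_eq]

theorem pd_add {f f' : Scal} {y : Coord} (hf : DifferentiableAt ℝ f y)
    (hf' : DifferentiableAt ℝ f' y) (i : Fin 4) :
    pd i (fun q => f q + f' q) y = pd i f y + pd i f' y := by
  simp only [pd]
  rw [fderiv_fun_add hf hf']; rfl

theorem pd_mul {f f' : Scal} {y : Coord} (hf : DifferentiableAt ℝ f y)
    (hf' : DifferentiableAt ℝ f' y) (i : Fin 4) :
    pd i (fun q => f q * f' q) y = pd i f y * f' y + f y * pd i f' y := by
  simp only [pd]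
  rw [fderiv_fun_mul hf hf']
  simp [mul_comm, add_comm]

theorem pd_sum {ι : Type*} (s : Finset ι) {f : ι → Scal} {y : Coord}
    (hf : ∀ k ∈ s, DifferentiableAt ℝ (f k) y) (i : Fin 4) :
    pd i (fun q => ∑ k ∈ s, f k q) y = ∑ k ∈ s, pd i (f k) y := by
  simp only [pd]
  rw [fderiv_fun_sum hf]
  simp

theorem pd_const (c : ℝ) (y : Coord) (i : Fin 4) : pd i (fun _ => c) y = 0 := by
  simp [pd]

theorem pd_eq_zero_of_eventually_const {f : Scal} {y : Coord} {c : ℝ} (h : f =ᶠ[𝓝 y] fun _ => c)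
    (i : Fin 4) : pd i f y = 0 := by
  rw [pd_congr h, pd_const]

/-- The chain rule for the exponential of a multiple of a function. -/
theorem pd_exp_mul {f : Scal} {y : Coord} (hf : DifferentiableAt ℝ f y) (c : ℝ) (i : Fin 4) :
    pd i (fun q => Real.exp (c * f q)) y = c * pd i f y * Real.exp (c * f y) := by
  simp only [pd]
  rw [((hf.hasFDerivAt.const_mul c).exp).fderiv]
  simp; ring

theorem fderiv_apply_eq_sum_pd (f : Scal) (y v : Coord) :
    fderiv ℝ f y v = ∑ i, v i * pd i f y := by
  conv_lhs => rw [← (EuclideanSpace.basisFun (Fin 4) ℝ).sum_repr v]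
  simp [pd, map_sum]

theorem pd_comm {f : Scal} {y : Coord} (hf : ContDiffAt ℝ ∞ f y) (i j : Fin 4) :
    pd i (fun q => pd j f q) y = pd j (fun q => pd i f q) y := by
  have hd : DifferentiableAt ℝ (fderiv ℝ f) y :=
    (hf.fderiv_right (m := 1) (by norm_cast)).differentiableAt (by norm_num)
  have hs : IsSymmSndFDerivAt ℝ f y := hf.isSymmSndFDerivAt (by simp; exact ENat.LEInfty.out)
  have key : ∀ i j : Fin 4, pd i (fun q => pd j f q) y
      = fderiv ℝ (fderiv ℝ f) y (EuclideanSpace.single i 1) (EuclideanSpace.single j 1) := by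
    intro i j
    simp only [pd]
    rw [fderiv_clm_apply hd (differentiableAt_const _)]
    simp
  rw [key, key, hs]

/-! ### Metrics with a time-like Killing field in a coordinate domain -/

/-- The data of a stationary spacetime on an open set `O` of the coordinate space: the components
of a smooth non-degenerate metric `G`, of a smooth Killing field `X` with `G(X, X) = -e^{2α}`, and
of the unit field `u = e^{-α} X`. Non-degeneracy is `inv_mul`; the signature plays no role. -/
structure IsStationary (G : Ten) (X u : Vec) (α : Scal) (O : Set Coord) : Prop where
  isOpen : IsOpen O
  smooth_metric : ∀ i j, ContDiffOn ℝ ∞ (fun y => G y i j) O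
  symm : ∀ y ∈ O, ∀ i j, G y i j = G y j i
  inv_mul : ∀ y ∈ O, (G y)⁻¹ * G y = 1
  smooth_field : ∀ i, ContDiffOn ℝ ∞ (fun y => X y i) O
  smooth_log : ContDiffOn ℝ ∞ α O
  norm : ∀ y ∈ O, ∑ i, ∑ j, G y i j * X y i * X y j = -Real.exp (2 * α y)
  unit : ∀ y ∈ O, ∀ i, u y i = Real.exp (-1 * α y) * X y i
  killing : ∀ y ∈ O, lieMetric G X y = 0

/-- A smooth family of invertible matrices has a smooth inverse. -/
theorem contDiffOn_inv {G : Ten} {O : Set Coord} (hG : ∀ i j, ContDiffOn ℝ ∞ (fun y => G y i j) O)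
    (hdet : ∀ y ∈ O, (G y).det ≠ 0) (i j : Fin 4) : ContDiffOn ℝ ∞ (fun y => (G y)⁻¹ i j) O := by
  have hd : ∀ A : Coord → Matrix (Fin 4) (Fin 4) ℝ, (∀ i j, ContDiffOn ℝ ∞ (fun y => A y i j) O) →
      ContDiffOn ℝ ∞ (fun y => (A y).det) O := by
    intro A hA
    simp only [Matrix.det_apply]
    refine ContDiffOn.sum fun σ _ => ?_
    exact (contDiffOn_prod fun k _ => hA _ _).const_smul _
  have : (fun y => (G y)⁻¹ i j) = fun y => (G y).det⁻¹ * (G y).adjugate i j := by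
    ext y; simp [Matrix.inv_def]
  rw [this]
  refine ((hd G hG).inv hdet).mul ?_
  simp only [Matrix.adjugate_apply]
  refine hd _ fun k l => ?_
  simp only [Matrix.updateRow_apply]
  split_ifs
  · exact contDiffOn_const
  · exact hG k l

namespace IsStationary

variable {G : Ten} {X u : Vec} {α : Scal} {O : Set Coord}

theorem differentiableAt (S : IsStationary G X u α O) {f : Scal} (hf : ContDiffOn ℝ ∞ f O)
    {y : Coord} (hy : y ∈ O) : DifferentiableAt ℝ f y :=
  (hf.contDiffAt (S.isOpen.mem_nhds hy)).differentiableAt (by simp)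

theorem mul_inv (S : IsStationary G X u α O) {y : Coord} (hy : y ∈ O) : G y * (G y)⁻¹ = 1 :=
  mul_eq_one_comm.mp (S.inv_mul y hy)

theorem inv_mul_apply (S : IsStationary G X u α O) {y : Coord} (hy : y ∈ O) (i j : Fin 4) :
    ∑ k, (G y)⁻¹ i k * G y k j = if i = j then 1 else 0 := by
  rw [← Matrix.mul_apply, S.inv_mul y hy, Matrix.one_apply]

theorem mul_inv_apply (S : IsStationary G X u α O) {y : Coord} (hy : y ∈ O) (i j : Fin 4) :
    ∑ k, G y i k * (G y)⁻¹ k j = if i = j then 1 else 0 := by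
  rw [← Matrix.mul_apply, S.mul_inv hy, Matrix.one_apply]

theorem inv_symm (S : IsStationary G X u α O) {y : Coord} (hy : y ∈ O) (i j : Fin 4) :
    (G y)⁻¹ i j = (G y)⁻¹ j i := by
  have h : (G y).transpose = G y := by ext i j; exact S.symm y hy j i
  conv_lhs => rw [← h, ← Matrix.transpose_nonsing_inv]
  rfl

theorem smooth_inv (S : IsStationary G X u α O) (i j : Fin 4) :
    ContDiffOn ℝ ∞ (fun y => (G y)⁻¹ i j) O := by
  refine contDiffOn_inv S.smooth_metric (fun y hy h => ?_) i j
  have := congrArg Matrix.det (S.inv_mul y hy)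
  simp [h] at this

theorem smooth_unit (S : IsStationary G X u α O) (i : Fin 4) :
    ContDiffOn ℝ ∞ (fun y => u y i) O :=
  ((((contDiffOn_const (c := (-1 : ℝ))).mul S.smooth_log).exp).mul (S.smooth_field i)).congr
    fun y hy => S.unit y hy i

theorem smooth_lower (S : IsStationary G X u α O) (i : Fin 4) :
    ContDiffOn ℝ ∞ (fun y => uF G u y i) O := by
  change ContDiffOn ℝ ∞ (fun y => ∑ j, G y i j * u y j) O
  exact ContDiffOn.sum fun j _ => (S.smooth_metric i j).mul (S.smooth_unit j)

theorem pd_metric_symm (S : IsStationary G X u α O) {y : Coord} (hy : y ∈ O) (k i j : Fin 4) :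
    pd k (fun q => G q i j) y = pd k (fun q => G q j i) y :=
  pd_congr (Filter.eventuallyEq_of_mem (S.isOpen.mem_nhds hy) fun q hq => S.symm q hq i j) k

theorem killing_apply (S : IsStationary G X u α O) {y : Coord} (hy : y ∈ O) (i j : Fin 4) :
    ∑ k, (X y k * pd k (fun q => G q i j) y + G y k j * pd i (fun q => X q k) y
      + G y i k * pd j (fun q => X q k) y) = 0 :=
  congrFun (congrFun (S.killing y hy) i) j

/-- The differential of `G(X, X) = -e^{2α}`. -/
theorem pd_norm (S : IsStationary G X u α O) {y : Coord} (hy : y ∈ O) (k : Fin 4) :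
    ∑ i, ∑ j, (pd k (fun q => G q i j) y * X y i * X y j
      + 2 * G y i j * X y i * pd k (fun q => X q j) y) = -(2 * pd k α y * Real.exp (2 * α y)) := by
  have hG := fun i j => S.differentiableAt (S.smooth_metric i j) hy
  have hX := fun i => S.differentiableAt (S.smooth_field i) hy
  have h1 : pd k (fun q => ∑ i, ∑ j, G q i j * X q i * X q j) y
      = pd k (fun q => -1 * Real.exp (2 * α q)) y :=
    pd_congr (Filter.eventuallyEq_of_mem (S.isOpen.mem_nhds hy) fun q hq => by
      simp [S.norm q hq]) k
  have h2 : pd k (fun q => -1 * Real.exp (2 * α q)) y = -(2 * pd k α y * Real.exp (2 * α y)) := by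
    have hα := S.differentiableAt S.smooth_log hy
    rw [pd_mul (differentiableAt_const _) ((hα.const_mul 2).exp), pd_const, pd_exp_mul hα]
    ring
  rw [← h2, ← h1, pd_sum _ (fun i _ => by fun_prop)]
  have h3 : ∀ i, pd k (fun q => ∑ j, G q i j * X q i * X q j) y
      = ∑ j, (pd k (fun q => G q i j) y * X y i * X y j
        + G y i j * pd k (fun q => X q i) y * X y j
        + G y i j * X y i * pd k (fun q => X q j) y) := by
    intro i
    rw [pd_sum _ (fun j _ => by fun_prop)]
    refine Finset.sum_congr rfl fun j _ => ?_
    rw [pd_mul (by fun_prop) (hX j), pd_mul (hG i j) (hX i)]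
    ring
  simp only [h3, Finset.sum_add_distrib]
  have h4 : ∑ i, ∑ j, G y i j * pd k (fun q => X q i) y * X y j
      = ∑ i, ∑ j, G y i j * X y i * pd k (fun q => X q j) y := by
    rw [Finset.sum_comm]
    refine Finset.sum_congr rfl fun i _ => Finset.sum_congr rfl fun j _ => ?_
    rw [S.symm y hy j i]; ring
  have h5 : ∑ i, ∑ j, 2 * G y i j * X y i * pd k (fun q => X q j) y
      = 2 * ∑ i, ∑ j, G y i j * X y i * pd k (fun q => X q j) y := by
    simp only [Finset.mul_sum, mul_assoc]
  rw [h4, h5]; ring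

/-- The Killing equation contracted with the Killing field. -/
theorem killing_contract (S : IsStationary G X u α O) {y : Coord} (hy : y ∈ O) (j : Fin 4) :
    ∑ i, ∑ k, (X y i * X y k * pd k (fun q => G q i j) y
      + X y i * G y k j * pd i (fun q => X q k) y
      + X y i * G y i k * pd j (fun q => X q k) y) = 0 := by
  have : ∀ i, X y i * ∑ k, (X y k * pd k (fun q => G q i j) y + G y k j * pd i (fun q => X q k) y
      + G y i k * pd j (fun q => X q k) y) = 0 := fun i => by rw [S.killing_apply hy, mul_zero]
  rw [← Finset.sum_eq_zero (s := Finset.univ) fun i _ => this i]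
  refine Finset.sum_congr rfl fun i _ => ?_
  rw [Finset.mul_sum]
  exact Finset.sum_congr rfl fun k _ => by ring

/-- The norm of the Killing field is constant along it: this is the Killing equation contracted
twice with the field, compared with the derivative of the norm along the field. -/
theorem field_log (S : IsStationary G X u α O) {y : Coord} (hy : y ∈ O) :
    ∑ k, X y k * pd k α y = 0 := by
  have h1 : ∑ k, X y k * (∑ i, ∑ j, (pd k (fun q => G q i j) y * X y i * X y j
      + 2 * G y i j * X y i * pd k (fun q => X q j) y)) =
      -(2 * Real.exp (2 * α y)) * ∑ k, X y k * pd k α y := by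
    rw [Finset.mul_sum]
    refine Finset.sum_congr rfl fun k _ => ?_
    rw [S.pd_norm hy]; ring
  have h2 : ∑ j, X y j * ∑ i, ∑ k, (X y i * X y k * pd k (fun q => G q i j) y
      + X y i * G y k j * pd i (fun q => X q k) y
      + X y i * G y i k * pd j (fun q => X q k) y) = 0 :=
    Finset.sum_eq_zero fun j _ => by rw [S.killing_contract hy, mul_zero]
  have h3 : ∑ k, X y k * (∑ i, ∑ j, (pd k (fun q => G q i j) y * X y i * X y j
      + 2 * G y i j * X y i * pd k (fun q => X q j) y)) =
      ∑ j, X y j * ∑ i, ∑ k, (X y i * X y k * pd k (fun q => G q i j) y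
      + X y i * G y k j * pd i (fun q => X q k) y
      + X y i * G y i k * pd j (fun q => X q k) y) := by
    have e1 : ∑ j, ∑ i, ∑ k, X y j * (X y i * X y k * pd k (fun q => G q i j) y)
        = ∑ k, ∑ i, ∑ j, X y k * (pd k (fun q => G q i j) y * X y i * X y j) := by
      rw [Finset.sum_comm]
      conv_rhs => rw [Finset.sum_comm]
      refine Finset.sum_congr rfl fun i _ => ?_
      rw [Finset.sum_comm]
      exact Finset.sum_congr rfl fun j _ => Finset.sum_congr rfl fun k _ => by ring
    have e2 : ∑ j, ∑ i, ∑ k, X y j * (X y i * G y k j * pd i (fun q => X q k) y)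
        = ∑ j, ∑ i, ∑ k, X y j * (X y i * G y i k * pd j (fun q => X q k) y) := by
      rw [Finset.sum_comm]
      refine Finset.sum_congr rfl fun i _ => Finset.sum_congr rfl fun j _ =>
        Finset.sum_congr rfl fun k _ => ?_
      rw [S.symm y hy k j]; ring
    have e3 : ∑ k, ∑ i, ∑ j, X y k * (2 * G y i j * X y i * pd k (fun q => X q j) y)
        = 2 * ∑ j, ∑ i, ∑ k, X y j * (X y i * G y i k * pd j (fun q => X q k) y) := by
      simp only [Finset.mul_sum]
      exact Finset.sum_congr rfl fun j _ => Finset.sum_congr rfl fun k _ =>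
        Finset.sum_congr rfl fun k _ => by ring
    simp only [Finset.mul_sum, mul_add, Finset.sum_add_distrib]
    simp only [Finset.mul_sum] at e3
    rw [e1, e2, e3]
    simp only [← Finset.mul_sum]; ring
  rw [h1, h2] at h3
  have := Real.exp_pos (2 * α y)
  rcases mul_eq_zero.mp h3 with h | h
  · linarith
  · exact h

end IsStationary

namespace IsStationary

variable {G : Ten} {X u : Vec} {α : Scal} {O : Set Coord}

/-- Differentiating the relation `G⁻¹ G = 1`. -/
theorem pd_inv (S : IsStationary G X u α O) {y : Coord} (hy : y ∈ O) (i k j : Fin 4) :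
    pd i (fun q => (G q)⁻¹ k j) y
      = -∑ a, ∑ b, (G y)⁻¹ k a * pd i (fun q => G q a b) y * (G y)⁻¹ b j := by
  have hG := fun i j => S.differentiableAt (S.smooth_metric i j) hy
  have hH := fun i j => S.differentiableAt (S.smooth_inv i j) hy
  have h1 : ∀ b, ∑ a, (pd i (fun q => (G q)⁻¹ k a) y * G y a b
      + (G y)⁻¹ k a * pd i (fun q => G q a b) y) = 0 := by
    intro b
    have h2 : pd i (fun q => ∑ a, (G q)⁻¹ k a * G q a b) y = 0 :=
      pd_eq_zero_of_eventually_const (c := if k = b then 1 else 0)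
        (Filter.eventuallyEq_of_mem (S.isOpen.mem_nhds hy) fun q hq => S.inv_mul_apply hq k b) i
    rw [pd_sum _ (fun a _ => (hH k a).fun_mul (hG a b))] at h2
    rw [← h2]
    exact Finset.sum_congr rfl fun a _ => (pd_mul (hH k a) (hG a b) i).symm
  have h3 : ∑ b, (∑ a, (pd i (fun q => (G q)⁻¹ k a) y * G y a b
      + (G y)⁻¹ k a * pd i (fun q => G q a b) y)) * (G y)⁻¹ b j = 0 :=
    Finset.sum_eq_zero fun b _ => by rw [h1, zero_mul]
  have h4 : ∑ b, ∑ a, pd i (fun q => (G q)⁻¹ k a) y * G y a b * (G y)⁻¹ b j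
      = pd i (fun q => (G q)⁻¹ k j) y := by
    rw [Finset.sum_comm]
    simp only [mul_assoc, ← Finset.mul_sum, S.mul_inv_apply hy]
    simp
  simp only [Finset.sum_mul, add_mul, Finset.sum_add_distrib] at h3
  rw [h4] at h3
  rw [Finset.sum_comm] at h3
  linarith

theorem sum_lower_christoffel (S : IsStationary G X u α O) {y : Coord} (hy : y ∈ O)
    (k i l : Fin 4) : ∑ j, G y k j * christoffel G j i l y
      = (1 / 2) * (pd i (fun q => G q l k) y + pd l (fun q => G q i k) y
        - pd k (fun q => G q i l) y) := by
  have h : ∀ j, G y k j * christoffel G j i l y = ∑ m, (1 / 2) * ((G y k j * (G y)⁻¹ j m) *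
      (pd i (fun q => G q l m) y + pd l (fun q => G q i m) y - pd m (fun q => G q i l) y)) := by
    intro j
    rw [christoffel, Finset.mul_sum, Finset.mul_sum]
    exact Finset.sum_congr rfl fun m _ => by ring
  simp only [h]
  rw [Finset.sum_comm]
  simp only [← Finset.mul_sum, ← Finset.sum_mul, S.mul_inv_apply hy]
  simp

theorem sum_christoffel_trace (S : IsStationary G X u α O) {y : Coord} (hy : y ∈ O) (k : Fin 4) :
    ∑ i, christoffel G i i k y = (1 / 2) * ∑ i, ∑ l, (G y)⁻¹ i l * pd k (fun q => G q i l) y := by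
  simp only [christoffel, ← Finset.mul_sum]
  congr 1
  simp only [mul_sub, mul_add, Finset.sum_sub_distrib, Finset.sum_add_distrib]
  have : ∑ i, ∑ l, (G y)⁻¹ i l * pd l (fun q => G q i k) y
      = ∑ i, ∑ l, (G y)⁻¹ i l * pd i (fun q => G q k l) y := by
    rw [Finset.sum_comm]
    refine Finset.sum_congr rfl fun i _ => Finset.sum_congr rfl fun l _ => ?_
    rw [S.inv_symm hy l i, S.pd_metric_symm hy i l k]
  rw [this]; ring

/-- The inverse metric is parallel. -/
theorem pd_inv_add_christoffel (S : IsStationary G X u α O) {y : Coord} (hy : y ∈ O)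
    (i k j : Fin 4) : pd i (fun q => (G q)⁻¹ k j) y
      + ∑ l, (christoffel G k i l y * (G y)⁻¹ l j + christoffel G j i l y * (G y)⁻¹ k l) = 0 := by
  rw [S.pd_inv hy, Finset.sum_add_distrib]
  have h1 : ∑ l, christoffel G k i l y * (G y)⁻¹ l j
      = ∑ l, ∑ m, (1 / 2) * ((G y)⁻¹ k m * (G y)⁻¹ l j * (pd i (fun q => G q l m) y
        + pd l (fun q => G q i m) y - pd m (fun q => G q i l) y)) := by
    refine Finset.sum_congr rfl fun l _ => ?_
    rw [christoffel, Finset.mul_sum, Finset.sum_mul]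
    exact Finset.sum_congr rfl fun m _ => by ring
  have h2 : ∑ l, christoffel G j i l y * (G y)⁻¹ k l
      = ∑ l, ∑ m, (1 / 2) * ((G y)⁻¹ k m * (G y)⁻¹ l j * (pd i (fun q => G q l m) y
        - pd l (fun q => G q i m) y + pd m (fun q => G q i l) y)) := by
    rw [Finset.sum_comm]
    refine Finset.sum_congr rfl fun l _ => ?_
    rw [christoffel, Finset.mul_sum, Finset.sum_mul]
    refine Finset.sum_congr rfl fun m _ => ?_
    rw [S.inv_symm hy m j, S.pd_metric_symm hy i m l]; ring
  rw [h1, h2, ← Finset.sum_add_distrib, Finset.sum_comm (f := fun a b => (G y)⁻¹ k a * _ * _),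
    neg_add_eq_zero]
  refine Finset.sum_congr rfl fun l _ => ?_
  rw [← Finset.sum_add_distrib]
  refine Finset.sum_congr rfl fun m _ => ?_
  rw [S.pd_metric_symm hy i m l]; ring

theorem pd_unit (S : IsStationary G X u α O) {y : Coord} (hy : y ∈ O) (i j : Fin 4) :
    pd i (fun q => u q j) y
      = Real.exp (-1 * α y) * (pd i (fun q => X q j) y - pd i α y * X y j) := by
  have hα := S.differentiableAt S.smooth_log hy
  rw [pd_congr (Filter.eventuallyEq_of_mem (S.isOpen.mem_nhds hy) fun q hq => S.unit q hq j),
    pd_mul ((hα.const_mul _).exp) (S.differentiableAt (S.smooth_field j) hy), pd_exp_mul hα]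
  ring

theorem unit_log (S : IsStationary G X u α O) {y : Coord} (hy : y ∈ O) :
    ∑ k, u y k * pd k α y = 0 := by
  simp only [S.unit y hy, mul_assoc, ← Finset.mul_sum, S.field_log hy, mul_zero]

/-- The acceleration of the unit field along a Killing field is the gradient of `α`: by the Killing
equation `∇_X X = -½ grad G(X, X)`, and `G(X, X) = -e^{2α}` with `α` invariant along `X`. -/
theorem acc_eq (S : IsStationary G X u α O) {y : Coord} (hy : y ∈ O) :
    acc G u y = grad α y := by
  ext k
  -- `h1` evaluates the part of `u^i ∇_i u_k` with derivatives of the field, `h4` the part with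
  -- Christoffel symbols
  have h1 : ∑ i, u y i * ∑ j, G y k j * pd i (fun q => u q j) y
      = Real.exp (-1 * α y) ^ 2 * ∑ i, ∑ j, X y i * G y j k * pd i (fun q => X q j) y := by
    have h2 : ∑ i, ∑ j, X y i * G y k j * (pd i α y * X y j) = 0 := by
      rw [Finset.sum_comm]
      refine Finset.sum_eq_zero fun j _ => ?_
      have : ∀ i, X y i * G y k j * (pd i α y * X y j)
          = (G y k j * X y j) * (X y i * pd i α y) := fun i => by ring
      simp only [this, ← Finset.mul_sum, S.field_log hy, mul_zero]
    have h3 : ∑ i, u y i * ∑ j, G y k j * pd i (fun q => u q j) y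
        = Real.exp (-1 * α y) ^ 2 * (∑ i, ∑ j, X y i * G y j k * pd i (fun q => X q j) y
          - ∑ i, ∑ j, X y i * G y k j * (pd i α y * X y j)) := by
      rw [← Finset.sum_sub_distrib]
      simp only [← Finset.sum_sub_distrib, Finset.mul_sum]
      refine Finset.sum_congr rfl fun i _ => Finset.sum_congr rfl fun j _ => ?_
      rw [S.unit y hy, S.pd_unit hy, S.symm y hy j k]; ring
    rw [h3, h2, sub_zero]
  have h4 : ∑ i, u y i * ∑ j, ∑ l, G y k j * (christoffel G j i l y * u y l)
      = Real.exp (-1 * α y) ^ 2 * (∑ i, ∑ l, X y i * X y l * pd l (fun q => G q i k) y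
        - (1 / 2) * ∑ i, ∑ l, pd k (fun q => G q i l) y * X y i * X y l) := by
    have h5 : ∑ i, u y i * ∑ j, ∑ l, G y k j * (christoffel G j i l y * u y l)
        = ∑ i, ∑ l, Real.exp (-1 * α y) ^ 2 * (X y i * X y l * ((1 / 2) *
          (pd i (fun q => G q l k) y + pd l (fun q => G q i k) y - pd k (fun q => G q i l) y))) := by
      refine Finset.sum_congr rfl fun i _ => ?_
      rw [Finset.sum_comm, Finset.mul_sum]
      refine Finset.sum_congr rfl fun l _ => ?_
      have : ∀ j, G y k j * (christoffel G j i l y * u y l)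
          = u y l * (G y k j * christoffel G j i l y) := fun j => by ring
      simp only [this, ← Finset.mul_sum]
      rw [S.sum_lower_christoffel hy, S.unit y hy, S.unit y hy]
      ring
    have h6 : ∑ i, ∑ l, X y i * X y l * pd i (fun q => G q l k) y
        = ∑ i, ∑ l, X y i * X y l * pd l (fun q => G q i k) y := by
      rw [Finset.sum_comm]
      exact Finset.sum_congr rfl fun i _ => Finset.sum_congr rfl fun l _ => by ring
    have h7 : ∑ i, ∑ l, X y i * X y l * ((1 / 2) *
          (pd i (fun q => G q l k) y + pd l (fun q => G q i k) y - pd k (fun q => G q i l) y))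
        = (1 / 2) * (∑ i, ∑ l, X y i * X y l * pd i (fun q => G q l k) y
          + ∑ i, ∑ l, X y i * X y l * pd l (fun q => G q i k) y
          - ∑ i, ∑ l, pd k (fun q => G q i l) y * X y i * X y l) := by
      simp only [← Finset.sum_add_distrib, ← Finset.sum_sub_distrib, Finset.mul_sum]
      exact Finset.sum_congr rfl fun i _ => Finset.sum_congr rfl fun l _ => by ring
    rw [h5]
    simp only [← Finset.mul_sum]
    rw [h7, h6]; ring
  have h8 : acc G u y k = ∑ i, u y i * ∑ j, G y k j * pd i (fun q => u q j) y
      + ∑ i, u y i * ∑ j, ∑ l, G y k j * (christoffel G j i l y * u y l) := by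
    simp only [acc, lower, covD, Finset.mul_sum, ← Finset.sum_add_distrib, mul_add]
    rw [Finset.sum_comm]
    refine Finset.sum_congr rfl fun i _ => Finset.sum_congr rfl fun j _ => ?_
    congr 1
    · ring
    · exact Finset.sum_congr rfl fun l _ => by ring
  have hK := S.killing_contract hy k
  have hN := S.pd_norm hy k
  simp only [Finset.sum_add_distrib] at hK hN
  have hC : ∑ i, ∑ j, 2 * G y i j * X y i * pd k (fun q => X q j) y
      = 2 * ∑ i, ∑ j, X y i * G y i j * pd k (fun q => X q j) y := by
    simp only [Finset.mul_sum]
    exact Finset.sum_congr rfl fun i _ => Finset.sum_congr rfl fun l _ => by ring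
  rw [hC] at hN
  have hE : Real.exp (-1 * α y) ^ 2 * Real.exp (2 * α y) = 1 := by
    rw [← Real.exp_nat_mul, ← Real.exp_add]; simp
  rw [h8, h1, h4, grad]
  linear_combination Real.exp (-1 * α y) ^ 2 * hK - (1 / 2) * Real.exp (-1 * α y) ^ 2 * hN
    + pd k α y * hE

/-- The unit field along a Killing field has no expansion: `∇ · X` is half the trace of the Killing
equation, and `α` is invariant along `X`. -/
theorem expan_eq_zero (S : IsStationary G X u α O) {y : Coord} (hy : y ∈ O) :
    expan G u y = 0 := by
  have h1 : expan G u y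
      = ∑ i, pd i (fun q => u q i) y + ∑ k, (∑ i, christoffel G i i k y) * u y k := by
    simp only [expan, covD, Finset.sum_add_distrib, Finset.sum_mul]
    rw [Finset.sum_comm (f := fun i k => christoffel G i i k y * u y k)]
  have h2 : ∑ i, pd i (fun q => u q i) y = Real.exp (-1 * α y) * ∑ i, pd i (fun q => X q i) y := by
    simp only [S.pd_unit hy, ← Finset.mul_sum, Finset.sum_sub_distrib]
    have : ∑ i, pd i α y * X y i = 0 := by
      rw [← S.field_log hy]
      exact Finset.sum_congr rfl fun i _ => mul_comm _ _
    rw [this, sub_zero]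
  have h3 : ∑ k, (∑ i, christoffel G i i k y) * u y k = Real.exp (-1 * α y) * ((1 / 2) *
      ∑ i, ∑ l, (G y)⁻¹ i l * ∑ k, X y k * pd k (fun q => G q i l) y) := by
    simp only [S.sum_christoffel_trace hy, S.unit y hy, Finset.mul_sum, Finset.sum_mul]
    rw [Finset.sum_comm]
    refine Finset.sum_congr rfl fun i _ => ?_
    rw [Finset.sum_comm]
    exact Finset.sum_congr rfl fun l _ => Finset.sum_congr rfl fun k _ => by ring
  have h4 : ∑ i, ∑ l, (G y)⁻¹ i l * (∑ k, X y k * pd k (fun q => G q i l) y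
      + (∑ k, G y k l * pd i (fun q => X q k) y + ∑ k, G y i k * pd l (fun q => X q k) y)) = 0 := by
    refine Finset.sum_eq_zero fun i _ => Finset.sum_eq_zero fun l _ => ?_
    have := S.killing_apply hy i l
    simp only [Finset.sum_add_distrib] at this
    rw [← add_assoc, this, mul_zero]
  have h5 : ∑ i, ∑ l, (G y)⁻¹ i l * ∑ k, G y k l * pd i (fun q => X q k) y
      = ∑ i, pd i (fun q => X q i) y := by
    refine Finset.sum_congr rfl fun i _ => ?_
    simp only [Finset.mul_sum]
    rw [Finset.sum_comm]
    have : ∀ k l, (G y)⁻¹ i l * (G y k l * pd i (fun q => X q k) y)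
        = (G y)⁻¹ i l * G y l k * pd i (fun q => X q k) y := fun k l => by
      rw [S.symm y hy k l]; ring
    simp only [this, ← Finset.sum_mul, S.inv_mul_apply hy]
    simp
  have h6 : ∑ i, ∑ l, (G y)⁻¹ i l * ∑ k, G y i k * pd l (fun q => X q k) y
      = ∑ i, pd i (fun q => X q i) y := by
    rw [← h5, Finset.sum_comm]
    refine Finset.sum_congr rfl fun i _ => Finset.sum_congr rfl fun l _ => ?_
    rw [S.inv_symm hy]
    congr 1
    exact Finset.sum_congr rfl fun k _ => by rw [S.symm y hy l k]
  simp only [mul_add, Finset.sum_add_distrib] at h4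
  rw [h5, h6] at h4
  rw [h1, h2, h3]
  linear_combination (1 / 2) * Real.exp (-1 * α y) * h4

/-- The divergence of the energy tensor, in terms of the kinematics of the velocity. -/
theorem divT_energyT (S : IsStationary G X u α O) {y : Coord} (hy : y ∈ O) {r q : Scal}
    (hr : DifferentiableAt ℝ r y) (hq : DifferentiableAt ℝ q y) (j : Fin 4) :
    divT G (energyT G u r q) y j = (∑ i, u y i * (pd i r y + pd i q y)) * u y j
      + (r y + q y) * (expan G u y * u y j + ∑ i, u y i * covD G u i j y)
      + ∑ i, pd i q y * (G y)⁻¹ i j := by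
  have hu := fun i => S.differentiableAt (S.smooth_unit i) hy
  have hH := fun i j => S.differentiableAt (S.smooth_inv i j) hy
  have h1 : ∀ i, pd i (fun x => energyT G u r q x i j) y
      = (pd i r y + pd i q y) * u y i * u y j + (r y + q y) * pd i (fun x => u x i) y * u y j
        + (r y + q y) * u y i * pd i (fun x => u x j) y + pd i q y * (G y)⁻¹ i j
        + q y * pd i (fun x => (G x)⁻¹ i j) y := by
    intro i
    simp only [energyT, Matrix.of_apply]
    rw [pd_add (((hr.fun_add hq).fun_mul (hu i)).fun_mul (hu j)) (hq.fun_mul (hH i j)),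
      pd_mul ((hr.fun_add hq).fun_mul (hu i)) (hu j), pd_mul (hr.fun_add hq) (hu i), pd_add hr hq,
      pd_mul hq (hH i j)]
    ring
  have h2 : divT G (energyT G u r q) y j = ∑ i, (
      ((u y i * (pd i r y + pd i q y)) * u y j
      + (r y + q y) * (covD G u i i y * u y j + u y i * covD G u i j y)
      + pd i q y * (G y)⁻¹ i j)
      + q y * (pd i (fun q => (G q)⁻¹ i j) y
      + ∑ l, (christoffel G i i l y * (G y)⁻¹ l j + christoffel G j i l y * (G y)⁻¹ i l))) := by
    refine Finset.sum_congr rfl fun i _ => ?_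
    rw [h1 i]
    simp only [covD, energyT, Matrix.of_apply, mul_add, add_mul, Finset.mul_sum, Finset.sum_mul,
      Finset.sum_add_distrib]
    have e1 : ∑ k, christoffel G i i k y * (r y * u y k * u y j)
        = ∑ k, r y * (christoffel G i i k y * u y k * u y j) :=
      Finset.sum_congr rfl fun k _ => by ring
    have e2 : ∑ k, christoffel G i i k y * (q y * u y k * u y j)
        = ∑ k, q y * (christoffel G i i k y * u y k * u y j) :=
      Finset.sum_congr rfl fun k _ => by ring
    have e3 : ∑ k, christoffel G j i k y * (r y * u y i * u y k)
        = ∑ k, r y * (u y i * (christoffel G j i k y * u y k)) :=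
      Finset.sum_congr rfl fun k _ => by ring
    have e4 : ∑ k, christoffel G j i k y * (q y * u y i * u y k)
        = ∑ k, q y * (u y i * (christoffel G j i k y * u y k)) :=
      Finset.sum_congr rfl fun k _ => by ring
    have e5 : ∑ k, christoffel G i i k y * (q y * (G y)⁻¹ k j)
        = ∑ k, q y * (christoffel G i i k y * (G y)⁻¹ k j) :=
      Finset.sum_congr rfl fun k _ => by ring
    have e6 : ∑ k, christoffel G j i k y * (q y * (G y)⁻¹ i k)
        = ∑ k, q y * (christoffel G j i k y * (G y)⁻¹ i k) :=
      Finset.sum_congr rfl fun k _ => by ring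
    rw [e1, e2, e3, e4, e5, e6]; ring
  rw [h2]
  simp only [S.pd_inv_add_christoffel hy, mul_zero, add_zero]
  simp only [Finset.sum_add_distrib, ← Finset.sum_mul, ← Finset.mul_sum, expan]

end IsStationary

/-! ### The Levi-Civita symbol -/

/-- The Levi-Civita symbol as a quotient of Vandermonde determinants: permuting the rows of the
Vandermonde matrix of `0, 1, 2, 3`, whose determinant is `12`, multiplies the determinant by the
symbol. -/
theorem eps_eq (i j k l : Fin 4) : eps i j k l =
    ((j : ℝ) - i) * (k - i) * (l - i) * (k - j) * (l - j) * (l - k) / 12 := by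
  have h := Matrix.det_mul (Matrix.of fun r c : Fin 4 => if ![i, j, k, l] r = c then (1 : ℝ) else 0)
    (Matrix.vandermonde fun c : Fin 4 => (c : ℝ))
  have hm : (Matrix.of fun r c : Fin 4 => if ![i, j, k, l] r = c then (1 : ℝ) else 0)
      * (Matrix.vandermonde fun c : Fin 4 => (c : ℝ))
      = Matrix.vandermonde fun r : Fin 4 => ((![i, j, k, l] r : Fin 4) : ℝ) := by
    ext r c
    simp [Matrix.mul_apply, Matrix.vandermonde_apply]
  rw [hm] at h
  have hI : ∀ r : Fin 4, Finset.Ioi r = Finset.univ.filter fun s => r < s := by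
    intro r; ext s; simp
  simp only [Matrix.det_vandermonde, hI, Finset.prod_filter, Fin.prod_univ_four] at h
  norm_num [Fin.lt_def] at h
  have h2 : (![i, j, k, l] : Fin 4 → Fin 4) 2 = k := rfl
  have h3 : (![i, j, k, l] : Fin 4 → Fin 4) 3 = l := rfl
  rw [h2, h3] at h
  rw [eps]
  linarith

/-- The dual of `x ∧ F` written out. -/
theorem sum_eps (x : Fin 4 → ℝ) (F : Matrix (Fin 4) (Fin 4) ℝ) (l : Fin 4) :
    ∑ i, ∑ j, ∑ k, x i * F j k * eps i j k l =
      ![-(x 1 * (F 2 3 - F 3 2) + x 2 * (F 3 1 - F 1 3) + x 3 * (F 1 2 - F 2 1)),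
        x 0 * (F 2 3 - F 3 2) + x 2 * (F 3 0 - F 0 3) + x 3 * (F 0 2 - F 2 0),
        -(x 0 * (F 1 3 - F 3 1) + x 1 * (F 3 0 - F 0 3) + x 3 * (F 0 1 - F 1 0)),
        x 0 * (F 1 2 - F 2 1) + x 1 * (F 2 0 - F 0 2) + x 2 * (F 0 1 - F 1 0)] l := by
  fin_cases l <;> simp [Fin.sum_univ_four, eps_eq] <;> ring

/-- The dual of `x ∧ F` vanishes only if `x ∧ F` does, for an antisymmetric `F`. -/
theorem cyclic_of_sum_eps_eq_zero {x : Fin 4 → ℝ} {F : Matrix (Fin 4) (Fin 4) ℝ}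
    (hF : ∀ j k, F j k = -F k j) (h : ∀ l, ∑ i, ∑ j, ∑ k, x i * F j k * eps i j k l = 0)
    (i j k : Fin 4) : x i * F j k + x j * F k i + x k * F i j = 0 := by
  have h0 := h 0
  have h1 := h 1
  have h2 := h 2
  have h3 := h 3
  simp only [sum_eps] at h0 h1 h2 h3
  simp at h0 h1 h2 h3
  have d : ∀ j, F j j = 0 := fun j => by linarith [hF j j]
  have a1 := hF 1 0
  have a2 := hF 2 0
  have a3 := hF 3 0
  have a4 := hF 2 1
  have a5 := hF 3 1
  have a6 := hF 3 2
  rw [a1, a2, a4] at h3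
  rw [a1, a3, a5] at h2
  rw [a2, a3, a6] at h1
  rw [a4, a5, a6] at h0
  fin_cases i <;> fin_cases j <;> fin_cases k <;> simp [d] <;>
    simp only [a1, a2, a3, a4, a5, a6] <;> linarith

/-- Converse of `cyclic_of_sum_eps_eq_zero`, with the antisymmetric part of an arbitrary `F`. -/
theorem sum_eps_eq_zero_of_cyclic {x : Fin 4 → ℝ} {F : Matrix (Fin 4) (Fin 4) ℝ}
    (h : ∀ i j k, x i * (F j k - F k j) + x j * (F k i - F i k) + x k * (F i j - F j i) = 0)
    (l : Fin 4) : ∑ i, ∑ j, ∑ k, x i * F j k * eps i j k l = 0 := by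
  rw [sum_eps]
  have h0 := h 1 2 3
  have h1 := h 0 2 3
  have h2 := h 0 1 3
  have h3 := h 0 1 2
  fin_cases l <;> simp <;> linarith

/-- If the volume of `U ∧ F ∧ A` vanishes, where `i(v)F = A` and `v(A) = 0` for a form `v` with
`v(U) = -1`, then `F ∧ A = 0`. Indeed `i(v)(F ∧ A) = A ∧ A = 0`, so that the dual of `F ∧ A` is a
multiple of `v`, and its value on `U` is the volume. -/
theorem cyclic_of_volume_eq_zero {U v A : Fin 4 → ℝ} {F : Matrix (Fin 4) (Fin 4) ℝ}
    (hF : ∀ j k, F j k = -F k j) (hU : ∑ i, v i * U i = -1) (hA : ∑ i, v i * A i = 0)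
    (hvF : ∀ j, ∑ i, v i * F i j = A j)
    (h : ∑ l, (∑ i, ∑ j, ∑ k, U i * F j k * eps i j k l) * A l = 0) (j k l : Fin 4) :
    F j k * A l + F k l * A j + F l j * A k = 0 := by
  have hvB : ∀ k l, ∑ j, v j * (F j k * A l + F k l * A j + F l j * A k) = 0 := by
    intro k l
    have : ∀ j, v j * (F j k * A l + F k l * A j + F l j * A k)
        = v j * F j k * A l + F k l * (v j * A j) - v j * F j l * A k :=
      fun j => by rw [hF l j]; ring
    simp only [this, Finset.sum_add_distrib, Finset.sum_sub_distrib, ← Finset.sum_mul,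
      ← Finset.mul_sum, hvF, hA]
    ring
  have d : ∀ j, F j j = 0 := fun j => by linarith [hF j j]
  have a1 := hF 1 0
  have a2 := hF 2 0
  have a3 := hF 3 0
  have a4 := hF 2 1
  have a5 := hF 3 1
  have a6 := hF 3 2
  have b1 := hvB 2 3
  have b2 := hvB 1 3
  have b3 := hvB 1 2
  have b4 := hvB 0 3
  have b5 := hvB 0 2
  have b6 := hvB 0 1
  simp only [sum_eps] at h
  rw [Fin.sum_univ_four] at h
  simp [a1, a2, a3, a4, a5, a6] at h
  rw [Fin.sum_univ_four] at hU
  -- the components of the dual of `F ∧ A`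
  obtain ⟨d0, hd0⟩ : ∃ d0, d0 = F 1 2 * A 3 + F 2 3 * A 1 - F 1 3 * A 2 := ⟨_, rfl⟩
  obtain ⟨d1, hd1⟩ : ∃ d1, d1 = -(F 0 2 * A 3 + F 2 3 * A 0 - F 0 3 * A 2) := ⟨_, rfl⟩
  obtain ⟨d2, hd2⟩ : ∃ d2, d2 = F 0 1 * A 3 + F 1 3 * A 0 - F 0 3 * A 1 := ⟨_, rfl⟩
  obtain ⟨d3, hd3⟩ : ∃ d3, d3 = -(F 0 1 * A 2 + F 1 2 * A 0 - F 0 2 * A 1) := ⟨_, rfl⟩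
  rw [Fin.sum_univ_four] at b1 b2 b3 b4 b5 b6
  simp only [d, a1, a2, a3, a4, a5, a6] at b1 b2 b3 b4 b5 b6
  -- `e1`, …, `e6` say that the dual is proportional to `v`, and `e0` is the vanishing of the volume
  have e1 : v 1 * d0 = v 0 * d1 := by rw [hd0, hd1]; linarith
  have e2 : v 2 * d0 = v 0 * d2 := by rw [hd0, hd2]; linarith
  have e3 : v 3 * d0 = v 0 * d3 := by rw [hd0, hd3]; linarith
  have e4 : v 2 * d1 = v 1 * d2 := by rw [hd1, hd2]; linarith
  have e5 : v 3 * d1 = v 1 * d3 := by rw [hd1, hd3]; linarith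
  have e6 : v 3 * d2 = v 2 * d3 := by rw [hd2, hd3]; linarith
  have e0 : U 0 * d0 + U 1 * d1 + U 2 * d2 + U 3 * d3 = 0 := by
    rw [hd0, hd1, hd2, hd3]; linarith
  have z0 : d0 = 0 := by
    linear_combination d0 * hU - v 0 * e0 - U 1 * e1 - U 2 * e2 - U 3 * e3
  have z1 : d1 = 0 := by
    linear_combination d1 * hU - v 1 * e0 + U 0 * e1 - U 2 * e4 - U 3 * e5
  have z2 : d2 = 0 := by
    linear_combination d2 * hU - v 2 * e0 + U 0 * e2 + U 1 * e4 - U 3 * e6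
  have z3 : d3 = 0 := by
    linear_combination d3 * hU - v 3 * e0 + U 0 * e3 + U 1 * e5 + U 2 * e6
  rw [hd0] at z0
  rw [hd1] at z1
  rw [hd2] at z2
  rw [hd3] at z3
  clear hvB b1 b2 b3 b4 b5 b6 e1 e2 e3 e4 e5 e6 e0 h hU hA hvF
  fin_cases j <;> fin_cases k <;> fin_cases l <;> simp [d] <;>
    simp only [a1, a2, a3, a4, a5, a6] <;> linarith

/-! ### Stationary fields: conservation and rotation -/

theorem grad_apply (f : Scal) (y : Coord) (i : Fin 4) : grad f y i = pd i f y := rfl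

/-- The 1-form `χ = e^{-α} u`, which is invariant along the Killing field. -/
def invForm (G : Ten) (u : Vec) (α : Scal) : Vec :=
  fun y i => Real.exp (-1 * α y) * uF G u y i

/-- The conservation equations at a point, for the density `r` and the pressure `q`, solved for the
gradient of the pressure: `X(r) = 0` and `dq = -X(q) χ - (r + q) dα`. -/
def FluidEq (G : Ten) (X u : Vec) (α r q : Scal) (y : Coord) : Prop :=
  ∑ i, X y i * pd i r y = 0 ∧
    ∀ j, pd j q y = -(∑ i, X y i * pd i q y) * invForm G u α y j - (r y + q y) * pd j α y

theorem exp_mul_exp (α : Scal) (y : Coord) :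
    Real.exp (-1 * α y) * Real.exp (-1 * α y) * Real.exp (2 * α y) = 1 := by
  rw [← Real.exp_add, ← Real.exp_add, Real.exp_eq_one_iff]; ring

/-- Raising both indices of a tensor of rank two. -/
def raise2 (G : Ten) (F : Ten) : Ten :=
  fun y => (G y)⁻¹ * F y * ((G y)⁻¹).transpose

theorem raise2_apply (G F : Ten) (y : Coord) (i j : Fin 4) :
    raise2 G F y i j = ∑ a, ∑ b, (G y)⁻¹ i a * F y a b * (G y)⁻¹ j b := by
  simp only [raise2, Matrix.mul_apply, Matrix.transpose_apply, Finset.sum_mul]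
  exact Finset.sum_comm

namespace IsStationary

variable {G : Ten} {X u : Vec} {α : Scal} {O : Set Coord}

theorem raise_lower (S : IsStationary G X u α O) {y : Coord} (hy : y ∈ O) (i : Fin 4) :
    raise G (uF G u) y i = u y i := by
  simp only [raise, uF, lower, Finset.mul_sum]
  rw [Finset.sum_comm]
  simp only [← mul_assoc, ← Finset.sum_mul, S.inv_mul_apply hy]
  simp

theorem sum_lower_raise (S : IsStationary G X u α O) {y : Coord} (hy : y ∈ O) (x : Vec)
    (i : Fin 4) : ∑ j, G y i j * raise G x y j = x y i := by
  simp only [raise, Finset.mul_sum]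
  rw [Finset.sum_comm]
  simp only [← mul_assoc, ← Finset.sum_mul, S.mul_inv_apply hy]
  simp

theorem sum_unit_lower (S : IsStationary G X u α O) {y : Coord} (hy : y ∈ O) :
    ∑ i, uF G u y i * u y i = -1 := by
  have : ∑ i, uF G u y i * u y i = Real.exp (-1 * α y) * Real.exp (-1 * α y) *
      ∑ i, ∑ j, G y i j * X y i * X y j := by
    simp only [uF, lower, Finset.sum_mul, Finset.mul_sum, S.unit y hy]
    exact Finset.sum_congr rfl fun i _ => Finset.sum_congr rfl fun j _ => by ring
  rw [this, S.norm y hy]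
  linarith [exp_mul_exp α y]

theorem sum_field_invForm (S : IsStationary G X u α O) {y : Coord} (hy : y ∈ O) :
    ∑ i, X y i * invForm G u α y i = -1 := by
  rw [← S.sum_unit_lower hy]
  refine Finset.sum_congr rfl fun i _ => ?_
  rw [S.unit y hy, invForm]; ring

theorem sum_lower_divT (S : IsStationary G X u α O) {y : Coord} (hy : y ∈ O) {r q : Scal}
    (hr : DifferentiableAt ℝ r y) (hq : DifferentiableAt ℝ q y) (k : Fin 4) :
    ∑ j, G y k j * divT G (energyT G u r q) y j
      = (∑ i, u y i * pd i r y + ∑ i, u y i * pd i q y) * uF G u y k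
        + (r y + q y) * pd k α y + pd k q y := by
  have h1 : ∀ j, G y k j * divT G (energyT G u r q) y j
      = (∑ i, u y i * pd i r y + ∑ i, u y i * pd i q y) * (G y k j * u y j)
        + (r y + q y) * (G y k j * ∑ i, u y i * covD G u i j y)
        + ∑ i, pd i q y * (G y k j * (G y)⁻¹ j i) := by
    intro j
    rw [S.divT_energyT hy hr hq, S.expan_eq_zero hy, mul_add, mul_add]
    simp only [mul_add, Finset.sum_add_distrib, Finset.mul_sum]
    congr 1
    · ring_nf
    · exact Finset.sum_congr rfl fun i _ => by rw [S.inv_symm hy i j]; ring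
  simp only [h1, Finset.sum_add_distrib, ← Finset.mul_sum]
  have h2 : ∑ j, ∑ i, pd i q y * (G y k j * (G y)⁻¹ j i) = pd k q y := by
    rw [Finset.sum_comm]
    simp only [← Finset.mul_sum, S.mul_inv_apply hy]
    simp
  have h3 : ∑ j, G y k j * ∑ i, u y i * covD G u i j y = pd k α y :=
    congrFun (S.acc_eq hy) k
  rw [h2, h3]
  rfl

/-- The conservation of the energy tensor, split along and across the velocity. -/
theorem divT_eq_zero_iff (S : IsStationary G X u α O) {y : Coord} (hy : y ∈ O) {r q : Scal}
    (hr : DifferentiableAt ℝ r y) (hq : DifferentiableAt ℝ q y) :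
    divT G (energyT G u r q) y = 0 ↔ FluidEq G X u α r q y := by
  have hD := S.sum_lower_divT hy hr hq
  have he := Real.exp_pos (-1 * α y)
  have hu : ∀ f : Scal, ∑ i, u y i * pd i f y = Real.exp (-1 * α y) * ∑ i, X y i * pd i f y := by
    intro f
    rw [Finset.mul_sum]
    exact Finset.sum_congr rfl fun i _ => by rw [S.unit y hy]; ring
  constructor
  · intro h
    simp only [h, Pi.zero_apply, mul_zero, Finset.sum_const_zero] at hD
    have h0 : ∑ k, u y k * ((∑ i, u y i * pd i r y + ∑ i, u y i * pd i q y) * uF G u y k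
        + (r y + q y) * pd k α y + pd k q y) = 0 :=
      Finset.sum_eq_zero fun k _ => by rw [← hD k, mul_zero]
    have h1 : ∑ k, u y k * ((∑ i, u y i * pd i r y + ∑ i, u y i * pd i q y) * uF G u y k
        + (r y + q y) * pd k α y + pd k q y)
        = (∑ i, u y i * pd i r y + ∑ i, u y i * pd i q y) * (∑ k, uF G u y k * u y k)
        + (r y + q y) * (∑ k, u y k * pd k α y) + ∑ i, u y i * pd i q y := by
      generalize ∑ i, u y i * pd i r y + ∑ i, u y i * pd i q y = s
      simp only [Finset.mul_sum, ← Finset.sum_add_distrib]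
      exact Finset.sum_congr rfl fun k _ => by ring
    rw [h1, S.sum_unit_lower hy, S.unit_log hy] at h0
    have h2 : ∑ i, u y i * pd i r y = 0 := by linarith
    constructor
    · rw [hu] at h2
      exact (mul_eq_zero.mp h2).resolve_left he.ne'
    · intro j
      have := hD j
      rw [h2, hu] at this
      rw [invForm]
      linarith
  · rintro ⟨h1, h2⟩
    have h3 : ∀ k, ∑ j, G y k j * divT G (energyT G u r q) y j = 0 := by
      intro k
      rw [hD, hu, hu, h1, h2 k, invForm]
      ring
    ext j
    have h4 : ∑ k, (G y)⁻¹ j k * ∑ i, G y k i * divT G (energyT G u r q) y i = 0 :=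
      Finset.sum_eq_zero fun k _ => by rw [h3, mul_zero]
    simp only [Finset.mul_sum] at h4
    rw [Finset.sum_comm] at h4
    simp only [← mul_assoc, ← Finset.sum_mul, S.inv_mul_apply hy] at h4
    simpa using h4

theorem pd_invForm (S : IsStationary G X u α O) {y : Coord} (hy : y ∈ O) (i j : Fin 4) :
    pd i (fun q => invForm G u α q j) y
      = Real.exp (-1 * α y) * (pd i (fun q => uF G u q j) y - pd i α y * uF G u y j) := by
  have hα := S.differentiableAt S.smooth_log hy
  simp only [invForm]
  rw [pd_mul ((hα.const_mul _).exp) (S.differentiableAt (S.smooth_lower j) hy), pd_exp_mul hα]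
  ring

theorem smooth_invForm (S : IsStationary G X u α O) (i : Fin 4) :
    ContDiffOn ℝ ∞ (fun y => invForm G u α y i) O :=
  (((contDiffOn_const (c := (-1 : ℝ))).mul S.smooth_log).exp).mul (S.smooth_lower i)

theorem extD_invForm (S : IsStationary G X u α O) {y : Coord} (hy : y ∈ O) (i j : Fin 4) :
    extD (invForm G u α) y i j = Real.exp (-1 * α y) *
      (extD (uF G u) y i j - (pd i α y * uF G u y j - pd j α y * uF G u y i)) := by
  simp only [extD, Matrix.of_apply, S.pd_invForm hy]
  ring

/-- The Killing field annihilates the differential of the invariant form: `ℒ_X χ = 0` because the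
flow of `X` preserves `G`, `X` and `α`, and `χ(X) = -1` is constant. -/
theorem sum_field_extD_invForm (S : IsStationary G X u α O) {y : Coord} (hy : y ∈ O) (j : Fin 4) :
    ∑ i, X y i * extD (invForm G u α) y i j = 0 := by
  have hG := fun i j => S.differentiableAt (S.smooth_metric i j) hy
  have hX := fun i => S.differentiableAt (S.smooth_field i) hy
  have hα := S.differentiableAt S.smooth_log hy
  have h1 : ∀ i j, pd i (fun q => invForm G u α q j) y = Real.exp (-2 * α y) *
      ((∑ k, (pd i (fun q => G q j k) y * X y k + G y j k * pd i (fun q => X q k) y))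
        - 2 * pd i α y * ∑ k, G y j k * X y k) := by
    intro i j
    have h2 : pd i (fun q => invForm G u α q j) y
        = pd i (fun q => Real.exp (-2 * α q) * ∑ k, G q j k * X q k) y := by
      refine pd_congr (Filter.eventuallyEq_of_mem (S.isOpen.mem_nhds hy) fun q hq => ?_) i
      have : Real.exp (-2 * α q) = Real.exp (-1 * α q) * Real.exp (-1 * α q) := by
        rw [← Real.exp_add]; congr 1; ring
      simp only [invForm, uF, lower, S.unit q hq, this, Finset.mul_sum]
      exact Finset.sum_congr rfl fun k _ => by ring
    have h3 : pd i (fun q => ∑ k, G q j k * X q k) y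
        = ∑ k, (pd i (fun q => G q j k) y * X y k + G y j k * pd i (fun q => X q k) y) := by
      rw [pd_sum _ fun k _ => (hG j k).fun_mul (hX k)]
      exact Finset.sum_congr rfl fun k _ => pd_mul (hG j k) (hX k) i
    rw [h2, pd_mul ((hα.const_mul _).exp)
      (DifferentiableAt.fun_sum fun k _ => (hG j k).fun_mul (hX k)), pd_exp_mul hα, h3]
    ring
  have h4 : ∀ i, X y i * extD (invForm G u α) y i j = Real.exp (-2 * α y) * (
      ∑ k, (X y i * X y k * pd i (fun q => G q k j) y
        + X y i * G y k j * pd i (fun q => X q k) y)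
      - ∑ k, (pd j (fun q => G q i k) y * X y i * X y k
        + X y i * G y i k * pd j (fun q => X q k) y)
      - 2 * (X y i * pd i α y) * (∑ k, G y j k * X y k)
      + 2 * pd j α y * ∑ k, G y i k * X y i * X y k) := by
    intro i
    have e1 : ∑ k, (X y i * X y k * pd i (fun q => G q k j) y
        + X y i * G y k j * pd i (fun q => X q k) y) = X y i *
        ∑ k, (pd i (fun q => G q j k) y * X y k + G y j k * pd i (fun q => X q k) y) := by
      rw [Finset.mul_sum]
      refine Finset.sum_congr rfl fun k _ => ?_
      rw [S.symm y hy k j, S.pd_metric_symm hy i k j]; ring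
    have e2 : ∑ k, (pd j (fun q => G q i k) y * X y i * X y k
        + X y i * G y i k * pd j (fun q => X q k) y) = X y i *
        ∑ k, (pd j (fun q => G q i k) y * X y k + G y i k * pd j (fun q => X q k) y) := by
      rw [Finset.mul_sum]
      exact Finset.sum_congr rfl fun k _ => by ring
    have e3 : ∑ k, G y i k * X y i * X y k = X y i * ∑ k, G y i k * X y k := by
      rw [Finset.mul_sum]
      exact Finset.sum_congr rfl fun k _ => by ring
    rw [e1, e2, e3]
    simp only [extD, Matrix.of_apply, h1]
    ring
  have hK := S.killing_contract hy j
  have hN := S.pd_norm hy j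
  have h5 : ∑ i, ∑ k, X y i * X y k * pd i (fun q => G q k j) y
      = ∑ i, ∑ k, X y i * X y k * pd k (fun q => G q i j) y := by
    rw [Finset.sum_comm]
    exact Finset.sum_congr rfl fun i _ => Finset.sum_congr rfl fun k _ => by ring
  have h6 : ∑ i, ∑ k, 2 * G y i k * X y i * pd j (fun q => X q k) y
      = 2 * ∑ i, ∑ k, X y i * G y i k * pd j (fun q => X q k) y := by
    simp only [Finset.mul_sum]
    exact Finset.sum_congr rfl fun i _ => Finset.sum_congr rfl fun k _ => by ring
  have h7 : ∑ i, 2 * (X y i * pd i α y) * (∑ k, G y j k * X y k) = 0 := by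
    rw [← Finset.sum_mul, ← Finset.mul_sum, S.field_log hy]; ring
  have h8 : ∑ i, 2 * pd j α y * ∑ k, G y i k * X y i * X y k
      = 2 * pd j α y * -Real.exp (2 * α y) := by
    rw [← Finset.mul_sum, S.norm y hy]
  simp only [h4]
  rw [← Finset.mul_sum]
  simp only [Finset.sum_add_distrib, Finset.sum_sub_distrib] at hK hN ⊢
  rw [h5, h7, h8]
  rw [h6] at hN
  linear_combination Real.exp (-2 * α y) * hK - Real.exp (-2 * α y) * hN

/-- The interior product of the unit field with the differential of its 1-form is the
acceleration. -/
theorem sum_unit_extD (S : IsStationary G X u α O) {y : Coord} (hy : y ∈ O) (j : Fin 4) :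
    ∑ i, u y i * extD (uF G u) y i j = pd j α y := by
  have h1 := S.sum_field_extD_invForm hy j
  have h2 : ∀ i, X y i * extD (invForm G u α) y i j = u y i * extD (uF G u) y i j
      - u y i * pd i α y * uF G u y j + pd j α y * (uF G u y i * u y i) := by
    intro i
    rw [S.extD_invForm hy, S.unit y hy]; ring
  simp only [h2, Finset.sum_add_distrib, Finset.sum_sub_distrib, ← Finset.mul_sum,
    ← Finset.sum_mul, S.unit_log hy, S.sum_unit_lower hy] at h1
  linarith

theorem extD_antisymm (x : Vec) (y : Coord) (i j : Fin 4) : extD x y i j = -extD x y j i := by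
  simp [extD]

theorem lower_raise2 (S : IsStationary G X u α O) {y : Coord} (hy : y ∈ O) (F : Ten)
    (i j : Fin 4) : ∑ a, ∑ b, G y i a * raise2 G F y a b * G y j b = F y i j := by
  have h : G y * raise2 G F y * (G y).transpose = F y := by
    have h1 : ((G y)⁻¹).transpose * (G y).transpose = 1 := by
      rw [← Matrix.transpose_mul, S.mul_inv hy, Matrix.transpose_one]
    calc G y * raise2 G F y * (G y).transpose
        = (G y * (G y)⁻¹) * F y * (((G y)⁻¹).transpose * (G y).transpose) := by
          simp only [raise2, Matrix.mul_assoc]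
      _ = F y := by rw [h1, S.mul_inv hy, one_mul, mul_one]
  rw [← h]
  simp only [Matrix.mul_apply, Matrix.transpose_apply, Finset.sum_mul]
  exact Finset.sum_comm

theorem raise2_antisymm (G : Ten) {y : Coord} (F : Ten)
    (hF : ∀ i j, F y i j = -F y j i) (i j : Fin 4) : raise2 G F y i j = -raise2 G F y j i := by
  rw [raise2_apply, raise2_apply, Finset.sum_comm, ← Finset.sum_neg_distrib]
  refine Finset.sum_congr rfl fun a _ => ?_
  rw [← Finset.sum_neg_distrib]
  refine Finset.sum_congr rfl fun b _ => ?_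
  rw [hF b a]; ring

theorem raise2_of_wedge {y : Coord} {F : Ten} {x z : Vec}
    (hF : ∀ i j, F y i j = x y i * z y j - x y j * z y i) (i j : Fin 4) :
    raise2 G F y i j = raise G x y i * raise G z y j - raise G x y j * raise G z y i := by
  simp only [raise2_apply, raise, hF, mul_sub, sub_mul, Finset.sum_sub_distrib]
  simp only [Finset.sum_mul_sum]
  congr 1
  · exact Finset.sum_congr rfl fun a _ => Finset.sum_congr rfl fun b _ => by ring
  · rw [Finset.sum_comm]
    exact Finset.sum_congr rfl fun a _ => Finset.sum_congr rfl fun b _ => by ring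

theorem wedge_of_raise2 (S : IsStationary G X u α O) {y : Coord} (hy : y ∈ O) {F : Ten} {x : Vec}
    {s : Fin 4 → ℝ} (hF : ∀ i j, raise2 G F y i j = raise G x y i * s j - raise G x y j * s i)
    (i j : Fin 4) :
    F y i j = x y i * (∑ k, G y j k * s k) - x y j * (∑ k, G y i k * s k) := by
  rw [← S.lower_raise2 hy F, ← S.sum_lower_raise hy x i, ← S.sum_lower_raise hy x j]
  simp only [Finset.sum_mul_sum, hF, mul_sub, sub_mul, Finset.sum_sub_distrib]
  congr 1
  · exact Finset.sum_congr rfl fun a _ => Finset.sum_congr rfl fun b _ => by ring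
  · rw [Finset.sum_comm]
    exact Finset.sum_congr rfl fun a _ => Finset.sum_congr rfl fun b _ => by ring

theorem sum_lower_raise2 (S : IsStationary G X u α O) {y : Coord} (hy : y ∈ O) (j : Fin 4) :
    ∑ i, uF G u y i * raise2 G (extD (uF G u)) y i j = raise G (grad α) y j := by
  have h : ∀ a, ∑ i, uF G u y i * (G y)⁻¹ i a = u y a := by
    intro a
    rw [← S.raise_lower hy, raise]
    exact Finset.sum_congr rfl fun i _ => by rw [S.inv_symm hy i a]; ring
  have h1 : ∑ i, uF G u y i * raise2 G (extD (uF G u)) y i j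
      = ∑ b, (G y)⁻¹ j b * ∑ a, (∑ i, uF G u y i * (G y)⁻¹ i a) * extD (uF G u) y a b := by
    simp only [raise2_apply, Finset.mul_sum, Finset.sum_mul]
    rw [Finset.sum_comm]
    conv_rhs => rw [Finset.sum_comm]
    refine Finset.sum_congr rfl fun a _ => ?_
    rw [Finset.sum_comm]
    exact Finset.sum_congr rfl fun b _ => Finset.sum_congr rfl fun i _ => by ring
  rw [h1]
  simp only [h, S.sum_unit_extD hy, raise, grad]

theorem sum_lower_raise_log (S : IsStationary G X u α O) {y : Coord} (hy : y ∈ O) :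
    ∑ i, uF G u y i * raise G (grad α) y i = 0 := by
  rw [← S.unit_log hy]
  simp only [raise, Finset.mul_sum, ← S.raise_lower hy, Finset.sum_mul]
  rw [Finset.sum_comm]
  exact Finset.sum_congr rfl fun i _ => Finset.sum_congr rfl fun j _ => by
    rw [S.inv_symm hy i j, grad]; ring

/-- The rotation vector in terms of the Levi-Civita symbol. -/
theorem rot_eq (S : IsStationary G X u α O) {y : Coord} (hy : y ∈ O) (l : Fin 4) :
    rot G u y l = (1 / 2) * Real.sqrt |(G y).det| *
      ∑ i, ∑ j, ∑ k, u y i * raise2 G (extD (uF G u)) y j k * eps i j k l := by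
  simp only [rot, star3, vol, Finset.mul_sum, S.raise_lower hy]
  refine Finset.sum_congr rfl fun i _ => Finset.sum_congr rfl fun j _ =>
    Finset.sum_congr rfl fun k _ => ?_
  rw [raise2]; ring

theorem sqrt_det_pos (S : IsStationary G X u α O) {y : Coord} (hy : y ∈ O) :
    0 < Real.sqrt |(G y).det| := by
  refine Real.sqrt_pos.mpr (abs_pos.mpr fun h => ?_)
  have := congrArg Matrix.det (S.inv_mul y hy)
  simp [h] at this

/-- The rotation vanishes exactly where the invariant form is closed: `w` is the dual of `u ∧ du`,
and `du = e^α dχ + dα ∧ u` where `X` annihilates `dχ`. -/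
theorem rot_eq_zero_iff (S : IsStationary G X u α O) {y : Coord} (hy : y ∈ O) :
    rot G u y = 0 ↔ ∀ i j, extD (invForm G u α) y i j = 0 := by
  have hanti := raise2_antisymm G (extD (uF G u)) (extD_antisymm (uF G u) y)
  constructor
  · intro h i j
    have h1 : ∀ l, ∑ i, ∑ j, ∑ k, u y i * raise2 G (extD (uF G u)) y j k * eps i j k l = 0 := by
      intro l
      have := S.rot_eq hy l
      rw [h] at this
      have hp := S.sqrt_det_pos hy
      exact (mul_eq_zero.mp this.symm).resolve_left (by positivity)
    have h2 := cyclic_of_sum_eps_eq_zero hanti h1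
    have h3 : ∀ j k, raise2 G (extD (uF G u)) y j k
        = raise G (grad α) y j * u y k - raise G (grad α) y k * u y j := by
      intro j k
      have h4 : ∑ i, uF G u y i * (u y i * raise2 G (extD (uF G u)) y j k
          + u y j * raise2 G (extD (uF G u)) y k i + u y k * raise2 G (extD (uF G u)) y i j) = 0 :=
        Finset.sum_eq_zero fun i _ => by rw [h2, mul_zero]
      have h5 : ∀ i, uF G u y i * (u y i * raise2 G (extD (uF G u)) y j k
          + u y j * raise2 G (extD (uF G u)) y k i + u y k * raise2 G (extD (uF G u)) y i j)
          = uF G u y i * u y i * raise2 G (extD (uF G u)) y j k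
          - u y j * (uF G u y i * raise2 G (extD (uF G u)) y i k)
          + u y k * (uF G u y i * raise2 G (extD (uF G u)) y i j) := fun i => by
        rw [hanti k i]; ring
      simp only [h5, Finset.sum_add_distrib, Finset.sum_sub_distrib, ← Finset.mul_sum,
        ← Finset.sum_mul, S.sum_unit_lower hy, S.sum_lower_raise2 hy] at h4
      linarith
    have h6 := S.wedge_of_raise2 hy h3 i j
    rw [S.extD_invForm hy, h6, grad_apply, grad_apply, uF, lower, lower]
    simp
  · intro h
    have h1 : ∀ i j, extD (uF G u) y i j = grad α y i * uF G u y j - grad α y j * uF G u y i := by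
      intro i j
      have := h i j
      rw [S.extD_invForm hy] at this
      have := (mul_eq_zero.mp this).resolve_left (Real.exp_pos _).ne'
      rw [grad_apply, grad_apply]
      linarith
    have h2 := raise2_of_wedge (G := G) h1
    ext l
    rw [S.rot_eq hy, sum_eps_eq_zero_of_cyclic, mul_zero, Pi.zero_apply]
    intro i j k
    simp only [h2, S.raise_lower hy]
    ring

theorem ip_rot_acc (S : IsStationary G X u α O) {y : Coord} (hy : y ∈ O) :
    ip G (rot G u) (acc G u) y = (1 / 2) * Real.sqrt |(G y).det| *
      ∑ l, (∑ i, ∑ j, ∑ k, u y i * raise2 G (extD (uF G u)) y j k * eps i j k l)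
        * raise G (grad α) y l := by
  have : ip G (rot G u) (acc G u) y = ∑ l, rot G u y l * raise G (grad α) y l := by
    simp only [ip, raise, Finset.mul_sum, S.acc_eq hy]
    exact Finset.sum_congr rfl fun i _ => Finset.sum_congr rfl fun j _ => by ring
  rw [this, Finset.mul_sum]
  exact Finset.sum_congr rfl fun l _ => by rw [S.rot_eq hy]; ring

/-- The rotation is orthogonal to the acceleration where the differential of the invariant form is
divisible by `dα`. -/
theorem ip_rot_acc_eq_zero (S : IsStationary G X u α O) {y : Coord} (hy : y ∈ O) {z : Fin 4 → ℝ}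
    (h : ∀ i j, extD (invForm G u α) y i j = pd i α y * z j - pd j α y * z i) :
    ip G (rot G u) (acc G u) y = 0 := by
  have h1 : ∀ i j, extD (uF G u) y i j =
      grad α y i * (fun q k => uF G u q k + Real.exp (α q) * z k : Vec) y j
        - grad α y j * (fun q k => uF G u q k + Real.exp (α q) * z k : Vec) y i := by
    intro i j
    have h2 := h i j
    rw [S.extD_invForm hy] at h2
    have h3 : Real.exp (α y) * Real.exp (-1 * α y) = 1 := by
      rw [← Real.exp_add, Real.exp_eq_one_iff]; ring
    simp only [grad_apply]
    linear_combination Real.exp (α y) * h2 - (extD (uF G u) y i j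
      - (pd i α y * uF G u y j - pd j α y * uF G u y i)) * h3
  have h2 := raise2_of_wedge (G := G) (F := extD (uF G u)) (x := grad α)
    (z := fun q k => uF G u q k + Real.exp (α q) * z k) h1
  rw [S.ip_rot_acc hy]
  simp only [sum_eps]
  rw [Fin.sum_univ_four]
  simp [h2]
  right
  ring

/-- Conversely, where the acceleration does not vanish and the rotation is orthogonal to it, the
differential of the invariant form is divisible by `dα`. -/
theorem exists_extD_invForm (S : IsStationary G X u α O) {y : Coord} (hy : y ∈ O)
    (hα : grad α y ≠ 0) (h : ip G (rot G u) (acc G u) y = 0) :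
    ∃ z : Fin 4 → ℝ, ∀ i j, extD (invForm G u α) y i j = pd i α y * z j - pd j α y * z i := by
  have hanti := raise2_antisymm G (extD (uF G u)) (extD_antisymm (uF G u) y)
  rw [S.ip_rot_acc hy] at h
  have hp := S.sqrt_det_pos hy
  have h1 := cyclic_of_volume_eq_zero hanti (S.sum_unit_lower hy) (S.sum_lower_raise_log hy)
    (S.sum_lower_raise2 hy) ((mul_eq_zero.mp h).resolve_left (by positivity))
  obtain ⟨m, hm⟩ : ∃ m, raise G (grad α) y m ≠ 0 := by
    by_contra! hcon
    refine hα (funext fun i => ?_)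
    rw [← S.sum_lower_raise hy (grad α) i]
    simp [hcon]
  -- with a non-zero component `m` of the raised `dα`, divide `du` by `dα`
  have h2 : ∀ k l, raise2 G (extD (uF G u)) y k l
      = raise G (grad α) y k * ((raise G (grad α) y m)⁻¹ * raise2 G (extD (uF G u)) y m l)
        - raise G (grad α) y l * ((raise G (grad α) y m)⁻¹ * raise2 G (extD (uF G u)) y m k) := by
    intro k l
    have h3 := h1 m k l
    rw [hanti l m] at h3
    field_simp
    linarith
  refine ⟨fun j => Real.exp (-1 * α y) * ((∑ k, G y j k *
    ((raise G (grad α) y m)⁻¹ * raise2 G (extD (uF G u)) y m k)) - uF G u y j), fun i j => ?_⟩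
  rw [S.extD_invForm hy, S.wedge_of_raise2 hy h2 i j, grad_apply, grad_apply]
  ring

end IsStationary

/-! ### The classes of a stationary field -/

theorem star3_eq_zero {G : Ten} {x : Vec} {F : Ten} {y : Coord} (hF : F y = 0) :
    star3 G x F y = 0 := by
  ext l; simp [star3, hF]

theorem inter_eq_zero {G : Ten} {x : Vec} {F : Ten} {y : Coord} (hF : F y = 0) :
    inter G x F y = 0 := by
  ext l; simp [inter, hF]

theorem ip_zero_left {G : Ten} {x z : Vec} {y : Coord} (hx : x y = 0) : ip G x z y = 0 := by
  simp [ip, hx]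

theorem grad_eq_zero {f : Scal} {y : Coord} (h : ∀ᶠ q in 𝓝 y, f q = 0) : grad f y = 0 :=
  funext fun i => pd_eq_zero_of_eventually_const h i

theorem cb_eq_zero {G : Ten} {u x : Vec} {y : Coord} (hx : x y = 0) : cb G u x y = 0 := by
  simp [cb, ip_zero_left hx]

namespace IsStationary

variable {G : Ten} {X u : Vec} {α : Scal} {O : Set Coord}

theorem ip_comm (S : IsStationary G X u α O) {y : Coord} (hy : y ∈ O) (x z : Vec) :
    ip G x z y = ip G z x y := by
  rw [ip, ip, Finset.sum_comm]
  exact Finset.sum_congr rfl fun i _ => Finset.sum_congr rfl fun j _ => by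
    rw [S.inv_symm hy j i]; ring

theorem extD_acc (S : IsStationary G X u α O) {y : Coord} (hy : y ∈ O) :
    extD (acc G u) y = 0 := by
  ext i j
  have h : ∀ i j, pd i (fun q => acc G u q j) y = pd i (fun q => pd j α q) y := fun i j =>
    pd_congr (Filter.eventuallyEq_of_mem (S.isOpen.mem_nhds hy) fun q hq =>
      congrFun (S.acc_eq hq) j) i
  simp only [extD, Matrix.of_apply, h, Matrix.zero_apply]
  rw [pd_comm (S.smooth_log.contDiffAt (S.isOpen.mem_nhds hy)), sub_self]

theorem rotAcc_eq_zero (S : IsStationary G X u α O) {y : Coord} (hy : y ∈ O) :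
    rotAcc G u y = 0 := star3_eq_zero (S.extD_acc hy)

theorem vc_eq_zero (S : IsStationary G X u α O) {y : Coord} (hy : y ∈ O) : vc G u y = 0 := by
  simp [vc, inter_eq_zero (S.extD_acc hy)]

theorem cb_vc_eq_zero (S : IsStationary G X u α O) {y : Coord} (hy : y ∈ O) :
    cb G u (vc G u) y = 0 := by
  exact cb_eq_zero (S.vc_eq_zero hy)

theorem cu_vc_eq_zero (S : IsStationary G X u α O) {y : Coord} (hy : y ∈ O) :
    cu G u (vc G u) y = 0 := by
  simp [cu, ip_zero_left (S.vc_eq_zero hy)]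

theorem Om_eq_zero (S : IsStationary G X u α O) {y : Coord} (hy : y ∈ O) : Om G u y = 0 := by
  simp [Om, S.expan_eq_zero hy, S.cu_vc_eq_zero hy]

theorem nu_eq_zero (S : IsStationary G X u α O) {y : Coord} (hy : y ∈ O) : nu G u y = 0 := by
  simp [nu, S.Om_eq_zero hy, S.cb_vc_eq_zero hy]

theorem OmT_eq_zero (S : IsStationary G X u α O) {y : Coord} (hy : y ∈ O) : OmT G u y = 0 := by
  have : grad (Om G u) y = 0 :=
    grad_eq_zero (Filter.eventually_of_mem (S.isOpen.mem_nhds hy) fun q hq => S.Om_eq_zero hq)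
  exact cb_eq_zero this

theorem cbT_eq_zero (S : IsStationary G X u α O) {y : Coord} (hy : y ∈ O) : cbT G u y = 0 := by
  have : grad (cb G u (vc G u)) y = 0 :=
    grad_eq_zero (Filter.eventually_of_mem (S.isOpen.mem_nhds hy) fun q hq => S.cb_vc_eq_zero hq)
  exact cb_eq_zero this

theorem vphi1_eq_zero (S : IsStationary G X u α O) {y : Coord} (hy : y ∈ O) :
    vphi1 G u y = 0 := by
  have : grad (nu G u) y = 0 :=
    grad_eq_zero (Filter.eventually_of_mem (S.isOpen.mem_nhds hy) fun q hq => S.nu_eq_zero hq)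
  simp [vphi1, dstar, ca, ip_zero_left this, S.expan_eq_zero hy, S.cb_vc_eq_zero hy,
    S.cu_vc_eq_zero hy]

/-- At a point, only four of the classes are possible: `da = 0`, so that `v`, `c`, `Ω`, `ν` and
their derivatives vanish, and this contradicts one of the relations of each other class. -/
theorem class_mem (S : IsStationary G X u α O) {y : Coord} (hy : y ∈ O) {n : ℕ}
    (h : ClassRel G u n y) : n = 1 ∨ n = 2 ∨ n = 15 ∨ n = 18 := by
  have hv := S.rotAcc_eq_zero hy
  have hc : ip G (vc G u) (rot G u) y = 0 := ip_zero_left (S.vc_eq_zero hy)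
  have hO := S.OmT_eq_zero hy
  have hb := S.cbT_eq_zero hy
  have hp := S.vphi1_eq_zero hy
  unfold ClassRel at h
  split at h <;> simp_all

theorem class_two_iff (S : IsStationary G X u α O) {y : Coord} (hy : y ∈ O) :
    ClassRel G u 2 y ↔ ip G (rot G u) (acc G u) y ≠ 0 := by
  rw [S.ip_comm hy]
  refine ⟨fun h => h.2, fun h => ⟨fun h0 => h ?_, h⟩⟩
  exact ip_zero_left h0

theorem class_fifteen_iff (S : IsStationary G X u α O) {y : Coord} (hy : y ∈ O) :
    ClassRel G u 15 y ↔
      acc G u y ≠ 0 ∧ rot G u y ≠ 0 ∧ ip G (rot G u) (acc G u) y = 0 := by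
  rw [S.ip_comm hy]
  constructor
  · rintro ⟨⟨h1, h2, h3, -⟩, -⟩
    exact ⟨h1, h2, h3⟩
  · rintro ⟨h1, h2, h3⟩
    exact ⟨⟨h1, h2, h3, ip_zero_left (S.vc_eq_zero hy)⟩, S.rotAcc_eq_zero hy, S.cbT_eq_zero hy,
      S.OmT_eq_zero hy, S.vphi1_eq_zero hy⟩

theorem class_eighteen_iff (S : IsStationary G X u α O) {y : Coord} (hy : y ∈ O) :
    ClassRel G u 18 y ↔ acc G u y ≠ 0 ∧ rot G u y = 0 :=
  ⟨fun h => ⟨h.1, h.2.1⟩, fun h => ⟨h.1, h.2, S.rotAcc_eq_zero hy⟩⟩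

end IsStationary

section Analysis

variable {E : Type*} [NormedAddCommGroup E] [NormedSpace ℝ E]

/-! ### Functions with prescribed differentials -/

theorem _root_.ContDiffOn.differentiableAt_of_isOpen {F : Type*} [NormedAddCommGroup F]
    [NormedSpace ℝ F] {f : E → F} {O : Set E} (hf : ContDiffOn ℝ ∞ f O) (hO : IsOpen O) {y : E}
    (hy : y ∈ O) : DifferentiableAt ℝ f y :=
  (hf.contDiffAt (hO.mem_nhds hy)).differentiableAt (by simp)

/-- The derivative of the differential of a smooth function is symmetric. -/
theorem fderiv_symm_of_eqOn_fderiv {f : E → ℝ} {η : E → E →L[ℝ] ℝ} {O : Set E} (hO : IsOpen O)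
    (hf : ContDiffOn ℝ ∞ f O) (h : ∀ y ∈ O, fderiv ℝ f y = η y) {y : E} (hy : y ∈ O) (v w : E) :
    fderiv ℝ η y v w = fderiv ℝ η y w v := by
  have hs : IsSymmSndFDerivAt ℝ f y :=
    (hf.contDiffAt (hO.mem_nhds hy)).isSymmSndFDerivAt (by simp; exact ENat.LEInfty.out)
  have : fderiv ℝ (fderiv ℝ f) y = fderiv ℝ η y :=
    (Filter.eventuallyEq_of_mem (hO.mem_nhds hy) h).fderiv_eq
  rw [← this]
  exact hs v w

theorem isOpen_image_of_apply_eq_one [CompleteSpace E] {ℓ : E →L[ℝ] ℝ} {v : E} (hv : ℓ v = 1)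
    {B : Set E} (hB : IsOpen B) : IsOpen (ℓ '' B) :=
  ℓ.isOpenMap (fun t => ⟨t • v, by simp [hv]⟩) _ hB

/-- On a convex open set, a function whose differential is everywhere proportional to a linear form
`ℓ` is a smooth function of `ℓ`: it is constant on the fibres of `ℓ`, which are convex. -/
theorem exists_comp_linear {ℓ : E →L[ℝ] ℝ} {v : E} (hv : ℓ v = 1) {B : Set E} (hB : IsOpen B)
    (hc : Convex ℝ B) {f : E → ℝ} (hf : ContDiffOn ℝ ∞ f B)
    (h : ∀ y ∈ B, ∀ w, ℓ w = 0 → fderiv ℝ f y w = 0) :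
    ∃ φ : ℝ → ℝ, ContDiffOn ℝ ∞ φ (ℓ '' B) ∧ ∀ y ∈ B, f y = φ (ℓ y) := by
  have hconst : ∀ y ∈ B, ∀ z ∈ B, ℓ y = ℓ z → f y = f z := by
    intro y hy z hz hyz
    have hseg : ∀ t ∈ Set.Icc (0 : ℝ) 1, y + t • (z - y) ∈ B := fun t ht =>
      hc.add_smul_sub_mem hy hz ht
    have hd : ∀ t ∈ Set.Icc (0 : ℝ) 1,
        HasDerivWithinAt (fun t : ℝ => f (y + t • (z - y))) 0 (Set.Icc 0 1) t := by
      intro t ht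
      have h1 : HasDerivAt (fun t : ℝ => y + t • (z - y)) (z - y) t := by
        simpa using ((hasDerivAt_id t).smul_const (z - y)).const_add y
      have h2 := (hf.differentiableAt_of_isOpen hB (hseg t ht)).hasFDerivAt.comp_hasDerivAt t h1
      rw [h _ (hseg t ht) _ (by simp [hyz])] at h2
      exact h2.hasDerivWithinAt
    have := constant_of_derivWithin_zero (fun t ht => (hd t ht).differentiableWithinAt)
      (fun t ht => (hd t (Set.Ico_subset_Icc_self ht)).derivWithin
        (uniqueDiffOn_Icc (by norm_num) t (Set.Ico_subset_Icc_self ht)))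
      1 (Set.right_mem_Icc.mpr zero_le_one)
    simpa using this.symm
  refine ⟨fun t => f (Function.invFunOn ℓ B t), ?_, fun y hy =>
    hconst _ hy _ (Function.invFunOn_mem ⟨y, hy, rfl⟩) (Function.invFunOn_eq ⟨y, hy, rfl⟩).symm⟩
  rintro _ ⟨y, hy, rfl⟩
  have hcurve : ContDiff ℝ ∞ fun t : ℝ => y + (t - ℓ y) • v := by fun_prop
  have h0 : y + (ℓ y - ℓ y) • v = y := by simp
  have h1 : ContDiffAt ℝ ∞ (fun t : ℝ => f (y + (t - ℓ y) • v)) (ℓ y) := by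
    refine ContDiffAt.comp (g := f) (ℓ y) ?_ hcurve.contDiffAt
    rw [h0]
    exact hf.contDiffAt (hB.mem_nhds hy)
  refine (h1.congr_of_eventuallyEq ?_).contDiffWithinAt
  have h2 : ∀ᶠ t in 𝓝 (ℓ y), y + (t - ℓ y) • v ∈ B :=
    hcurve.continuous.continuousAt.eventually_mem (by rw [h0]; exact hB.mem_nhds hy)
  filter_upwards [h2] with t ht
  have h3 : ∃ z ∈ B, ℓ z = t := ⟨_, ht, by simp [hv]⟩
  refine hconst _ (Function.invFunOn_mem h3) _ ht ?_
  rw [Function.invFunOn_eq h3]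
  simp [hv]

theorem fderiv_comp_real {a : E → ℝ} {φ : ℝ → ℝ} {B : Set E} (hB : IsOpen B)
    (ha : ContDiffOn ℝ ∞ a B) (himg : IsOpen (a '' B)) (hφ : ContDiffOn ℝ ∞ φ (a '' B)) {y : E}
    (hy : y ∈ B) :
    HasFDerivAt (fun y => φ (a y)) (deriv φ (a y) • fderiv ℝ a y) y := by
  have h1 : HasDerivAt φ (deriv φ (a y)) (a y) :=
    (hφ.differentiableAt_of_isOpen himg ⟨y, hy, rfl⟩).hasDerivAt
  exact h1.comp_hasFDerivAt y (ha.differentiableAt_of_isOpen hB hy).hasFDerivAt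

/-! ### The conservation equations in terms of the invariant form -/

/-- A smooth vector field `X`, a 1-form `χ` invariant along `X` with `χ(X) = -1`, and a function
`α` invariant along `X`, on an open set. The invariance `i(X) dχ = 0` is stated as the symmetry of
the derivative of `χ` in the direction of `X`. -/
structure InvariantForm (X : E → E) (χ : E → E →L[ℝ] ℝ) (α : E → ℝ) (O : Set E) : Prop where
  isOpen : IsOpen O
  smooth_field : ContDiffOn ℝ ∞ X O
  smooth_form : ContDiffOn ℝ ∞ χ O
  smooth_log : ContDiffOn ℝ ∞ α O
  form_field : ∀ y ∈ O, χ y (X y) = -1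
  log_field : ∀ y ∈ O, fderiv ℝ α y (X y) = 0
  inter_field : ∀ y ∈ O, ∀ v, fderiv ℝ χ y (X y) v = fderiv ℝ χ y v (X y)

/-- Density `r` and pressure `q` of a conserved fluid at rest with respect to `X`: `r` is invariant
along `X` and `dq = -X(q) χ - (r + q) dα`. -/
structure IsFluid (X : E → E) (χ : E → E →L[ℝ] ℝ) (α r q : E → ℝ) (O : Set E) : Prop where
  smooth_density : ContDiffOn ℝ ∞ r O
  smooth_pressure : ContDiffOn ℝ ∞ q O
  density_field : ∀ y ∈ O, fderiv ℝ r y (X y) = 0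
  pressure : ∀ y ∈ O, ∀ w, fderiv ℝ q y w
    = -(fderiv ℝ q y (X y) * χ y w) - (r y + q y) * fderiv ℝ α y w

variable {X : E → E} {χ : E → E →L[ℝ] ℝ} {α r q : E → ℝ} {O : Set E}

theorem smooth_derivAlong {f : E → ℝ} (hO : IsOpen O) (hf : ContDiffOn ℝ ∞ f O)
    (hX : ContDiffOn ℝ ∞ X O) : ContDiffOn ℝ ∞ (fun y => fderiv ℝ f y (X y)) O :=
  (hf.fderiv_of_isOpen hO (by simp)).clm_apply hX

namespace IsFluid

/-- The symmetry of the second derivative of the pressure, that is the exterior derivative of the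
equation for `dq`. -/
theorem antisymm_pressure (I : InvariantForm X χ α O) (F : IsFluid X χ α r q O) {y : E}
    (hy : y ∈ O) (v w : E) :
    fderiv ℝ (fun z => fderiv ℝ q z (X z)) y v * χ y w
      - fderiv ℝ (fun z => fderiv ℝ q z (X z)) y w * χ y v
      + fderiv ℝ q y (X y) * (fderiv ℝ χ y v w - fderiv ℝ χ y w v)
      + (fderiv ℝ r y v + fderiv ℝ q y v) * fderiv ℝ α y w
      - (fderiv ℝ r y w + fderiv ℝ q y w) * fderiv ℝ α y v = 0 := by
  have hO := I.isOpen
  have hα := I.smooth_log.fderiv_of_isOpen (m := ∞) hO (by simp)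
  have h1 : ∀ z ∈ O, fderiv ℝ q z
      = -(fderiv ℝ q z (X z) • χ z) - (r z + q z) • fderiv ℝ α z := by
    intro z hz
    ext w
    simp [F.pressure z hz w]
  have dh := ((smooth_derivAlong hO F.smooth_pressure I.smooth_field).differentiableAt_of_isOpen
    hO hy).hasFDerivAt
  have dχ := (I.smooth_form.differentiableAt_of_isOpen hO hy).hasFDerivAt
  have dr := (F.smooth_density.differentiableAt_of_isOpen hO hy).hasFDerivAt
  have dq := (F.smooth_pressure.differentiableAt_of_isOpen hO hy).hasFDerivAt
  have dα := (hα.differentiableAt_of_isOpen hO hy).hasFDerivAt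
  have hω := ((dh.fun_smul dχ).fun_neg).fun_sub ((dr.fun_add dq).fun_smul dα)
  have h2 := fderiv_symm_of_eqOn_fderiv hO F.smooth_pressure h1 hy v w
  have h3 := fderiv_symm_of_eqOn_fderiv hO I.smooth_log (fun _ _ => rfl) hy v w
  rw [hω.fderiv] at h2
  simp at h2
  rw [h3] at h2
  linarith

/-- The interior product of `X` with the exterior derivative of the equation for `dq`. -/
theorem pressure_rate (I : InvariantForm X χ α O) (F : IsFluid X χ α r q O) {y : E}
    (hy : y ∈ O) (w : E) :
    fderiv ℝ (fun z => fderiv ℝ q z (X z)) y w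
      = -(fderiv ℝ (fun z => fderiv ℝ q z (X z)) y (X y) * χ y w)
        - fderiv ℝ q y (X y) * fderiv ℝ α y w := by
  have h := F.antisymm_pressure I hy (X y) w
  rw [I.form_field y hy, I.inter_field y hy, F.density_field y hy, I.log_field y hy] at h
  linarith

/-- The integrability condition `X(q) dχ + dr ∧ dα = 0`. -/
theorem integrability (I : InvariantForm X χ α O) (F : IsFluid X χ α r q O) {y : E}
    (hy : y ∈ O) (v w : E) :
    fderiv ℝ q y (X y) * (fderiv ℝ χ y v w - fderiv ℝ χ y w v)
      + fderiv ℝ r y v * fderiv ℝ α y w - fderiv ℝ r y w * fderiv ℝ α y v = 0 := by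
  have h := F.antisymm_pressure I hy v w
  rw [F.pressure_rate I hy v, F.pressure_rate I hy w, F.pressure y hy v, F.pressure y hy w] at h
  linarith

theorem smooth_rate (I : InvariantForm X χ α O) (F : IsFluid X χ α r q O) :
    ContDiffOn ℝ ∞ (fun z => fderiv ℝ q z (X z) * Real.exp (α z)) O :=
  (smooth_derivAlong I.isOpen F.smooth_pressure I.smooth_field).mul I.smooth_log.exp

/-- The differential of `e^α X(q)` is proportional to the invariant form. -/
theorem fderiv_rate (I : InvariantForm X χ α O) (F : IsFluid X χ α r q O) {y : E}
    (hy : y ∈ O) (w : E) :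
    fderiv ℝ (fun z => fderiv ℝ q z (X z) * Real.exp (α z)) y w
      = -(fderiv ℝ (fun z => fderiv ℝ q z (X z) * Real.exp (α z)) y (X y) * χ y w) := by
  have hO := I.isOpen
  have dh := ((smooth_derivAlong hO F.smooth_pressure I.smooth_field).differentiableAt_of_isOpen
    hO hy).hasFDerivAt
  have dα := (I.smooth_log.differentiableAt_of_isOpen hO hy).hasFDerivAt
  rw [(dh.fun_mul dα.exp).fderiv]
  simp only [add_apply, smul_apply, smul_eq_mul]
  rw [F.pressure_rate I hy w, I.log_field y hy]
  ring

/-- Where the invariant form is not closed, `e^α X(q)` is locally constant: if `k = e^α X(q)`, then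
`dk = -X(k) χ`, and the exterior derivative of this relation is `X(k) dχ = 0`. -/
theorem fderiv_rate_eq_zero (I : InvariantForm X χ α O) (F : IsFluid X χ α r q O) {y : E}
    (hy : y ∈ O) {v w : E} (h : fderiv ℝ χ y v w ≠ fderiv ℝ χ y w v) :
    fderiv ℝ (fun z => fderiv ℝ q z (X z) * Real.exp (α z)) y = 0 := by
  have hO := I.isOpen
  set k := fun z => fderiv ℝ q z (X z) * Real.exp (α z) with hk
  have hks : ContDiffOn ℝ ∞ k O := F.smooth_rate I
  have h1 : ∀ z ∈ O, fderiv ℝ k z = -(fderiv ℝ k z (X z) • χ z) := by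
    intro z hz
    ext w
    simpa using F.fderiv_rate I hz w
  have dm := ((smooth_derivAlong hO hks I.smooth_field).differentiableAt_of_isOpen hO hy).hasFDerivAt
  have dχ := (I.smooth_form.differentiableAt_of_isOpen hO hy).hasFDerivAt
  have h2 : ∀ v w, _ := fun v w => fderiv_symm_of_eqOn_fderiv hO hks h1 hy v w
  rw [(dm.fun_smul dχ).fun_neg.fderiv] at h2
  simp at h2
  have h3 : ∀ w, fderiv ℝ (fun z => fderiv ℝ k z (X z)) y w
      = -(fderiv ℝ (fun z => fderiv ℝ k z (X z)) y (X y) * χ y w) := by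
    intro w
    have := h2 (X y) w
    rw [I.form_field y hy, I.inter_field y hy] at this
    linarith
  have h4 : fderiv ℝ k y (X y) * (fderiv ℝ χ y v w - fderiv ℝ χ y w v) = 0 := by
    have := h2 v w
    rw [h3 v, h3 w] at this
    linarith
  have h5 := (mul_eq_zero.mp h4).resolve_right (sub_ne_zero.mpr h)
  rw [h1 y hy, h5]
  simp

end IsFluid

end Analysis

section Solutions

variable {E : Type*} [NormedAddCommGroup E] [NormedSpace ℝ E]

/-! ### Integration of the conservation equations on convex domains -/

theorem contDiffOn_comp_image {a : E → ℝ} {φ : ℝ → ℝ} {B : Set E} (ha : ContDiffOn ℝ ∞ a B)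
    (hφ : ContDiffOn ℝ ∞ φ (a '' B)) : ContDiffOn ℝ ∞ (fun y => φ (a y)) B :=
  hφ.comp ha (Set.mapsTo_image a B)

theorem fderiv_of_eqOn_linear {a : E → ℝ} {ℓ : E →L[ℝ] ℝ} {B : Set E} (hB : IsOpen B)
    (h : ∀ y ∈ B, a y = ℓ y) {y : E} (hy : y ∈ B) : fderiv ℝ a y = ℓ := by
  rw [(Filter.eventuallyEq_of_mem (hB.mem_nhds hy) h).fderiv_eq, ℓ.fderiv]

/-- A version of `exists_comp_linear` for a function that coincides with a linear form. -/
theorem exists_comp_of_eqOn_linear {ℓ : E →L[ℝ] ℝ} {v : E} (hv : ℓ v = 1) {B : Set E}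
    (hB : IsOpen B) (hc : Convex ℝ B) {a : E → ℝ} (ha : ∀ y ∈ B, a y = ℓ y) {f : E → ℝ}
    (hf : ContDiffOn ℝ ∞ f B) (h : ∀ y ∈ B, ∀ w, fderiv ℝ a y w = 0 → fderiv ℝ f y w = 0) :
    ∃ φ : ℝ → ℝ, ContDiffOn ℝ ∞ φ (a '' B) ∧ ∀ y ∈ B, f y = φ (a y) := by
  obtain ⟨φ, h1, h2⟩ := exists_comp_linear hv hB hc hf fun y hy w hw =>
    h y hy w (by rw [fderiv_of_eqOn_linear hB ha hy, hw])
  refine ⟨φ, ?_, fun y hy => by rw [h2 y hy, ha y hy]⟩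
  rwa [Set.EqOn.image_eq (f₂ := ℓ) ha]

theorem isOpen_image_of_eqOn_linear [CompleteSpace E] {ℓ : E →L[ℝ] ℝ} {v : E} (hv : ℓ v = 1)
    {B : Set E} (hB : IsOpen B) {a : E → ℝ} (ha : ∀ y ∈ B, a y = ℓ y) : IsOpen (a '' B) := by
  rw [Set.EqOn.image_eq (f₂ := ℓ) ha]
  exact isOpen_image_of_apply_eq_one hv hB

/-- A smooth function on an open interval has a smooth primitive. -/
theorem exists_contDiffOn_primitive {s : Set ℝ} (hs : IsOpen s) (hc : Convex ℝ s) {κ : ℝ → ℝ}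
    (hκ : ContDiffOn ℝ ∞ κ s) :
    ∃ K : ℝ → ℝ, ContDiffOn ℝ ∞ K s ∧ ∀ t ∈ s, deriv K t = κ t := by
  obtain ⟨K, hK⟩ := hc.exists_forall_hasDerivWithinAt (hκ.differentiableOn (by simp))
  have hd : ∀ t ∈ s, HasDerivAt K (κ t) t := fun t ht => (hK t ht).hasDerivAt (hs.mem_nhds ht)
  refine ⟨K, ?_, fun t ht => (hd t ht).deriv⟩
  rw [contDiffOn_infty_iff_deriv_of_isOpen hs]
  exact ⟨fun t ht => (hd t ht).differentiableAt.differentiableWithinAt,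
    hκ.congr fun t ht => (hd t ht).deriv⟩

variable [CompleteSpace E] {X : E → E} {χ : E → E →L[ℝ] ℝ} {α r q : E → ℝ} {B : Set E}
  {ℓ ℓ' : E →L[ℝ] ℝ} {e e' : E}

/-- If every fluid has `X(q) = 0`, then `dq = -(r + q) dα`: the pressure is a function of `α`, and
it determines the density. -/
theorem isFluid_iff_of_rate_eq_zero (I : InvariantForm X χ α B) (hc : Convex ℝ B) (he : ℓ e = 1)
    (hα : ∀ y ∈ B, α y = ℓ y)
    (h0 : ∀ r q, IsFluid X χ α r q B → ∀ y ∈ B, fderiv ℝ q y (X y) = 0) :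
    IsFluid X χ α r q B ↔ ∃ f : ℝ → ℝ, ContDiffOn ℝ ∞ f (α '' B) ∧
      ∀ y ∈ B, q y = f (α y) ∧ r y = -f (α y) - deriv f (α y) := by
  have hB := I.isOpen
  have himg := isOpen_image_of_eqOn_linear he hB hα
  have hαe : ∀ y ∈ B, fderiv ℝ α y e = 1 := fun y hy => by
    rw [fderiv_of_eqOn_linear hB hα hy, he]
  constructor
  · intro F
    obtain ⟨f, hf, hqf⟩ := exists_comp_of_eqOn_linear he hB hc hα F.smooth_pressure
      fun y hy w hw => by rw [F.pressure y hy, h0 r q F y hy, hw]; simp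
    refine ⟨f, hf, fun y hy => ⟨hqf y hy, ?_⟩⟩
    have h1 := (Filter.eventuallyEq_of_mem (hB.mem_nhds hy) hqf).fderiv_eq (𝕜 := ℝ)
    rw [(fderiv_comp_real hB I.smooth_log himg hf hy).fderiv] at h1
    have h2 := F.pressure y hy e
    rw [h0 r q F y hy, h1] at h2
    simp only [smul_apply, smul_eq_mul, hαe y hy] at h2
    rw [← hqf y hy]
    linarith
  · rintro ⟨f, hf, h⟩
    have hf' : ContDiffOn ℝ ∞ (deriv f) (α '' B) := hf.deriv_of_isOpen himg (by simp)
    have hq : ∀ y ∈ B, fderiv ℝ q y = deriv f (α y) • fderiv ℝ α y := fun y hy => by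
      rw [(Filter.eventuallyEq_of_mem (hB.mem_nhds hy) fun z hz => (h z hz).1).fderiv_eq,
        (fderiv_comp_real hB I.smooth_log himg hf hy).fderiv]
    have hr : ∀ y ∈ B, r y = (fun t => -f t - deriv f t) (α y) := fun y hy => (h y hy).2
    have hφ : ContDiffOn ℝ ∞ (fun t => -f t - deriv f t) (α '' B) := hf.neg.sub hf'
    refine ⟨(contDiffOn_comp_image I.smooth_log hφ).congr hr,
      (contDiffOn_comp_image I.smooth_log hf).congr fun y hy => (h y hy).1, fun y hy => ?_,
      fun y hy w => ?_⟩
    · rw [(Filter.eventuallyEq_of_mem (hB.mem_nhds hy) hr).fderiv_eq,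
        (fderiv_comp_real hB I.smooth_log himg hφ hy).fderiv]
      simp [I.log_field y hy]
    · rw [hq y hy, (h y hy).1, (h y hy).2]
      simp [I.log_field y hy]
      ring

/-- The fluids when the velocity is `u = -dτ` and has no acceleration: then `dq = -X(q) χ` is
proportional to `dτ`. -/
theorem isFluid_iff_of_log_const (I : InvariantForm X χ α B) (hc : Convex ℝ B) (he : ℓ e = 1)
    {τ : E → ℝ} (hτ : ∀ y ∈ B, τ y = ℓ y) (hα : ∀ y ∈ B, fderiv ℝ α y = 0)
    (hχ : ∀ y ∈ B, ∀ w, Real.exp (α y) * χ y w = -fderiv ℝ τ y w) :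
    IsFluid X χ α r q B ↔ (∃ f : ℝ → ℝ, ContDiffOn ℝ ∞ f (τ '' B) ∧ ∀ y ∈ B, q y = f (τ y)) ∧
      ContDiffOn ℝ ∞ r B ∧ ∀ y ∈ B, fderiv ℝ r y (X y) = 0 := by
  have hB := I.isOpen
  have himg := isOpen_image_of_eqOn_linear he hB hτ
  have hτs : ContDiffOn ℝ ∞ τ B := ℓ.contDiff.contDiffOn.congr hτ
  constructor
  · intro F
    refine ⟨?_, F.smooth_density, F.density_field⟩
    refine exists_comp_of_eqOn_linear he hB hc hτ F.smooth_pressure fun y hy w hw => ?_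
    have h1 := hχ y hy w
    rw [hw, neg_zero] at h1
    rw [F.pressure y hy, hα y hy, (mul_eq_zero.mp h1).resolve_left (Real.exp_pos _).ne']
    simp
  · rintro ⟨⟨f, hf, h⟩, hrs, hr⟩
    refine ⟨hrs, (contDiffOn_comp_image hτs hf).congr h, hr, fun y hy w => ?_⟩
    have hX := hχ y hy (X y)
    rw [I.form_field y hy] at hX
    rw [(Filter.eventuallyEq_of_mem (hB.mem_nhds hy) h).fderiv_eq,
      (fderiv_comp_real hB hτs himg hf hy).fderiv, hα y hy]
    have hw := hχ y hy w
    simp only [smul_apply, smul_eq_mul, zero_apply]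
    linear_combination deriv f (τ y) * hw + deriv f (τ y) * χ y w * hX

/-- The fluids when the velocity is `u = -dτ + μ dα` and the invariant form is nowhere closed. Then
`e^α X(q)` is a constant `c`, and `q - c τ e^{-2α}` has a differential proportional to `dα`. -/
theorem isFluid_iff_of_eq_add (I : InvariantForm X χ α B) (hc : Convex ℝ B)
    (he : ℓ e = 1) (hα : ∀ y ∈ B, α y = ℓ y) {τ μ : E → ℝ} (hτ : ContDiffOn ℝ ∞ τ B)
    (hμ : ContDiffOn ℝ ∞ μ B)
    (hχ : ∀ y ∈ B, ∀ w, Real.exp (α y) * χ y w = -fderiv ℝ τ y w + μ y * fderiv ℝ α y w)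
    (hd : ∀ y ∈ B, ∃ v w, fderiv ℝ χ y v w ≠ fderiv ℝ χ y w v) :
    IsFluid X χ α r q B ↔ ∃ (c : ℝ) (f : ℝ → ℝ), ContDiffOn ℝ ∞ f (α '' B) ∧
      ∀ y ∈ B, q y = c * τ y * Real.exp (-2 * α y) + f (α y) ∧
        r y = c * (τ y - μ y) * Real.exp (-2 * α y) - f (α y) - deriv f (α y) := by
  have hB := I.isOpen
  have himg := isOpen_image_of_eqOn_linear he hB hα
  have hαe : ∀ y ∈ B, fderiv ℝ α y e = 1 := fun y hy => by
    rw [fderiv_of_eqOn_linear hB hα hy, he]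
  have dα := fun y hy => (I.smooth_log.differentiableAt_of_isOpen hB (y := y) hy).hasFDerivAt
  have dτ := fun y hy => (hτ.differentiableAt_of_isOpen hB (y := y) hy).hasFDerivAt
  have dμ := fun y hy => (hμ.differentiableAt_of_isOpen hB (y := y) hy).hasFDerivAt
  have hexp : ∀ y, Real.exp (-2 * α y) * Real.exp (α y) * Real.exp (α y) = 1 := fun y => by
    rw [← Real.exp_add, ← Real.exp_add, Real.exp_eq_one_iff]; ring
  have hs : ∀ c : ℝ, ContDiffOn ℝ ∞ (fun y => c * τ y * Real.exp (-2 * α y)) B := fun c =>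
    (contDiffOn_const.mul hτ).mul (contDiffOn_const.mul I.smooth_log).exp
  have dcτ : ∀ c, ∀ y ∈ B, ∀ w, fderiv ℝ (fun y => c * τ y * Real.exp (-2 * α y)) y w
      = c * Real.exp (-2 * α y) * (fderiv ℝ τ y w - 2 * τ y * fderiv ℝ α y w) := by
    intro c y hy w
    rw [(((dτ y hy).const_mul c).fun_mul ((dα y hy).const_mul (-2)).exp).fderiv]
    simp only [add_apply, smul_apply, smul_eq_mul]
    ring
  constructor
  · intro F
    obtain ⟨c, hk⟩ := hB.exists_is_const_of_fderiv_eq_zero (𝕜 := ℝ) hc.isPreconnected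
      ((F.smooth_rate I).differentiableOn (by simp)) fun y hy => by
        obtain ⟨v, w, hvw⟩ := hd y hy
        exact F.fderiv_rate_eq_zero I hy hvw
    have hdq : ∀ y ∈ B, ∀ w, fderiv ℝ q y w = c * Real.exp (-2 * α y) * (fderiv ℝ τ y w
        - μ y * fderiv ℝ α y w) - (r y + q y) * fderiv ℝ α y w := by
      intro y hy w
      rw [F.pressure y hy w]
      have h1 := hk y hy
      have h2 := hχ y hy w
      have h3 : fderiv ℝ q y (X y) * χ y w = c * Real.exp (-2 * α y) *
          (Real.exp (α y) * χ y w) := by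
        rw [← h1]
        linear_combination -fderiv ℝ q y (X y) * χ y w * hexp y
      rw [h3, h2]; ring
    have hsub : ContDiffOn ℝ ∞ (fun y => q y - c * τ y * Real.exp (-2 * α y)) B :=
      F.smooth_pressure.sub (hs c)
    have hdP : ∀ y ∈ B, ∀ w, fderiv ℝ (fun y => q y - c * τ y * Real.exp (-2 * α y)) y w
        = (c * Real.exp (-2 * α y) * (2 * τ y - μ y) - (r y + q y)) * fderiv ℝ α y w := by
      intro y hy w
      rw [fderiv_fun_sub (F.smooth_pressure.differentiableAt_of_isOpen hB hy)
        ((hs c).differentiableAt_of_isOpen hB hy), sub_apply, dcτ c y hy, hdq y hy]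
      ring
    obtain ⟨f, hf, hPf⟩ := exists_comp_of_eqOn_linear he hB hc hα hsub
      fun y hy w hw => by rw [hdP y hy, hw, mul_zero]
    refine ⟨c, f, hf, fun y hy => ?_⟩
    have h1 := (Filter.eventuallyEq_of_mem (hB.mem_nhds hy) hPf).fderiv_eq (𝕜 := ℝ)
    have h2 := hdP y hy e
    rw [h1, (fderiv_comp_real hB I.smooth_log himg hf hy).fderiv] at h2
    simp only [smul_apply, smul_eq_mul, hαe y hy] at h2
    have h3 := hPf y hy
    exact ⟨by linarith, by rw [← h3]; linarith⟩
  · rintro ⟨c, f, hf, h⟩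
    have hf' : ContDiffOn ℝ ∞ (deriv f) (α '' B) := hf.deriv_of_isOpen himg (by simp)
    have hτX : ∀ y ∈ B, fderiv ℝ τ y (X y) = Real.exp (α y) := fun y hy => by
      have := hχ y hy (X y)
      rw [I.form_field y hy, I.log_field y hy] at this
      linarith
    -- `X(μ) = X(τ)`, from the exterior derivative of the expression of `u`
    have hμX : ∀ y ∈ B, fderiv ℝ μ y (X y) = Real.exp (α y) := by
      intro y hy
      have h1 : ∀ z ∈ B, fderiv ℝ τ z = μ z • fderiv ℝ α z - Real.exp (α z) • χ z := by
        intro z hz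
        ext w
        have := hχ z hz w
        simp only [sub_apply, smul_apply, smul_eq_mul]
        linarith
      have dχ := (I.smooth_form.differentiableAt_of_isOpen hB hy).hasFDerivAt
      have ddα := ((I.smooth_log.fderiv_of_isOpen (m := ∞) hB
        (by simp)).differentiableAt_of_isOpen hB hy).hasFDerivAt
      have h2 := fderiv_symm_of_eqOn_fderiv hB hτ h1 hy (X y) e
      have h3 := fderiv_symm_of_eqOn_fderiv hB I.smooth_log (fun _ _ => rfl) hy (X y) e
      rw [(((dμ y hy).fun_smul ddα).fun_sub ((dα y hy).exp.fun_smul dχ)).fderiv] at h2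
      simp at h2
      rw [h3, I.log_field y hy, I.form_field y hy, I.inter_field y hy, hαe y hy] at h2
      linarith
    have hq : ∀ y ∈ B, ∀ w, fderiv ℝ q y w = c * Real.exp (-2 * α y) * (fderiv ℝ τ y w
        - 2 * τ y * fderiv ℝ α y w) + deriv f (α y) * fderiv ℝ α y w := fun y hy w => by
      rw [(Filter.eventuallyEq_of_mem (hB.mem_nhds hy) fun z hz => (h z hz).1).fderiv_eq,
        fderiv_fun_add ((hs c).differentiableAt_of_isOpen hB hy)
          (fderiv_comp_real hB I.smooth_log himg hf hy).differentiableAt,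
        (fderiv_comp_real hB I.smooth_log himg hf hy).fderiv, add_apply, dcτ c y hy]
      simp
    have hr : ∀ y ∈ B, r y = c * (τ y - μ y) * Real.exp (-2 * α y)
        + (fun t => -f t - deriv f t) (α y) := fun y hy => by rw [(h y hy).2]; ring
    have hφ : ContDiffOn ℝ ∞ (fun t => -f t - deriv f t) (α '' B) := hf.neg.sub hf'
    have hs' : ContDiffOn ℝ ∞ (fun y => c * (τ y - μ y) * Real.exp (-2 * α y)) B :=
      (contDiffOn_const.mul (hτ.sub hμ)).mul (contDiffOn_const.mul I.smooth_log).exp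
    refine ⟨(hs'.add (contDiffOn_comp_image I.smooth_log hφ)).congr hr,
      ((hs c).add (contDiffOn_comp_image I.smooth_log hf)).congr fun y hy => (h y hy).1,
      fun y hy => ?_, fun y hy w => ?_⟩
    · rw [(Filter.eventuallyEq_of_mem (hB.mem_nhds hy) hr).fderiv_eq,
        fderiv_fun_add (hs'.differentiableAt_of_isOpen hB hy)
          (fderiv_comp_real hB I.smooth_log himg hφ hy).differentiableAt,
        (fderiv_comp_real hB I.smooth_log himg hφ hy).fderiv,
        (((((dτ y hy).fun_sub (dμ y hy)).const_mul c).fun_mul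
          ((dα y hy).const_mul (-2)).exp)).fderiv]
      simp [I.log_field y hy, hτX y hy, hμX y hy]
    · rw [hq y hy, hq y hy, I.log_field y hy, hτX y hy, (h y hy).1, (h y hy).2]
      linear_combination c * Real.exp (-2 * α y) * hχ y hy w

/-- The fluids when the velocity is `u = -e^α dτ`. Then `e^α X(q)` is a function of `τ`; if `f₀` is
a primitive of this function, then `q - f₀(τ) e^{-α}` has a differential proportional to `dα`. -/
theorem isFluid_iff_of_integrable (I : InvariantForm X χ α B) (hc : Convex ℝ B) (he : ℓ e = 1)
    (hα : ∀ y ∈ B, α y = ℓ y) (he' : ℓ' e' = 1) {τ : E → ℝ} (hτ : ∀ y ∈ B, τ y = ℓ' y)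
    (hχ : ∀ y ∈ B, ∀ w, χ y w = -fderiv ℝ τ y w) :
    IsFluid X χ α r q B ↔ ∃ f₀ f₁ : ℝ → ℝ, ContDiffOn ℝ ∞ f₀ (τ '' B) ∧
      ContDiffOn ℝ ∞ f₁ (α '' B) ∧ ∀ y ∈ B, q y = f₀ (τ y) * Real.exp (-α y) + f₁ (α y) ∧
        r y = -f₁ (α y) - deriv f₁ (α y) := by
  have hB := I.isOpen
  have himg := isOpen_image_of_eqOn_linear he hB hα
  have himg' := isOpen_image_of_eqOn_linear he' hB hτ
  have hτs : ContDiffOn ℝ ∞ τ B := ℓ'.contDiff.contDiffOn.congr hτ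
  have hαe : ∀ y ∈ B, fderiv ℝ α y e = 1 := fun y hy => by
    rw [fderiv_of_eqOn_linear hB hα hy, he]
  have dα := fun y hy => (I.smooth_log.differentiableAt_of_isOpen hB (y := y) hy).hasFDerivAt
  have hτX : ∀ y ∈ B, fderiv ℝ τ y (X y) = 1 := fun y hy => by
    have := hχ y hy (X y)
    rw [I.form_field y hy] at this
    linarith
  have hexp : ∀ y, Real.exp (α y) * Real.exp (-α y) = 1 := fun y => by
    rw [← Real.exp_add, Real.exp_eq_one_iff]; ring
  have hs : ∀ f : ℝ → ℝ, ContDiffOn ℝ ∞ f (τ '' B) →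
      ContDiffOn ℝ ∞ (fun y => f (τ y) * Real.exp (-α y)) B := fun f hf =>
    (contDiffOn_comp_image hτs hf).mul I.smooth_log.neg.exp
  have dfτ : ∀ f : ℝ → ℝ, ContDiffOn ℝ ∞ f (τ '' B) → ∀ y ∈ B, ∀ w,
      fderiv ℝ (fun y => f (τ y) * Real.exp (-α y)) y w = Real.exp (-α y) *
        (deriv f (τ y) * fderiv ℝ τ y w - f (τ y) * fderiv ℝ α y w) := by
    intro f hf y hy w
    rw [((fderiv_comp_real hB hτs himg' hf hy).fun_mul (dα y hy).fun_neg.exp).fderiv]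
    simp only [add_apply, smul_apply, smul_eq_mul, neg_apply]
    ring
  constructor
  · intro F
    obtain ⟨κ, hκ, hkκ⟩ := exists_comp_of_eqOn_linear he' hB hc hτ (F.smooth_rate I)
      fun y hy w hw => by rw [F.fderiv_rate I hy, hχ y hy, hw]; simp
    have hconv : Convex ℝ (τ '' B) := by
      rw [Set.EqOn.image_eq (f₂ := ℓ') hτ]
      exact hc.linear_image ℓ'.toLinearMap
    obtain ⟨f₀, hf₀, hd₀⟩ := exists_contDiffOn_primitive himg' hconv hκ
    have hsub : ContDiffOn ℝ ∞ (fun y => q y - f₀ (τ y) * Real.exp (-α y)) B :=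
      F.smooth_pressure.sub (hs f₀ hf₀)
    have hdP : ∀ y ∈ B, ∀ w, fderiv ℝ (fun y => q y - f₀ (τ y) * Real.exp (-α y)) y w
        = (f₀ (τ y) * Real.exp (-α y) - (r y + q y)) * fderiv ℝ α y w := by
      intro y hy w
      have h1 := hkκ y hy
      rw [fderiv_fun_sub (F.smooth_pressure.differentiableAt_of_isOpen hB hy)
        ((hs f₀ hf₀).differentiableAt_of_isOpen hB hy), sub_apply, dfτ f₀ hf₀ y hy,
        F.pressure y hy w, hχ y hy w, hd₀ _ ⟨y, hy, rfl⟩, ← h1]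
      linear_combination -fderiv ℝ q y (X y) * fderiv ℝ τ y w * hexp y
    obtain ⟨f₁, hf₁, hPf⟩ := exists_comp_of_eqOn_linear he hB hc hα hsub
      fun y hy w hw => by rw [hdP y hy, hw, mul_zero]
    refine ⟨f₀, f₁, hf₀, hf₁, fun y hy => ?_⟩
    have h1 := (Filter.eventuallyEq_of_mem (hB.mem_nhds hy) hPf).fderiv_eq (𝕜 := ℝ)
    have h2 := hdP y hy e
    rw [h1, (fderiv_comp_real hB I.smooth_log himg hf₁ hy).fderiv] at h2
    simp only [smul_apply, smul_eq_mul, hαe y hy] at h2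
    have h3 := hPf y hy
    exact ⟨by linarith, by rw [← h3]; linarith⟩
  · rintro ⟨f₀, f₁, hf₀, hf₁, h⟩
    have hf' : ContDiffOn ℝ ∞ (deriv f₁) (α '' B) := hf₁.deriv_of_isOpen himg (by simp)
    have hq : ∀ y ∈ B, ∀ w, fderiv ℝ q y w = Real.exp (-α y) *
        (deriv f₀ (τ y) * fderiv ℝ τ y w - f₀ (τ y) * fderiv ℝ α y w)
          + deriv f₁ (α y) * fderiv ℝ α y w := fun y hy w => by
      rw [(Filter.eventuallyEq_of_mem (hB.mem_nhds hy) fun z hz => (h z hz).1).fderiv_eq,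
        fderiv_fun_add ((hs f₀ hf₀).differentiableAt_of_isOpen hB hy)
          (fderiv_comp_real hB I.smooth_log himg hf₁ hy).differentiableAt,
        (fderiv_comp_real hB I.smooth_log himg hf₁ hy).fderiv, add_apply, dfτ f₀ hf₀ y hy]
      simp
    have hr : ∀ y ∈ B, r y = (fun t => -f₁ t - deriv f₁ t) (α y) := fun y hy => (h y hy).2
    have hφ : ContDiffOn ℝ ∞ (fun t => -f₁ t - deriv f₁ t) (α '' B) := hf₁.neg.sub hf'
    refine ⟨(contDiffOn_comp_image I.smooth_log hφ).congr hr,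
      ((hs f₀ hf₀).add (contDiffOn_comp_image I.smooth_log hf₁)).congr fun y hy => (h y hy).1,
      fun y hy => ?_, fun y hy w => ?_⟩
    · rw [(Filter.eventuallyEq_of_mem (hB.mem_nhds hy) hr).fderiv_eq,
        (fderiv_comp_real hB I.smooth_log himg hφ hy).fderiv]
      simp [I.log_field y hy]
    · rw [hq y hy, hq y hy, I.log_field y hy, hτX y hy, (h y hy).1, (h y hy).2, hχ y hy w]
      ring

end Solutions

section Poincare

variable {E : Type} [NormedAddCommGroup E] [NormedSpace ℝ E] [ProperSpace E]

/-! ### A Poincaré lemma with parameters -/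

/-- Differentiation under the integral over a parameter in `[0, 1]`. -/
theorem hasFDerivAt_integral_param {F : Type} [NormedAddCommGroup F] [NormedSpace ℝ F]
    {f : E × ℝ → F} {W : Set (E × ℝ)} (hW : IsOpen W) {O : Set E} (hO : IsOpen O)
    (hOW : ∀ y ∈ O, ∀ t ∈ Set.Icc (0 : ℝ) 1, (y, t) ∈ W) (hf : ContDiffOn ℝ ∞ f W) {y : E}
    (hy : y ∈ O) :
    HasFDerivAt (fun y => ∫ t in (0 : ℝ)..1, f (y, t))
      (∫ t in (0 : ℝ)..1, (fderiv ℝ f (y, t)).comp (ContinuousLinearMap.inl ℝ E ℝ)) y := by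
  obtain ⟨ε, hε, hball⟩ := Metric.nhds_basis_closedBall.mem_iff.mp (hO.mem_nhds hy)
  have hKW : Metric.closedBall y ε ×ˢ Set.Icc (0 : ℝ) 1 ⊆ W := fun z hz =>
    hOW z.1 (hball hz.1) z.2 hz.2
  have hf' : ContDiffOn ℝ ∞
      (fun z => (fderiv ℝ f z).comp (ContinuousLinearMap.inl ℝ E ℝ)) W :=
    (hf.fderiv_of_isOpen hW (by simp)).clm_comp contDiffOn_const
  obtain ⟨C, hC⟩ := ((isCompact_closedBall y ε).prod isCompact_Icc).exists_bound_of_continuousOn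
    (hf'.continuousOn.mono hKW)
  have hsub : Set.uIoc (0 : ℝ) 1 ⊆ Set.Icc 0 1 := by
    rw [Set.uIoc_of_le zero_le_one]; exact Set.Ioc_subset_Icc_self
  have hcont : ∀ {F' : Type} [NormedAddCommGroup F'] {g : E × ℝ → F'} {z : E},
      ContinuousOn g W → z ∈ O → ContinuousOn (fun t => g (z, t)) (Set.Icc (0 : ℝ) 1) :=
    fun hg hz => hg.comp (by fun_prop) fun t ht => hOW _ hz t ht
  have hmeas : ∀ {F' : Type} [NormedAddCommGroup F'] {g : E × ℝ → F'} {z : E},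
      ContinuousOn g W → z ∈ O → MeasureTheory.AEStronglyMeasurable (fun t => g (z, t))
        (MeasureTheory.volume.restrict (Set.uIoc (0 : ℝ) 1)) := fun hg hz =>
    ((hcont hg hz).aestronglyMeasurable measurableSet_Icc).mono_measure
      (MeasureTheory.Measure.restrict_mono hsub le_rfl)
  refine intervalIntegral.hasFDerivAt_integral_of_dominated_of_fderiv_le (𝕜 := ℝ)
    (F := fun y t => f (y, t))
    (F' := fun y t => (fderiv ℝ f (y, t)).comp (ContinuousLinearMap.inl ℝ E ℝ))
    (s := Metric.closedBall y ε) (bound := fun _ => C) (Metric.closedBall_mem_nhds y hε)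
    ?_ ?_ ?_ ?_
    intervalIntegrable_const ?_
  · filter_upwards [Metric.closedBall_mem_nhds y hε] with z hz
    exact hmeas hf.continuousOn (hball hz)
  · exact ContinuousOn.intervalIntegrable (μ := MeasureTheory.volume)
      ((hcont hf.continuousOn hy).mono (by rw [Set.uIcc_of_le zero_le_one]))
  · exact hmeas hf'.continuousOn hy
  · exact Filter.Eventually.of_forall fun t ht z hz => hC (z, t) ⟨hz, hsub ht⟩
  · refine Filter.Eventually.of_forall fun t ht z hz => ?_
    have h1 := (hf.differentiableAt_of_isOpen hW (hOW z (hball hz) t (hsub ht))).hasFDerivAt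
    exact h1.comp z (hasFDerivAt_prodMk_left z t)

/-- The integral of a smooth function over a parameter in `[0, 1]` is smooth. -/
theorem contDiffOn_integral_param {F : Type} [NormedAddCommGroup F] [NormedSpace ℝ F]
    {f : E × ℝ → F} {W : Set (E × ℝ)} (hW : IsOpen W) {O : Set E} (hO : IsOpen O)
    (hOW : ∀ y ∈ O, ∀ t ∈ Set.Icc (0 : ℝ) 1, (y, t) ∈ W) (hf : ContDiffOn ℝ ∞ f W) :
    ContDiffOn ℝ ∞ (fun y => ∫ t in (0 : ℝ)..1, f (y, t)) O := by
  have key : ∀ n : ℕ, ∀ {F : Type} [NormedAddCommGroup F] [NormedSpace ℝ F] {f : E × ℝ → F},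
      ContDiffOn ℝ ∞ f W → ContDiffOn ℝ n (fun y => ∫ t in (0 : ℝ)..1, f (y, t)) O := by
    intro n
    induction n with
    | zero =>
      intro F _ _ f hf
      rw [Nat.cast_zero, contDiffOn_zero]
      exact fun y hy =>
        (hasFDerivAt_integral_param hW hO hOW hf hy).continuousAt.continuousWithinAt
    | succ n ih =>
      intro F _ _ f hf
      rw [Nat.cast_succ, contDiffOn_succ_iff_fderiv_of_isOpen hO]
      refine ⟨fun y hy => (hasFDerivAt_integral_param hW hO hOW hf
        hy).differentiableAt.differentiableWithinAt, by simp, ?_⟩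
      refine (ih (f := fun z => (fderiv ℝ f z).comp (ContinuousLinearMap.inl ℝ E ℝ))
        ((hf.fderiv_of_isOpen hW (by simp)).clm_comp contDiffOn_const)).congr fun y hy => ?_
      exact (hasFDerivAt_integral_param hW hO hOW hf hy).fderiv
  exact contDiffOn_infty.mpr fun n => key n hf

/-- A 1-form `η` on a convex domain whose restrictions to the translates of the range of a
projection `P` are closed has a smooth primitive along these translates. For `P = id` this is the
Poincaré lemma. The primitive at `y` is the integral of `η` along the segment that ends at `y` and
starts at the point `z = y - P (y - c)` of the translate through `y`, where `P (z - c) = 0`. -/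
theorem exists_primitive_along {B : Set E} (hB : IsOpen B) (hc : Convex ℝ B) (P : E →L[ℝ] E)
    (hP : ∀ y, P (P y) = P y) {c : E} (hcP : ∀ y ∈ B, y - P (y - c) ∈ B) {η : E → E →L[ℝ] ℝ}
    (hη : ContDiffOn ℝ ∞ η B)
    (hsymm : ∀ y ∈ B, ∀ v w, P v = v → P w = w → fderiv ℝ η y v w = fderiv ℝ η y w v) :
    ∃ f : E → ℝ, ContDiffOn ℝ ∞ f B ∧ ∀ y ∈ B, ∀ w, P w = w → fderiv ℝ f y w = η y w := by
  set γ : E × ℝ → E := fun z => z.1 - (1 - z.2) • P (z.1 - c) with hγ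
  have hγs : ContDiff ℝ ∞ γ := by fun_prop
  have hW : IsOpen (γ ⁻¹' B) := hB.preimage hγs.continuous
  have hmem : ∀ y ∈ B, ∀ t ∈ Set.Icc (0 : ℝ) 1, (y, t) ∈ γ ⁻¹' B := by
    intro y hy t ht
    have h1 : γ (y, t) = (y - P (y - c)) + t • (y - (y - P (y - c))) := by
      simp only [hγ]; module
    rw [Set.mem_preimage, h1]
    exact hc.add_smul_sub_mem (hcP y hy) hy ht
  have hg : ContDiffOn ℝ ∞ (fun z : E × ℝ => η (γ z) (P (z.1 - c))) (γ ⁻¹' B) :=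
    (hη.comp hγs.contDiffOn fun z hz => hz).clm_apply
      (ContDiff.contDiffOn (by fun_prop))
  refine ⟨_, contDiffOn_integral_param hW hB hmem hg, fun y hy w hw => ?_⟩
  rw [(hasFDerivAt_integral_param hW hB hmem hg hy).fderiv]
  have hcontA : ContinuousOn (fun t : ℝ =>
      (fderiv ℝ (fun z : E × ℝ => η (γ z) (P (z.1 - c))) (y, t)).comp
        (ContinuousLinearMap.inl ℝ E ℝ)) (Set.Icc 0 1) :=
    (((hg.fderiv_of_isOpen (m := ∞) hW (by simp)).continuousOn.comp (by fun_prop)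
      fun t ht => hmem y hy t ht).clm_comp continuousOn_const)
  have huIcc : Set.uIcc (0 : ℝ) 1 = Set.Icc 0 1 := Set.uIcc_of_le zero_le_one
  rw [ContinuousLinearMap.intervalIntegral_apply (by
    exact (hcontA.mono huIcc.le).intervalIntegrable)]
  -- the derivative of the integrand in the direction `w` is the derivative of `t * η (γ (y, t)) w`
  -- with respect to `t`
  have hder : ∀ t ∈ Set.uIcc (0 : ℝ) 1, HasDerivAt (fun t : ℝ => t * η (γ (y, t)) w)
      ((fderiv ℝ (fun z : E × ℝ => η (γ z) (P (z.1 - c))) (y, t)).comp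
        (ContinuousLinearMap.inl ℝ E ℝ) w) t := by
    intro t ht
    rw [huIcc] at ht
    have dη := (hη.differentiableAt_of_isOpen hB (hmem y hy t ht)).hasFDerivAt
    have d1 : HasFDerivAt γ (fderiv ℝ γ (y, t)) (y, t) :=
      (hγs.differentiable (by simp) _).hasFDerivAt
    have d1w : fderiv ℝ γ (y, t) (w, 0) = t • w := by
      have : HasFDerivAt γ _ (y, t) := hasFDerivAt_fst.fun_sub
        (((hasFDerivAt_const (1 : ℝ) _).fun_sub hasFDerivAt_snd).fun_smul
          ((P.hasFDerivAt.comp _ (hasFDerivAt_fst.sub_const c))))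
      rw [this.fderiv]
      simp [hw, sub_smul]
    have d2 : HasFDerivAt (fun z : E × ℝ => P (z.1 - c)) (P.comp (ContinuousLinearMap.fst ℝ E ℝ))
        (y, t) := P.hasFDerivAt.comp _ (hasFDerivAt_fst.sub_const c)
    have d3 := (dη.comp (y, t) d1).clm_apply d2
    have h3 : (fderiv ℝ (fun z : E × ℝ => η (γ z) (P (z.1 - c))) (y, t)).comp
        (ContinuousLinearMap.inl ℝ E ℝ) w
        = η (γ (y, t)) w + t * fderiv ℝ η (γ (y, t)) (P (y - c)) w := by
      have h4 := hsymm _ (hmem y hy t ht) w (P (y - c)) hw (hP _)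
      rw [show fderiv ℝ (fun z : E × ℝ => η (γ z) (P (z.1 - c))) (y, t) = _ from d3.fderiv]
      simp [hw, d1w, h4, -map_sub]
    have d4 : HasDerivAt (fun t : ℝ => γ (y, t)) (P (y - c)) t := by
      have : HasDerivAt (fun t : ℝ => y - (1 - t) • P (y - c)) _ t :=
        (((hasDerivAt_id t).const_sub 1).smul_const (P (y - c))).const_sub y
      exact this.congr_deriv (by simp [-map_sub])
    have d5 : HasDerivAt (fun t => η (γ (y, t))) (fderiv ℝ η (γ (y, t)) (P (y - c))) t :=
      dη.comp_hasDerivAt t d4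
    have d6 : HasDerivAt (fun t => η (γ (y, t)) w) (fderiv ℝ η (γ (y, t)) (P (y - c)) w) t := by
      simpa [-map_sub] using d5.clm_apply (hasDerivAt_const t w)
    rw [h3]
    exact ((hasDerivAt_id' t).fun_mul d6).congr_deriv (by ring)
  rw [intervalIntegral.integral_eq_sub_of_hasDerivAt hder
    (ContinuousOn.intervalIntegrable ((hcontA.clm_apply continuousOn_const).mono huIcc.le))]
  simp [hγ]

end Poincare

/-! ### Stationary fields as invariant forms -/

/-- The 1-form on the coordinate space with given components. -/
def toForm (x : Vec) (y : Coord) : Coord →L[ℝ] ℝ :=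
  ∑ i, x y i • (EuclideanSpace.proj i : Coord →L[ℝ] ℝ)

/-- The vector field on the coordinate space with given components. -/
def toField (X : Vec) (y : Coord) : Coord := WithLp.toLp 2 (X y)

theorem toForm_apply (x : Vec) (y w : Coord) : toForm x y w = ∑ i, w i * x y i := by
  simp [toForm, mul_comm]

theorem fderiv_toField (f : Scal) (X : Vec) (y : Coord) :
    fderiv ℝ f y (toField X y) = ∑ i, X y i * pd i f y :=
  fderiv_apply_eq_sum_pd f y _

theorem fderiv_toForm {x : Vec} {y : Coord} (hx : ∀ i, DifferentiableAt ℝ (fun q => x q i) y)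
    (v w : Coord) :
    fderiv ℝ (toForm x) y v w = ∑ i, ∑ j, v i * w j * pd i (fun q => x q j) y := by
  have h : HasFDerivAt (fun y => ∑ j, x y j • (EuclideanSpace.proj j : Coord →L[ℝ] ℝ)) _ y :=
    HasFDerivAt.fun_sum fun j _ => (hx j).hasFDerivAt.smul_const
      (EuclideanSpace.proj j : Coord →L[ℝ] ℝ)
  rw [show fderiv ℝ (toForm x) y = _ from h.fderiv, Finset.sum_comm]
  simp only [sum_apply, ContinuousLinearMap.smulRight_apply, smul_apply,
    fderiv_apply_eq_sum_pd, smul_eq_mul, Finset.sum_mul, PiLp.proj_apply]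
  exact Finset.sum_congr rfl fun j _ => Finset.sum_congr rfl fun i _ => by ring

theorem fderiv_toForm_sub {x : Vec} {y : Coord} (hx : ∀ i, DifferentiableAt ℝ (fun q => x q i) y)
    (v w : Coord) : fderiv ℝ (toForm x) y v w - fderiv ℝ (toForm x) y w v
      = ∑ i, ∑ j, v i * w j * extD x y i j := by
  rw [fderiv_toForm hx, fderiv_toForm hx,
    Finset.sum_comm (f := fun i j => w i * v j * pd i (fun q => x q j) y)]
  simp only [← Finset.sum_sub_distrib, extD, Matrix.of_apply]
  exact Finset.sum_congr rfl fun j _ => Finset.sum_congr rfl fun i _ => by ring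

theorem contDiffOn_toForm {x : Vec} {O : Set Coord}
    (hx : ∀ i, ContDiffOn ℝ ∞ (fun q => x q i) O) : ContDiffOn ℝ ∞ (toForm x) O :=
  ContDiffOn.sum fun i _ => (hx i).smul contDiffOn_const

theorem contDiffOn_toField {X : Vec} {O : Set Coord}
    (hX : ∀ i, ContDiffOn ℝ ∞ (fun q => X q i) O) : ContDiffOn ℝ ∞ (toField X) O :=
  contDiffOn_euclidean.mpr hX

/-- The pointwise form of the conservation equations for `IsFluid`. -/
theorem fluidEq_iff {G : Ten} {X u : Vec} {α r q : Scal} {y : Coord} :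
    FluidEq G X u α r q y ↔ fderiv ℝ r y (toField X y) = 0 ∧
      ∀ w, fderiv ℝ q y w = -(fderiv ℝ q y (toField X y) * toForm (invForm G u α) y w)
        - (r y + q y) * fderiv ℝ α y w := by
  simp only [fderiv_toField]
  refine and_congr_right fun _ => ⟨fun h w => ?_, fun h j => ?_⟩
  · rw [fderiv_apply_eq_sum_pd, toForm_apply, fderiv_apply_eq_sum_pd, Finset.mul_sum,
      Finset.mul_sum, ← Finset.sum_neg_distrib, ← Finset.sum_sub_distrib]
    exact Finset.sum_congr rfl fun j _ => by rw [h j]; ring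
  · have := h (EuclideanSpace.single j 1)
    rw [toForm_apply] at this
    simp only [PiLp.single_apply, ite_mul, one_mul, zero_mul, Finset.sum_ite_eq',
      Finset.mem_univ, if_true] at this
    rw [neg_mul]
    exact this

namespace IsStationary

variable {G : Ten} {X u : Vec} {α : Scal} {O : Set Coord}

theorem form_sub (S : IsStationary G X u α O) {y : Coord} (hy : y ∈ O) (v w : Coord) :
    fderiv ℝ (toForm (invForm G u α)) y v w - fderiv ℝ (toForm (invForm G u α)) y w v
      = ∑ i, ∑ j, v i * w j * extD (invForm G u α) y i j :=
  fderiv_toForm_sub (fun i => S.differentiableAt (S.smooth_invForm i) hy) v w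

theorem invariantForm (S : IsStationary G X u α O) :
    InvariantForm (toField X) (toForm (invForm G u α)) α O where
  isOpen := S.isOpen
  smooth_field := contDiffOn_toField S.smooth_field
  smooth_form := contDiffOn_toForm S.smooth_invForm
  smooth_log := S.smooth_log
  form_field y hy := by rw [toForm_apply]; exact S.sum_field_invForm hy
  log_field y hy := by rw [fderiv_toField]; exact S.field_log hy
  inter_field y hy v := by
    rw [← sub_eq_zero, S.form_sub hy, Finset.sum_comm]
    refine Finset.sum_eq_zero fun j _ => ?_
    have : ∀ i, toField X y i * v j * extD (invForm G u α) y i j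
        = v j * (X y i * extD (invForm G u α) y i j) := fun i => by
      rw [toField]; ring
    simp only [this, ← Finset.mul_sum, S.sum_field_extD_invForm hy, mul_zero]

/-- The invariant form is closed exactly where the rotation vanishes. -/
theorem rot_eq_zero_iff_form (S : IsStationary G X u α O) {y : Coord} (hy : y ∈ O) :
    rot G u y = 0 ↔ ∀ v w, fderiv ℝ (toForm (invForm G u α)) y v w
      = fderiv ℝ (toForm (invForm G u α)) y w v := by
  rw [S.rot_eq_zero_iff hy]
  constructor
  · intro h v w
    rw [← sub_eq_zero, S.form_sub hy]
    simp [h]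
  · intro h i j
    have := S.form_sub hy (EuclideanSpace.single i 1) (EuclideanSpace.single j 1)
    rw [h, sub_self] at this
    simpa using this.symm

theorem fderiv_log_eq_zero_iff (S : IsStationary G X u α O) {y : Coord} (hy : y ∈ O) :
    acc G u y = 0 ↔ fderiv ℝ α y = 0 := by
  rw [S.acc_eq hy]
  constructor
  · intro h
    ext w
    rw [fderiv_apply_eq_sum_pd]
    exact Finset.sum_eq_zero fun i _ => by
      rw [show pd i α y = 0 from congrFun h i, mul_zero]
  · intro h
    ext i
    simp [grad, pd, h]

/-- Where the rotation is not orthogonal to the acceleration, the pressure of a fluid is constant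
along the velocity: otherwise the integrability condition `X(q) dχ = -dr ∧ dα` makes `dχ` divisible
by `dα`. -/
theorem rate_eq_zero (S : IsStationary G X u α O) {r q : Scal}
    (F : IsFluid (toField X) (toForm (invForm G u α)) α r q O) {y : Coord} (hy : y ∈ O)
    (h : ip G (rot G u) (acc G u) y ≠ 0) : fderiv ℝ q y (toField X y) = 0 := by
  by_contra hne
  refine h (S.ip_rot_acc_eq_zero hy
    (z := fun i => (fderiv ℝ q y (toField X y))⁻¹ * pd i r y) fun i j => ?_)
  have h1 := F.integrability S.invariantForm hy (EuclideanSpace.single i 1)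
    (EuclideanSpace.single j 1)
  have h2 := S.form_sub hy (EuclideanSpace.single i 1) (EuclideanSpace.single j 1)
  rw [h2] at h1
  simp only [PiLp.single_apply, ite_mul, one_mul, zero_mul, Finset.sum_ite_eq', mul_ite, mul_one,
      mul_zero, Finset.mem_univ, if_true] at h1
  change _ + pd i r y * pd j α y - pd j r y * pd i α y = 0 at h1
  field_simp
  linarith

/-- Where the acceleration does not vanish and the rotation is orthogonal to it, the invariant form
is closed on the level sets of `α`. -/
theorem form_symm_of_log (S : IsStationary G X u α O) {y : Coord} (hy : y ∈ O)
    (ha : acc G u y ≠ 0) (h : ip G (rot G u) (acc G u) y = 0) {v w : Coord}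
    (hv : fderiv ℝ α y v = 0) (hw : fderiv ℝ α y w = 0) :
    fderiv ℝ (toForm (invForm G u α)) y v w = fderiv ℝ (toForm (invForm G u α)) y w v := by
  rw [S.acc_eq hy] at ha
  obtain ⟨z, hz⟩ := S.exists_extD_invForm hy ha h
  rw [← sub_eq_zero, S.form_sub hy]
  have h1 : ∑ i, ∑ j, v i * w j * extD (invForm G u α) y i j
      = fderiv ℝ α y v * (∑ j, w j * z j) - fderiv ℝ α y w * ∑ i, v i * z i := by
    rw [fderiv_apply_eq_sum_pd, fderiv_apply_eq_sum_pd, Finset.sum_mul_sum,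
      mul_comm (∑ i, w i * _), Finset.sum_mul_sum, ← Finset.sum_sub_distrib]
    refine Finset.sum_congr rfl fun i _ => ?_
    rw [← Finset.sum_sub_distrib]
    exact Finset.sum_congr rfl fun j _ => by rw [hz]; ring
  rw [h1, hv, hw]
  ring

end IsStationary

/-! ### Passage to coordinates -/

section Charts

set_option linter.unusedSectionVars false

variable {M : Type*} [TopologicalSpace M] [ChartedSpace (EuclideanSpace ℝ (Fin 4)) M]
  [IsManifold (𝓡 4) ∞ M]
  {φ : OpenPartialHomeomorph M (EuclideanSpace ℝ (Fin 4))}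

/-- The differential of the inverse of a chart. -/
def dSymm (φ : OpenPartialHomeomorph M (EuclideanSpace ℝ (Fin 4))) (y : Coord) :
    Coord →L[ℝ] TangentSpace (𝓡 4) (φ.symm y) :=
  mfderiv (𝓡 4) (𝓡 4) φ.symm y

/-- The components of a tangent vector in a chart. -/
def dChart (φ : OpenPartialHomeomorph M (EuclideanSpace ℝ (Fin 4))) (x : M) :
    TangentSpace (𝓡 4) x →L[ℝ] Coord :=
  mfderiv (𝓡 4) (𝓡 4) φ x

theorem mdifferentiableAt_chart (hφ : φ ∈ IsManifold.maximalAtlas (𝓡 4) ∞ M) {x : M}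
    (hx : x ∈ φ.source) : MDifferentiableAt (𝓡 4) (𝓡 4) φ x :=
  (contMDiffAt_of_mem_maximalAtlas hφ hx).mdifferentiableAt (by simp)

theorem mdifferentiableAt_symm (hφ : φ ∈ IsManifold.maximalAtlas (𝓡 4) ∞ M) {y : Coord}
    (hy : y ∈ φ.target) : MDifferentiableAt (𝓡 4) (𝓡 4) φ.symm y :=
  (contMDiffAt_symm_of_mem_maximalAtlas hφ hy).mdifferentiableAt (by simp)

theorem dChart_dSymm (hφ : φ ∈ IsManifold.maximalAtlas (𝓡 4) ∞ M) {y : Coord}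
    (hy : y ∈ φ.target) (w : Coord) : dChart φ (φ.symm y) (dSymm φ y w) = w := by
  have h1 := mfderiv_comp y (mdifferentiableAt_chart hφ (φ.map_target hy))
    (mdifferentiableAt_symm hφ hy)
  have h2 : (φ ∘ φ.symm) =ᶠ[𝓝 y] id :=
    Filter.eventuallyEq_of_mem (φ.open_target.mem_nhds hy) fun z hz => φ.right_inv hz
  rw [h2.mfderiv_eq, mfderiv_id] at h1
  exact (congrArg (fun L : Coord →L[ℝ] Coord => L w) h1).symm

theorem dSymm_dChart (hφ : φ ∈ IsManifold.maximalAtlas (𝓡 4) ∞ M) {y : Coord}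
    (hy : y ∈ φ.target) (W : TangentSpace (𝓡 4) (φ.symm y)) :
    dSymm φ y (dChart φ (φ.symm y) W) = W := by
  have hs := φ.map_target hy
  have hy' : MDifferentiableAt (𝓡 4) (𝓡 4) φ.symm (φ (φ.symm y)) := by
    rw [φ.right_inv hy]; exact mdifferentiableAt_symm hφ hy
  have h1 := mfderiv_comp (φ.symm y) hy' (mdifferentiableAt_chart hφ hs)
  have h2 : (φ.symm ∘ φ) =ᶠ[𝓝 (φ.symm y)] id :=
    Filter.eventuallyEq_of_mem (φ.open_source.mem_nhds hs) fun z hz => φ.left_inv hz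
  rw [h2.mfderiv_eq, mfderiv_id] at h1
  have h3 := (congrArg (fun L : Coord →L[ℝ] Coord => L W) h1).symm
  have h4 : φ (φ.symm y) = y := φ.right_inv hy
  have h5 : ∀ z, z = y → ∀ w : Coord, (mfderiv (𝓡 4) (𝓡 4) φ.symm z : Coord →L[ℝ] Coord) w
      = (mfderiv (𝓡 4) (𝓡 4) φ.symm y : Coord →L[ℝ] Coord) w := by
    rintro z rfl w; rfl
  exact (h5 _ h4 _).symm.trans h3

theorem toField_fieldIn (X : ∀ x : M, TangentSpace (𝓡 4) x) (y : Coord) :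
    toField (fieldIn X φ) y = dChart φ (φ.symm y) (X (φ.symm y)) := rfl

theorem dSymm_toField (hφ : φ ∈ IsManifold.maximalAtlas (𝓡 4) ∞ M)
    (X : ∀ x : M, TangentSpace (𝓡 4) x) {y : Coord} (hy : y ∈ φ.target) :
    dSymm φ y (toField (fieldIn X φ) y) = X (φ.symm y) := by
  rw [toField_fieldIn, dSymm_dChart hφ hy]

theorem dSymm_eq_sum (y w : Coord) :
    dSymm φ y w = ∑ i, w i • dSymm φ y (EuclideanSpace.single i 1) := by
  conv_lhs => rw [← (EuclideanSpace.basisFun (Fin 4) ℝ).sum_repr w]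
  rw [map_sum]
  exact Finset.sum_congr rfl fun i _ => by simp

theorem metricIn_apply (g : LorentzMetric M) (y : Coord) (i j : Fin 4) :
    metricIn g φ y i j = g.val (φ.symm y) (dSymm φ y (EuclideanSpace.single i 1))
      (dSymm φ y (EuclideanSpace.single j 1)) := rfl

theorem val_dSymm (g : LorentzMetric M) (y v w : Coord) :
    g.val (φ.symm y) (dSymm φ y v) (dSymm φ y w)
      = ∑ i, ∑ j, metricIn g φ y i j * v i * w j := by
  rw [dSymm_eq_sum y v, dSymm_eq_sum y w]
  simp only [map_sum, map_smul, sum_apply, smul_apply, smul_eq_mul, metricIn_apply]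
  rw [Finset.sum_comm]
  simp only [Finset.mul_sum]
  exact Finset.sum_congr rfl fun i _ => Finset.sum_congr rfl fun j _ => by ring

theorem dAt_dSymm (hφ : φ ∈ IsManifold.maximalAtlas (𝓡 4) ∞ M) {f : M → ℝ} {y : Coord}
    (hy : y ∈ φ.target) (hf : MDifferentiableAt (𝓡 4) 𝓘(ℝ, ℝ) f (φ.symm y)) (w : Coord) :
    dAt f (φ.symm y) (dSymm φ y w) = fderiv ℝ (f ∘ φ.symm) y w := by
  rw [← mfderiv_eq_fderiv, mfderiv_comp y hf (mdifferentiableAt_symm hφ hy)]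
  rfl

theorem contDiffOn_comp_symm (hφ : φ ∈ IsManifold.maximalAtlas (𝓡 4) ∞ M) {f : M → ℝ} {V : Set M}
    (hf : SmoothOn f V) (hV : φ.source ⊆ V) : ContDiffOn ℝ ∞ (f ∘ φ.symm) φ.target :=
  (hf.comp (contMDiffOn_symm_of_mem_maximalAtlas hφ) fun _ hy => hV (φ.map_target hy)).contDiffOn

theorem smoothOn_comp_chart (hφ : φ ∈ IsManifold.maximalAtlas (𝓡 4) ∞ M) {f : Coord → ℝ}
    (hf : ContDiffOn ℝ ∞ f φ.target) : SmoothOn (f ∘ φ) φ.source :=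
  hf.contMDiffOn.comp (contMDiffOn_of_mem_maximalAtlas hφ) fun _ hx => φ.map_source hx

theorem smoothOn_iff_contDiffOn (hφ : φ ∈ IsManifold.maximalAtlas (𝓡 4) ∞ M) {f : M → ℝ} :
    SmoothOn f φ.source ↔ ContDiffOn ℝ ∞ (f ∘ φ.symm) φ.target := by
  refine ⟨fun h => contDiffOn_comp_symm hφ h subset_rfl, fun h => ?_⟩
  refine (smoothOn_comp_chart hφ h).congr fun x hx => ?_
  simp [φ.left_inv hx]

theorem SmoothOn.mdifferentiableAt {f : M → ℝ} {V : Set M} (hf : SmoothOn f V) (hV : IsOpen V)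
    {x : M} (hx : x ∈ V) : MDifferentiableAt (𝓡 4) 𝓘(ℝ, ℝ) f x :=
  (hf.contMDiffAt (hV.mem_nhds hx)).mdifferentiableAt (by simp)

/-- The coordinate vector fields, and their constant combinations, are smooth. -/
theorem contMDiffOn_dSymm (hφ : φ ∈ IsManifold.maximalAtlas (𝓡 4) ∞ M) (e : Coord) :
    ContMDiffOn (𝓡 4) (𝓡 4).tangent ∞
      (fun y => (⟨φ.symm y, dSymm φ y e⟩ : TangentBundle (𝓡 4) M)) φ.target := by
  have h1 := (contMDiffOn_symm_of_mem_maximalAtlas hφ).contMDiffOn_tangentMapWithin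
    (m := ∞) (by simp) φ.open_target.uniqueMDiffOn
  have h2 : ContMDiff (𝓡 4) (𝓡 4).tangent ∞
      (fun y : Coord => (⟨y, e⟩ : TangentBundle (𝓡 4) Coord)) :=
    contMDiff_vectorSpace_iff_contDiff.mpr contDiff_const
  refine (h1.comp h2.contMDiffOn fun y hy => hy).congr fun y hy => ?_
  simp only [Function.comp, tangentMapWithin, dSymm, mfderivWithin_of_isOpen φ.open_target hy]
  rfl

theorem contDiffOn_metricIn (g : LorentzMetric M) (hφ : φ ∈ IsManifold.maximalAtlas (𝓡 4) ∞ M)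
    (i j : Fin 4) : ContDiffOn ℝ ∞ (fun y => metricIn g φ y i j) φ.target := by
  rw [← contMDiffOn_iff_contDiffOn]
  have h : ContMDiffOn (𝓡 4) ((𝓡 4).prod 𝓘(ℝ)) ∞
      (fun y => Bundle.TotalSpace.mk' ℝ (E := Bundle.Trivial M ℝ) (φ.symm y)
        (g.val (φ.symm y) (dSymm φ y (EuclideanSpace.single i 1))
          (dSymm φ y (EuclideanSpace.single j 1)))) φ.target := by
    apply ContMDiffOn.clm_bundle_apply₂ (F₁ := EuclideanSpace ℝ (Fin 4))
      (F₂ := EuclideanSpace ℝ (Fin 4))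
    · exact g.contMDiff.comp_contMDiffOn (contMDiffOn_symm_of_mem_maximalAtlas hφ)
    · exact contMDiffOn_dSymm hφ _
    · exact contMDiffOn_dSymm hφ _
  intro y hy
  exact ((Bundle.contMDiffWithinAt_totalSpace.mp (h y hy)).2 :)

theorem contDiffOn_fieldIn {X : ∀ x : M, TangentSpace (𝓡 4) x} (hX : SmoothField X)
    (hφ : φ ∈ IsManifold.maximalAtlas (𝓡 4) ∞ M) (i : Fin 4) :
    ContDiffOn ℝ ∞ (fun y => fieldIn X φ y i) φ.target := by
  have h1 := (contMDiffOn_of_mem_maximalAtlas hφ).contMDiffOn_tangentMapWithin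
    (m := ∞) (by simp) φ.open_source.uniqueMDiffOn
  have h2 : ContMDiffOn (𝓡 4) (𝓡 4).tangent ∞
      (fun y => (⟨φ.symm y, X (φ.symm y)⟩ : TangentBundle (𝓡 4) M)) φ.target :=
    hX.comp_contMDiffOn (contMDiffOn_symm_of_mem_maximalAtlas hφ)
  have h3 := (contMDiff_snd_tangentBundle_modelSpace Coord (𝓡 4) (n := ∞)).comp_contMDiffOn
    (h1.comp h2 fun y hy => φ.map_target hy)
  have h4 : ContDiffOn ℝ ∞ (toField (fieldIn X φ)) φ.target := by
    rw [← contMDiffOn_iff_contDiffOn]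
    refine h3.congr fun y hy => ?_
    simp only [Function.comp, tangentMapWithin, toField_fieldIn, dChart,
      mfderivWithin_of_isOpen φ.open_source (φ.map_target hy)]
    rfl
  exact contDiffOn_euclidean.mp h4 i

end Charts

section Spacetimes

set_option linter.unusedSectionVars false

variable {M : Type*} [TopologicalSpace M] [ChartedSpace (EuclideanSpace ℝ (Fin 4)) M]
  [IsManifold (𝓡 4) ∞ M]
  {φ : OpenPartialHomeomorph M (EuclideanSpace ℝ (Fin 4))}

/-! ### Stationary spacetimes in a chart -/

/-- A Lorentz metric is non-degenerate. -/
theorem LorentzMetric.eq_zero_of_val_eq_zero (g : LorentzMetric M) {x : M}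
    {V : TangentSpace (𝓡 4) x} (h : ∀ W, g.val x V W = 0) : V = 0 := by
  obtain ⟨e, he⟩ := g.signature x
  rw [← e.sum_repr V]
  refine Finset.sum_eq_zero fun j _ => ?_
  have h1 := h (e j)
  rw [← e.sum_repr V] at h1
  simp only [map_sum, map_smul, sum_apply, smul_apply, smul_eq_mul, he, mul_ite, mul_zero,
    Finset.sum_ite_eq', Finset.mem_univ, if_true] at h1
  have h2 : e.repr V j = 0 := by
    split_ifs at h1 <;> simpa using h1
  rw [h2, zero_smul]

theorem isUnit_det_metricIn (g : LorentzMetric M) (hφ : φ ∈ IsManifold.maximalAtlas (𝓡 4) ∞ M)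
    {y : Coord} (hy : y ∈ φ.target) : IsUnit (metricIn g φ y).det := by
  rw [isUnit_iff_ne_zero]
  intro h
  obtain ⟨v, hv, hGv⟩ := Matrix.exists_mulVec_eq_zero_iff.mpr h
  have h1 : dSymm φ y (WithLp.toLp 2 v) = 0 := by
    refine g.eq_zero_of_val_eq_zero fun W => ?_
    rw [g.symm, ← dSymm_dChart hφ hy W, val_dSymm]
    refine Finset.sum_eq_zero fun i _ => ?_
    have h2 : ∑ j, metricIn g φ y i j * v j = 0 := congrFun hGv i
    calc _ = dChart φ (φ.symm y) W i * ∑ j, metricIn g φ y i j * v j := by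
          rw [Finset.mul_sum]
          exact Finset.sum_congr rfl fun j _ => by ring
      _ = 0 := by rw [h2, mul_zero]
  have h2 := dChart_dSymm hφ hy (WithLp.toLp 2 v)
  rw [h1, map_zero] at h2
  exact hv (by simpa using (congrArg WithLp.ofLp h2).symm)

variable {g : LorentzMetric M} {ξ u : ∀ x : M, TangentSpace (𝓡 4) x} {α : M → ℝ}

theorem fieldNorm_eq_exp (htime : IsTimelike g ξ) (x : M) :
    fieldNorm g ξ x = Real.exp (logNorm g ξ x) :=
  (Real.exp_log (Real.sqrt_pos.mpr (by linarith [htime x]))).symm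

theorem val_self_eq (htime : IsTimelike g ξ) (x : M) :
    g.val x (ξ x) (ξ x) = -Real.exp (2 * logNorm g ξ x) := by
  have h : Real.exp (2 * logNorm g ξ x) = fieldNorm g ξ x ^ 2 := by
    rw [fieldNorm_eq_exp htime, ← Real.exp_nat_mul]; norm_num
  rw [h, fieldNorm, Real.sq_sqrt (by linarith [htime x])]
  ring

theorem unitField_eq (htime : IsTimelike g ξ) (x : M) :
    unitField g ξ x = Real.exp (-logNorm g ξ x) • ξ x := by
  rw [unitField, fieldNorm_eq_exp htime, Real.exp_neg]

theorem isStationary_of_isKilling (hξ : SmoothField ξ) (htime : IsTimelike g ξ)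
    (hkill : IsKilling g ξ) (hφ : φ ∈ IsManifold.maximalAtlas (𝓡 4) ∞ M) :
    IsStationary (metricIn g φ) (fieldIn ξ φ) (fieldIn (unitField g ξ) φ)
      (logNorm g ξ ∘ φ.symm) φ.target := by
  have hQ : ∀ y ∈ φ.target, g.val (φ.symm y) (ξ (φ.symm y)) (ξ (φ.symm y))
      = ∑ i, ∑ j, metricIn g φ y i j * fieldIn ξ φ y i * fieldIn ξ φ y j := by
    intro y hy
    conv_lhs => rw [← dSymm_toField hφ ξ hy]
    exact val_dSymm g y _ _
  refine ⟨φ.open_target, contDiffOn_metricIn g hφ, fun y hy i j => g.symm _ _ _,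
    fun y hy => Matrix.nonsing_inv_mul _ (isUnit_det_metricIn g hφ hy), contDiffOn_fieldIn hξ hφ,
    ?_, fun y hy => ?_, fun y hy i => ?_, fun y hy => ?_⟩
  · have h1 : ContDiffOn ℝ ∞ (fun y => -∑ i, ∑ j,
        metricIn g φ y i j * fieldIn ξ φ y i * fieldIn ξ φ y j) φ.target :=
      (ContDiffOn.sum fun i _ => ContDiffOn.sum fun j _ =>
        ((contDiffOn_metricIn g hφ i j).mul (contDiffOn_fieldIn hξ hφ i)).mul
          (contDiffOn_fieldIn hξ hφ j)).neg
    have h2 : ∀ y ∈ φ.target, 0 < -∑ i, ∑ j,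
        metricIn g φ y i j * fieldIn ξ φ y i * fieldIn ξ φ y j := fun y hy => by
      rw [← hQ y hy]; linarith [htime (φ.symm y)]
    refine ((h1.sqrt fun y hy => (h2 y hy).ne').log fun y hy =>
      (Real.sqrt_pos.mpr (h2 y hy)).ne').congr fun y hy => ?_
    rw [← hQ y hy]; rfl
  · rw [← hQ y hy]
    exact val_self_eq htime _
  · have : fieldIn (unitField g ξ) φ y i
        = dChart φ (φ.symm y) (unitField g ξ (φ.symm y)) i := rfl
    rw [this, unitField_eq htime, map_smul, neg_one_mul]
    rfl
  · have := hkill φ hφ (φ.symm y) trivial (φ.map_target hy)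
    rwa [φ.right_inv hy] at this

/-- A spacetime with a time-like Killing field `ξ`, its unit field `u` and `α = ln |ξ|`. -/
structure IsStationarySpacetime (g : LorentzMetric M) (ξ u : ∀ x : M, TangentSpace (𝓡 4) x)
    (α : M → ℝ) : Prop where
  unit : ∀ x, g.val x (u x) (u x) = -1
  unit_eq : ∀ x, u x = Real.exp (-α x) • ξ x
  chart : ∀ φ ∈ IsManifold.maximalAtlas (𝓡 4) ∞ M,
    IsStationary (metricIn g φ) (fieldIn ξ φ) (fieldIn u φ) (α ∘ φ.symm) φ.target

theorem isStationarySpacetime (hξ : SmoothField ξ) (htime : IsTimelike g ξ)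
    (hkill : IsKilling g ξ) : IsStationarySpacetime g ξ (unitField g ξ) (logNorm g ξ) where
  unit x := by
    rw [unitField_eq htime]
    simp only [map_smul, smul_apply, smul_eq_mul, val_self_eq htime]
    rw [← mul_assoc, mul_neg, ← Real.exp_add, ← Real.exp_add]
    simp; ring
  unit_eq := unitField_eq htime
  chart _ hφ := isStationary_of_isKilling hξ htime hkill hφ

/-- The conservation equations at a point, solved for the differential of the pressure and written
without coordinates: `ξ(ρ) = 0` and `dp = -ξ(p) e^{-α} u - (ρ + p) dα`. -/
def FluidAt (g : LorentzMetric M) (ξ u : ∀ x : M, TangentSpace (𝓡 4) x) (α ρ p : M → ℝ) (x : M) :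
    Prop :=
  dAt ρ x (ξ x) = 0 ∧ ∀ W : TangentSpace (𝓡 4) x,
    dAt p x W = -(dAt p x (ξ x) * (Real.exp (-α x) * g.val x (u x) W))
      - (ρ x + p x) * dAt α x W

namespace IsStationarySpacetime

theorem smooth_log (S : IsStationarySpacetime g ξ u α) : SmoothOn α Set.univ := by
  intro x _
  have h := (smoothOn_iff_contDiffOn (IsManifold.chart_mem_maximalAtlas x)).mpr
    (S.chart _ (IsManifold.chart_mem_maximalAtlas (I := 𝓡 4) (n := ∞) x)).smooth_log
  exact (h.contMDiffAt ((chartAt _ x).open_source.mem_nhds (mem_chart_source _ x))).contMDiffWithinAt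

/-- The 1-form `g(u, ·)` in a chart. -/
theorem val_unit_dSymm (hφ : φ ∈ IsManifold.maximalAtlas (𝓡 4) ∞ M) {y : Coord}
    (hy : y ∈ φ.target) (w : Coord) : g.val (φ.symm y) (u (φ.symm y)) (dSymm φ y w)
      = ∑ i, w i * uF (metricIn g φ) (fieldIn u φ) y i := by
  have h1 : g.val (φ.symm y) (u (φ.symm y)) (dSymm φ y w)
      = ∑ i, ∑ j, metricIn g φ y i j * fieldIn u φ y i * w j := by
    conv_lhs => rw [← dSymm_toField hφ u hy]
    exact val_dSymm g y _ _
  rw [h1, Finset.sum_comm]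
  simp only [uF, lower, Finset.mul_sum]
  refine Finset.sum_congr rfl fun i _ => Finset.sum_congr rfl fun j _ => ?_
  rw [show metricIn g φ y j i = metricIn g φ y i j from g.symm _ _ _]
  ring

theorem toForm_invForm (hφ : φ ∈ IsManifold.maximalAtlas (𝓡 4) ∞ M) {y : Coord}
    (hy : y ∈ φ.target) (w : Coord) :
    toForm (invForm (metricIn g φ) (fieldIn u φ) (α ∘ φ.symm)) y w
      = Real.exp (-α (φ.symm y)) * g.val (φ.symm y) (u (φ.symm y)) (dSymm φ y w) := by
  rw [toForm_apply, val_unit_dSymm hφ hy, Finset.mul_sum]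
  refine Finset.sum_congr rfl fun i _ => ?_
  simp only [invForm, Function.comp, neg_one_mul]
  ring

theorem fluidAt_iff (S : IsStationarySpacetime g ξ u α)
    (hφ : φ ∈ IsManifold.maximalAtlas (𝓡 4) ∞ M) {ρ p : M → ℝ} {y : Coord} (hy : y ∈ φ.target)
    (hρ : MDifferentiableAt (𝓡 4) 𝓘(ℝ, ℝ) ρ (φ.symm y))
    (hp : MDifferentiableAt (𝓡 4) 𝓘(ℝ, ℝ) p (φ.symm y)) :
    FluidAt g ξ u α ρ p (φ.symm y) ↔ FluidEq (metricIn g φ) (fieldIn ξ φ) (fieldIn u φ)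
      (α ∘ φ.symm) (ρ ∘ φ.symm) (p ∘ φ.symm) y := by
  have hα := S.smooth_log.mdifferentiableAt isOpen_univ (Set.mem_univ (φ.symm y))
  have hpX : dAt p (φ.symm y) (ξ (φ.symm y))
      = fderiv ℝ (p ∘ φ.symm) y (toField (fieldIn ξ φ) y) := by
    rw [← dAt_dSymm hφ hy hp, dSymm_toField hφ ξ hy]
  have hρX : dAt ρ (φ.symm y) (ξ (φ.symm y))
      = fderiv ℝ (ρ ∘ φ.symm) y (toField (fieldIn ξ φ) y) := by
    rw [← dAt_dSymm hφ hy hρ, dSymm_toField hφ ξ hy]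
  rw [fluidEq_iff, FluidAt, hpX, hρX]
  refine and_congr_right fun _ => ⟨fun h w => ?_, fun h W => ?_⟩
  · have := h (dSymm φ y w)
    rw [dAt_dSymm hφ hy hp, dAt_dSymm hφ hy hα] at this
    rw [this, toForm_invForm hφ hy]
    rfl
  · have := h (dChart φ (φ.symm y) W)
    rw [← dAt_dSymm hφ hy hp, ← dAt_dSymm hφ hy hα, toForm_invForm hφ hy,
      dSymm_dChart hφ hy] at this
    exact this

theorem divT_eq_zero_iff (S : IsStationarySpacetime g ξ u α)
    (hφ : φ ∈ IsManifold.maximalAtlas (𝓡 4) ∞ M) {ρ p : M → ℝ} {x : M} (hx : x ∈ φ.source)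
    (hρ : MDifferentiableAt (𝓡 4) 𝓘(ℝ, ℝ) ρ x) (hp : MDifferentiableAt (𝓡 4) 𝓘(ℝ, ℝ) p x) :
    divT (metricIn g φ) (energyT (metricIn g φ) (fieldIn u φ) (ρ ∘ φ.symm) (p ∘ φ.symm)) (φ x) = 0
      ↔ FluidAt g ξ u α ρ p x := by
  have hy := φ.map_source hx
  have hd : ∀ f : M → ℝ, MDifferentiableAt (𝓡 4) 𝓘(ℝ, ℝ) f x →
      DifferentiableAt ℝ (f ∘ φ.symm) (φ x) := fun f hf => by
    rw [← φ.left_inv hx] at hf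
    exact (hf.comp (φ x) (mdifferentiableAt_symm hφ hy)).differentiableAt
  rw [(S.chart φ hφ).divT_eq_zero_iff hy (hd ρ hρ) (hd p hp)]
  rw [← φ.left_inv hx] at hρ hp
  rw [← S.fluidAt_iff hφ hy hρ hp, φ.left_inv hx]

/-- Perfect energy tensors with velocity `u`, with the conservation equations in invariant form. -/
theorem isPerfectEnergyTensor_iff (S : IsStationarySpacetime g ξ u α) {V : Set M} (hV : IsOpen V)
    {ρ p : M → ℝ} : IsPerfectEnergyTensor g u V ρ p ↔
      (SmoothOn ρ V ∧ SmoothOn p V ∧ ∀ x ∈ V, FluidAt g ξ u α ρ p x) ∧ ∀ x ∈ V, ρ x + p x ≠ 0 := by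
  constructor
  · intro h
    refine ⟨⟨h.smooth_density, h.smooth_pressure, fun x hx => ?_⟩, h.ne_zero⟩
    have hc := IsManifold.chart_mem_maximalAtlas (I := 𝓡 4) (n := ∞) x
    exact (S.divT_eq_zero_iff hc (mem_chart_source _ x)
      (SmoothOn.mdifferentiableAt h.smooth_density hV hx)
      (SmoothOn.mdifferentiableAt h.smooth_pressure hV hx)).mp
      (h.conserved _ hc x hx (mem_chart_source _ x))
  · rintro ⟨⟨h1, h2, h3⟩, h4⟩
    exact ⟨fun x _ => S.unit x, h1, h2, h4, fun φ hφ x hx hxs =>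
      (S.divT_eq_zero_iff hφ hxs (h1.mdifferentiableAt hV hx) (h2.mdifferentiableAt hV hx)).mpr
        (h3 x hx)⟩

/-- On the domain of a chart, the perfect energy tensors are given by the fluids in coordinates. -/
theorem isPerfectEnergyTensor_iff_isFluid (S : IsStationarySpacetime g ξ u α)
    (hφ : φ ∈ IsManifold.maximalAtlas (𝓡 4) ∞ M) {ρ p : M → ℝ} :
    IsPerfectEnergyTensor g u φ.source ρ p ↔
      IsFluid (toField (fieldIn ξ φ))
        (toForm (invForm (metricIn g φ) (fieldIn u φ) (α ∘ φ.symm))) (α ∘ φ.symm)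
        (ρ ∘ φ.symm) (p ∘ φ.symm) φ.target ∧ ∀ x ∈ φ.source, ρ x + p x ≠ 0 := by
  rw [S.isPerfectEnergyTensor_iff φ.open_source]
  refine and_congr_left fun _ => ?_
  constructor
  · rintro ⟨h1, h2, h3⟩
    have h4 := fun (y : Coord) (hy : y ∈ φ.target) => fluidEq_iff.mp ((S.fluidAt_iff hφ hy
      (h1.mdifferentiableAt φ.open_source (φ.map_target hy))
      (h2.mdifferentiableAt φ.open_source (φ.map_target hy))).mp (h3 _ (φ.map_target hy)))
    exact ⟨(smoothOn_iff_contDiffOn hφ).mp h1, (smoothOn_iff_contDiffOn hφ).mp h2,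
      fun y hy => (h4 y hy).1, fun y hy => (h4 y hy).2⟩
  · intro F
    have h1 := (smoothOn_iff_contDiffOn hφ).mpr F.smooth_density
    have h2 := (smoothOn_iff_contDiffOn hφ).mpr F.smooth_pressure
    refine ⟨h1, h2, fun x hx => ?_⟩
    have hy := φ.map_source hx
    have h3 := (S.fluidAt_iff hφ hy
      (h1.mdifferentiableAt φ.open_source (φ.map_target hy))
      (h2.mdifferentiableAt φ.open_source (φ.map_target hy))).mpr
      (fluidEq_iff.mpr ⟨F.density_field _ hy, F.pressure _ hy⟩)
    rwa [φ.left_inv hx] at h3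

end IsStationarySpacetime

end Spacetimes

/-! ### Charts adapted to functions -/

section Straightening

variable {E : Type*} [NormedAddCommGroup E] [NormedSpace ℝ E] [CompleteSpace E]

/-- Functions with independent differentials at `c` become linear after a local diffeomorphism:
`y ↦ y + ∑ᵢ (fᵢ y - Dfᵢ(c) y) vᵢ`, where the `vᵢ` are dual to the differentials, is tangent to the
identity at `c` and takes `fᵢ` to `Dfᵢ(c)`. -/
theorem exists_straightening {ι : Type*} [Fintype ι] [DecidableEq ι] {O : Set E} (hO : IsOpen O)
    {c : E} (hc : c ∈ O)
    {f : ι → E → ℝ} (hf : ∀ i, ContDiffOn ℝ ∞ (f i) O) {v : ι → E}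
    (hv : ∀ i j, fderiv ℝ (f i) c (v j) = if i = j then 1 else 0) :
    ∃ e : OpenPartialHomeomorph E E, c ∈ e.source ∧ e.source ⊆ O ∧ ContDiffOn ℝ ∞ e e.source ∧
      ContDiffOn ℝ ∞ e.symm e.target ∧ ∀ i, ∀ z ∈ e.source, f i z = fderiv ℝ (f i) c (e z) := by
  set Φ : E → E := fun y => y + ∑ i, (f i y - fderiv ℝ (f i) c y) • v i with hΦ
  have hΦs : ContDiffOn ℝ ∞ Φ O := contDiffOn_id.add (ContDiffOn.sum fun i _ =>
    ((hf i).sub (fderiv ℝ (f i) c).contDiff.contDiffOn).smul contDiffOn_const)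
  have hΦc : HasFDerivAt Φ ((ContinuousLinearEquiv.refl ℝ E : E ≃L[ℝ] E) : E →L[ℝ] E) c := by
    have h1 : HasFDerivAt Φ (ContinuousLinearMap.id ℝ E + ∑ i,
        (fderiv ℝ (f i) c - fderiv ℝ (f i) c).smulRight (v i)) c :=
      (hasFDerivAt_id c).add (HasFDerivAt.fun_sum fun i _ =>
        ((((hf i).differentiableAt_of_isOpen hO hc).hasFDerivAt.sub
          (fderiv ℝ (f i) c).hasFDerivAt).smul_const (v i)))
    convert h1 using 1
    ext w
    simp
  have hΦat : ContDiffAt ℝ ∞ Φ c := hΦs.contDiffAt (hO.mem_nhds hc)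
  set e₀ := hΦat.toOpenPartialHomeomorph Φ hΦc (by simp) with he₀
  -- the locus where the differential is invertible
  set I : Set E := {y | y ∈ O ∧ fderiv ℝ Φ y ∈
    Set.range ((↑) : (E ≃L[ℝ] E) → E →L[ℝ] E)} with hI
  have hIo : IsOpen I :=
    (hΦs.continuousOn_fderiv_of_isOpen hO (by simp)).isOpen_inter_preimage hO
      ContinuousLinearEquiv.isOpen
  have hIc : c ∈ I := ⟨hc, _, hΦc.fderiv.symm⟩
  set e := e₀.restrOpen I hIo with he
  have hes : e.source = e₀.source ∩ I := e₀.restrOpen_source I hIo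
  have hcoe : ∀ z, e z = Φ z := fun z => rfl
  have hsrc : e.source ⊆ O := fun y hy => (hes ▸ hy).2.1
  refine ⟨e, ?_, hsrc, (hΦs.mono hsrc).congr fun z _ => hcoe z, ?_, fun i z hz => ?_⟩
  · rw [hes]
    exact ⟨hΦat.mem_toOpenPartialHomeomorph_source hΦc (by simp), hIc⟩
  · intro y hy
    obtain ⟨h1, A, hA⟩ := (hes ▸ e.map_target hy : e.symm y ∈ e₀.source ∩ I).2
    have h2 : ContDiffAt ℝ ∞ Φ (e.symm y) := hΦs.contDiffAt (hO.mem_nhds h1)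
    refine (e.contDiffAt_symm (f₀' := A) hy ?_ h2).contDiffWithinAt
    rw [hA]
    exact (h2.differentiableAt (by simp)).hasFDerivAt
  · rw [hcoe, hΦ]
    simp [hv]

end Straightening

section Charts

set_option linter.unusedSectionVars false

variable {M : Type*} [TopologicalSpace M] [ChartedSpace (EuclideanSpace ℝ (Fin 4)) M]
  [IsManifold (𝓡 4) ∞ M]
  {φ : OpenPartialHomeomorph M (EuclideanSpace ℝ (Fin 4))}

theorem trans_mem_maximalAtlas (hφ : φ ∈ IsManifold.maximalAtlas (𝓡 4) ∞ M)
    {e : OpenPartialHomeomorph Coord Coord} (he : ContDiffOn ℝ ∞ e e.source)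
    (he' : ContDiffOn ℝ ∞ e.symm e.target) :
    φ.trans e ∈ IsManifold.maximalAtlas (𝓡 4) ∞ M := by
  refine (φ.trans e).mem_maximalAtlas_of_contMDiffOn ?_ ?_
  · exact he.contMDiffOn.comp' (contMDiffOn_of_mem_maximalAtlas hφ) |>.mono fun x hx => by
      simpa using hx
  · exact (contMDiffOn_symm_of_mem_maximalAtlas hφ).comp' he'.contMDiffOn |>.mono fun x hx => by
      simpa using hx

/-- Around every point `x` there is a chart `ψ` in which given functions with independent
differentials are linear, with a convex target stable under `y ↦ y - P (y - ψ x)`, for a given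
projection `P`. -/
theorem exists_chart_linear (hφ : φ ∈ IsManifold.maximalAtlas (𝓡 4) ∞ M) {x : M}
    (hx : x ∈ φ.source) {U : Set M} (hU : IsOpen U) (hxU : x ∈ U)
    {ι : Type*} [Fintype ι] [DecidableEq ι]
    {f : ι → M → ℝ} (hf : ∀ i, SmoothOn (f i) U) {v : ι → Coord}
    (hv : ∀ i j, fderiv ℝ (f i ∘ φ.symm) (φ x) (v j) = if i = j then 1 else 0)
    (P : Coord →L[ℝ] Coord) (hP : ∀ y, P (P y) = P y) :
    ∃ ψ ∈ IsManifold.maximalAtlas (𝓡 4) ∞ M, x ∈ ψ.source ∧ ψ.source ⊆ U ∧ Convex ℝ ψ.target ∧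
      (∀ y ∈ ψ.target, y - P (y - ψ x) ∈ ψ.target) ∧
      ∀ i, ∀ y ∈ ψ.target, f i (ψ.symm y) = fderiv ℝ (f i ∘ φ.symm) (φ x) y := by
  set O : Set Coord := φ.target ∩ φ.symm ⁻¹' U with hO
  have hOo : IsOpen O := φ.symm.isOpen_inter_preimage hU
  have hxO : φ x ∈ O := ⟨φ.map_source hx, by rwa [Set.mem_preimage, φ.left_inv hx]⟩
  obtain ⟨e, h1, h2, h3, h4, h5⟩ := exists_straightening hOo hxO
    (f := fun i => f i ∘ φ.symm) (fun i => ((hf i).comp' (contMDiffOn_symm_of_mem_maximalAtlas hφ)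
      |>.contDiffOn)) hv
  set c := e (φ x) with hc
  obtain ⟨ε, hε, hball⟩ := Metric.isOpen_iff.mp e.open_target c (e.map_source h1)
  -- since `y ↦ y - P (y - c)` is idempotent, this neighbourhood is mapped to itself
  set B : Set Coord := Metric.ball c ε ∩ (fun y => y - P (y - c)) ⁻¹' Metric.ball c ε with hB
  have hBo : IsOpen B := Metric.isOpen_ball.inter (Metric.isOpen_ball.preimage (by fun_prop))
  have hBc : Convex ℝ B := by
    refine (convex_ball c ε).inter ?_
    have : (fun y => y - P (y - c)) ⁻¹' Metric.ball c ε
        = ((ContinuousLinearMap.id ℝ Coord - P : Coord →L[ℝ] Coord) : Coord →ₗ[ℝ] Coord) ⁻¹'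
          ((fun z => P c + z) ⁻¹' Metric.ball c ε) := by
      ext y
      simp only [Set.mem_preimage, map_sub]
      congr! 1
      simp; abel
    rw [this]
    exact ((convex_ball c ε).translate_preimage_right (P c)).linear_preimage _
  have hcB : c ∈ B := ⟨Metric.mem_ball_self hε, by simp [hε]⟩
  have hBe : B ⊆ e.target := fun y hy => hball hy.1
  set ψ := (φ.trans e).trans (OpenPartialHomeomorph.ofSet B hBo) with hψ
  have hψm : ψ ∈ IsManifold.maximalAtlas (𝓡 4) ∞ M :=
    trans_mem_maximalAtlas (trans_mem_maximalAtlas hφ h3 h4) contDiffOn_id contDiffOn_id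
  have hsrc : ∀ z, z ∈ ψ.source ↔ (z ∈ φ.source ∧ φ z ∈ e.source) ∧ e (φ z) ∈ B := by
    intro z; simp [hψ]
  have htgt : ψ.target = B := by
    ext y
    simp only [hψ, OpenPartialHomeomorph.trans_target, OpenPartialHomeomorph.ofSet_target,
      OpenPartialHomeomorph.ofSet_symm, OpenPartialHomeomorph.ofSet_apply, Set.mem_inter_iff,
      Set.mem_preimage, id]
    exact ⟨fun h => h.1, fun h => ⟨h, hBe h, (h2 (e.map_target (hBe h))).1⟩⟩
  have hψx : ψ x = c := rfl
  refine ⟨ψ, hψm, (hsrc x).mpr ⟨⟨hx, h1⟩, hcB⟩, fun z hz => ?_, htgt ▸ hBc, ?_, fun i y hy => ?_⟩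
  · obtain ⟨⟨h6, h7⟩, -⟩ := (hsrc z).mp hz
    have := (h2 h7).2
    rwa [Set.mem_preimage, φ.left_inv h6] at this
  · rw [htgt, hψx]
    intro y hy
    refine ⟨hy.2, ?_⟩
    have : y - P (y - c) - P (y - P (y - c) - c) = y - P (y - c) := by
      simp only [map_sub, hP]; abel
    rw [Set.mem_preimage, this]
    exact hy.2
  · rw [htgt] at hy
    have h6 := h5 i (e.symm y) (e.map_target (hBe hy))
    rw [e.right_inv (hBe hy)] at h6
    exact h6

end Charts

section Solutions

set_option linter.unusedSectionVars false

variable {M : Type*} [TopologicalSpace M] [ChartedSpace (EuclideanSpace ℝ (Fin 4)) M]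
  [IsManifold (𝓡 4) ∞ M]
  {φ ψ : OpenPartialHomeomorph M (EuclideanSpace ℝ (Fin 4))}
  {g : LorentzMetric M} {ξ u : ∀ x : M, TangentSpace (𝓡 4) x} {α : M → ℝ} {U : Set M}

/-! ### Invariant relations and charts -/

theorem HoldsOn.chart {X : ∀ x : M, TangentSpace (𝓡 4) x} {P : Ten → Vec → Coord → Prop}
    (h : HoldsOn g X U P) (hψ : ψ ∈ IsManifold.maximalAtlas (𝓡 4) ∞ M) (hψU : ψ.source ⊆ U)
    {y : Coord} (hy : y ∈ ψ.target) : P (metricIn g ψ) (fieldIn X ψ) y := by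
  have := h ψ hψ _ (hψU (ψ.map_target hy)) (ψ.map_target hy)
  rwa [ψ.right_inv hy] at this

theorem IsPerfectEnergyTensor.mono {ρ p : M → ℝ} (h : IsPerfectEnergyTensor g u U ρ p) {V : Set M}
    (hV : V ⊆ U) : IsPerfectEnergyTensor g u V ρ p :=
  ⟨fun x hx => h.unit x (hV hx), h.smooth_density.mono hV, h.smooth_pressure.mono hV,
    fun x hx => h.ne_zero x (hV hx), fun φ hφ x hx => h.conserved φ hφ x (hV hx)⟩

theorem forall_source_iff {P : M → Prop} :
    (∀ x ∈ ψ.source, P x) ↔ ∀ y ∈ ψ.target, P (ψ.symm y) :=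
  ⟨fun h y hy => h _ (ψ.map_target hy), fun h x hx => by
    have := h _ (ψ.map_source hx)
    rwa [ψ.left_inv hx] at this⟩

theorem image_source (f : M → ℝ) : f '' ψ.source = (f ∘ ψ.symm) '' ψ.target := by
  rw [Set.image_comp, ψ.symm_image_target_eq_source]

theorem dAt_smul (f : M → ℝ) (x : M) (k : ℝ) (W : TangentSpace (𝓡 4) x) :
    dAt f x (k • W) = k * dAt f x W := by
  simp only [dAt, map_smul]; rfl

/-- Functions on the target of a chart are coordinate expressions. -/
theorem exists_smoothOn (hψ : ψ ∈ IsManifold.maximalAtlas (𝓡 4) ∞ M) {f : Coord → ℝ}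
    (hf : ContDiffOn ℝ ∞ f ψ.target) : ∃ τ : M → ℝ, SmoothOn τ ψ.source ∧
      ∀ y ∈ ψ.target, τ (ψ.symm y) = f y ∧ fderiv ℝ (τ ∘ ψ.symm) y = fderiv ℝ f y := by
  have h : ∀ y ∈ ψ.target, (f ∘ ψ) (ψ.symm y) = f y := fun y hy => by
    simp [ψ.right_inv hy]
  exact ⟨f ∘ ψ, smoothOn_comp_chart hψ hf, fun y hy => ⟨h y hy,
    (Filter.eventuallyEq_of_mem (ψ.open_target.mem_nhds hy) h).fderiv_eq⟩⟩

/-- Around every point there is a chart with convex target. -/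
theorem exists_chart_convex (hU : IsOpen U) {x : M} (hx : x ∈ U) :
    ∃ ψ ∈ IsManifold.maximalAtlas (𝓡 4) ∞ M, x ∈ ψ.source ∧ ψ.source ⊆ U ∧
      Convex ℝ ψ.target := by
  obtain ⟨ψ, h1, h2, h3, h4, -⟩ := exists_chart_linear
    (IsManifold.chart_mem_maximalAtlas (I := 𝓡 4) (n := ∞) x) (mem_chart_source _ x) hU hx
    (ι := Empty) (f := fun i => i.elim) (fun i => i.elim) (v := fun i => i.elim)
    (fun i => i.elim) 0 (fun y => by simp)
  exact ⟨ψ, h1, h2, h3, h4⟩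

theorem exists_chart_at (x : M) :
    ∃ φ ∈ IsManifold.maximalAtlas (𝓡 4) ∞ M, ∃ y ∈ φ.target, φ.symm y = x :=
  ⟨_, IsManifold.chart_mem_maximalAtlas x, _,
    (chartAt (EuclideanSpace ℝ (Fin 4)) x).map_source (mem_chart_source _ x),
    (chartAt _ x).left_inv (mem_chart_source _ x)⟩

namespace IsStationarySpacetime

theorem log_field (S : IsStationarySpacetime g ξ u α) (x : M) : dAt α x (ξ x) = 0 := by
  obtain ⟨φ, hφ, y, hy, rfl⟩ := exists_chart_at x
  rw [← dSymm_toField hφ ξ hy,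
    dAt_dSymm hφ hy (S.smooth_log.mdifferentiableAt isOpen_univ (Set.mem_univ _))]
  exact (S.chart _ hφ).invariantForm.log_field _ hy

theorem dAt_log_eq_zero (S : IsStationarySpacetime g ξ u α) (h : AccZero g u U) {x : M}
    (hx : x ∈ U) (W : TangentSpace (𝓡 4) x) : dAt α x W = 0 := by
  obtain ⟨φ, hφ, y, hy, rfl⟩ := exists_chart_at x
  have h1 := h φ hφ _ hx (φ.map_target hy)
  rw [φ.right_inv hy] at h1
  rw [← dSymm_dChart hφ hy W,
    dAt_dSymm hφ hy (S.smooth_log.mdifferentiableAt isOpen_univ (Set.mem_univ _)),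
    ((S.chart _ hφ).fderiv_log_eq_zero_iff hy).mp h1]
  rfl

theorem dAt_unit (S : IsStationarySpacetime g ξ u α) (f : M → ℝ) (x : M) :
    dAt f x (u x) = 0 ↔ dAt f x (ξ x) = 0 := by
  rw [S.unit_eq, dAt_smul, mul_eq_zero, or_iff_right (Real.exp_pos _).ne']

/-- The 1-form `g(u, ·)` in terms of the invariant form. -/
theorem val_unit_eq (hψ : ψ ∈ IsManifold.maximalAtlas (𝓡 4) ∞ M) {y : Coord}
    (hy : y ∈ ψ.target) (w : Coord) :
    g.val (ψ.symm y) (u (ψ.symm y)) (dSymm ψ y w) = Real.exp (α (ψ.symm y)) *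
      toForm (invForm (metricIn g ψ) (fieldIn u ψ) (α ∘ ψ.symm)) y w := by
  rw [toForm_invForm hψ hy, ← mul_assoc, ← Real.exp_add]
  simp

/-! ### A universal solution, and geodesic rotating velocities -/

/-- The density `0` and the pressure `e^{-α}` are a solution, since `dp = -p dα`. -/
theorem exists_isPerfectEnergyTensor (S : IsStationarySpacetime g ξ u α) :
    ∃ ρ p : M → ℝ, IsPerfectEnergyTensor g u Set.univ ρ p := by
  have hd : ∀ x (W : TangentSpace (𝓡 4) x),
      dAt (fun x => Real.exp (-α x)) x W = -(Real.exp (-α x) * dAt α x W) := by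
    intro x W
    obtain ⟨φ, hφ, y, hy, rfl⟩ := exists_chart_at x
    have h1 := S.smooth_log.mdifferentiableAt isOpen_univ (Set.mem_univ (φ.symm y))
    have h2 : MDifferentiableAt (𝓡 4) 𝓘(ℝ, ℝ) (fun x => Real.exp (-α x)) (φ.symm y) :=
      (Real.differentiable_exp.comp differentiable_neg).differentiableAt.mdifferentiableAt.comp _ h1
    rw [← dSymm_dChart hφ hy W, dAt_dSymm hφ hy h1, dAt_dSymm hφ hy h2]
    have h3 := ((S.chart φ hφ).smooth_log.differentiableAt_of_isOpen φ.open_target hy).hasFDerivAt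
    have h4 : HasFDerivAt ((fun x => Real.exp (-α x)) ∘ φ.symm) _ y := h3.neg.exp
    rw [h4.fderiv]
    simp
  refine ⟨fun _ => 0, fun x => Real.exp (-α x), S.isPerfectEnergyTensor_iff isOpen_univ |>.mpr
    ⟨⟨contMDiffOn_const, ?_, fun x _ => ⟨?_, fun W => ?_⟩⟩, fun x _ => ?_⟩⟩
  · exact (Real.contDiff_exp.comp contDiff_neg).contMDiff.comp_contMDiffOn S.smooth_log
  · rw [dAt, mfderiv_const]
    rfl
  · rw [hd, hd, S.log_field]
    ring
  · simp

/-- For a geodesic rotating velocity, the integrability condition `ξ(p) dχ = -dρ ∧ dα = 0` gives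
`ξ(p) = 0`, and then `dp = 0`. -/
theorem isPerfectEnergyTensor_iff_of_rot_ne_zero (S : IsStationarySpacetime g ξ u α)
    (hU : IsOpen U) (hUc : IsPreconnected U) (ha : AccZero g u U) (hw : RotNeZero g u U)
    (ρ p : M → ℝ) : IsPerfectEnergyTensor g u U ρ p ↔
      (∃ p₀ : ℝ, ∀ y ∈ U, p y = p₀) ∧ SmoothOn ρ U ∧ (∀ y ∈ U, dAt ρ y (u y) = 0) ∧
        ∀ y ∈ U, ρ y + p y ≠ 0 := by
  simp only [S.dAt_unit]
  constructor
  · intro T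
    obtain ⟨⟨h1, h2, h3⟩, h4⟩ := (S.isPerfectEnergyTensor_iff hU).mp T
    refine ⟨?_, h1, fun y hy => (h3 y hy).1, h4⟩
    have hloc : ∀ x ∈ U, ∀ᶠ z in 𝓝 x, p z = p x := by
      intro x hx
      obtain ⟨ψ, hψ, hxψ, hψU, hc⟩ := exists_chart_convex hU hx
      have S' := S.chart ψ hψ
      have F := ((S.isPerfectEnergyTensor_iff_isFluid hψ).mp (T.mono hψU)).1
      have hα : ∀ y ∈ ψ.target, fderiv ℝ (α ∘ ψ.symm) y = 0 := fun y hy =>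
        (S'.fderiv_log_eq_zero_iff hy).mp (ha.chart hψ hψU hy)
      have hp : ∀ y ∈ ψ.target, fderiv ℝ (p ∘ ψ.symm) y = 0 := by
        intro y hy
        have h5 : fderiv ℝ (p ∘ ψ.symm) y (toField (fieldIn ξ ψ) y) = 0 := by
          by_contra h6
          refine hw.chart hψ hψU hy ((S'.rot_eq_zero_iff_form hy).mpr fun v w => ?_)
          have h7 := F.integrability S'.invariantForm hy v w
          rw [hα y hy] at h7
          simpa [h6, sub_eq_zero] using h7
        ext w
        rw [F.pressure y hy, h5, hα y hy]
        simp
      filter_upwards [ψ.open_source.mem_nhds hxψ] with z hz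
      have h8 := hc.is_const_of_fderivWithin_eq_zero
        (F.smooth_pressure.differentiableOn (by simp))
        (fun y hy => by rw [fderivWithin_of_isOpen ψ.open_target hy, hp y hy])
        (ψ.map_source hz) (ψ.map_source hxψ)
      simpa [ψ.left_inv hz, ψ.left_inv hxψ] using h8
    have : PreconnectedSpace U := Subtype.preconnectedSpace hUc
    have hlc : IsLocallyConstant (fun z : U => p z) := by
      rw [IsLocallyConstant.iff_eventually_eq]
      exact fun z => continuous_subtype_val.continuousAt.eventually (hloc z z.2)
    rcases U.eq_empty_or_nonempty with rfl | ⟨x, hx⟩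
    · exact ⟨0, by simp⟩
    · exact ⟨p x, fun y hy => hlc.apply_eq_of_preconnectedSpace ⟨y, hy⟩ ⟨x, hx⟩⟩
  · rintro ⟨⟨p₀, hp⟩, h1, h2, h3⟩
    refine (S.isPerfectEnergyTensor_iff hU).mpr
      ⟨⟨h1, contMDiffOn_const.congr hp, fun x hx => ⟨h2 x hx, fun W => ?_⟩⟩, h3⟩
    have h4 : ∀ W, dAt p x W = 0 := fun W => by
      have : p =ᶠ[𝓝 x] fun _ => p₀ := Filter.eventuallyEq_of_mem (hU.mem_nhds hx) hp
      rw [dAt, this.mfderiv_eq, mfderiv_const]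
      rfl
    rw [h4, h4, S.dAt_log_eq_zero ha hx]
    simp

end IsStationarySpacetime
end Solutions

theorem exists_apply_eq_one {E : Type*} [NormedAddCommGroup E] [NormedSpace ℝ E]
    {ℓ : E →L[ℝ] ℝ} (h : ℓ ≠ 0) : ∃ e, ℓ e = 1 := by
  obtain ⟨v, hv⟩ := DFunLike.ne_iff.mp h
  exact ⟨(ℓ v)⁻¹ • v, by simpa using inv_mul_cancel₀ hv⟩

section LocalSolutions

set_option linter.unusedSectionVars false

variable {M : Type*} [TopologicalSpace M] [ChartedSpace (EuclideanSpace ℝ (Fin 4)) M]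
  [IsManifold (𝓡 4) ∞ M]
  {φ ψ : OpenPartialHomeomorph M (EuclideanSpace ℝ (Fin 4))}
  {g : LorentzMetric M} {ξ u : ∀ x : M, TangentSpace (𝓡 4) x} {α : M → ℝ} {U : Set M}

namespace IsStationarySpacetime

/-! ### Velocities with a non-zero acceleration -/

/-- Around a point where `a ≠ 0` there is a chart in which `α` is a linear function. -/
theorem exists_chart_log (S : IsStationarySpacetime g ξ u α) (hU : IsOpen U)
    (ha : AccNeZero g u U) {x : M} (hx : x ∈ U) :
    ∃ ψ ∈ IsManifold.maximalAtlas (𝓡 4) ∞ M, x ∈ ψ.source ∧ ψ.source ⊆ U ∧ Convex ℝ ψ.target ∧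
      ∃ (ℓ : Coord →L[ℝ] ℝ) (e : Coord), ℓ e = 1 ∧ (∀ y ∈ ψ.target, (α ∘ ψ.symm) y = ℓ y) ∧
        ∀ y ∈ ψ.target, y - ((y - ψ x) - ℓ (y - ψ x) • e) ∈ ψ.target := by
  obtain ⟨φ, hφ, hxφ, hφU, -⟩ := exists_chart_convex hU hx
  have h1 : fderiv ℝ (α ∘ φ.symm) (φ x) ≠ 0 := fun h =>
    ha.chart hφ hφU (φ.map_source hxφ)
      (((S.chart φ hφ).fderiv_log_eq_zero_iff (φ.map_source hxφ)).mpr h)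
  obtain ⟨e, he⟩ := exists_apply_eq_one h1
  set ℓ := fderiv ℝ (α ∘ φ.symm) (φ x) with hℓ
  obtain ⟨ψ, h2, h3, h4, h5, h6, h7⟩ := exists_chart_linear hφ hxφ hU hx (ι := Unit)
    (f := fun _ => α) (fun _ => S.smooth_log.mono (Set.subset_univ U)) (v := fun _ => e)
    (fun _ _ => by simpa using he)
    (ContinuousLinearMap.id ℝ Coord - ℓ.smulRight e) (fun y => by simp [he])
  exact ⟨ψ, h2, h3, h4, h5, ℓ, e, he, h7 (), fun y hy => by simpa using h6 y hy⟩

/-- The case `(w, a) ≠ 0`: the pressure is constant along the velocity. -/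
theorem exists_forall_iff_of_rotAcc_ne_zero (S : IsStationarySpacetime g ξ u α)
    (hU : IsOpen U) (h : RotAccNeZero g u U) {x : M} (hx : x ∈ U) :
    ∃ V : Set M, IsOpen V ∧ x ∈ V ∧ V ⊆ U ∧
      ∀ ρ p : M → ℝ, IsPerfectEnergyTensor g u V ρ p ↔
        (∃ f : ℝ → ℝ, ContDiffOn ℝ ∞ f (α '' V) ∧
          ∀ y ∈ V, p y = f (α y) ∧ ρ y = -f (α y) - deriv f (α y)) ∧
        ∀ y ∈ V, ρ y + p y ≠ 0 := by
  have ha : AccNeZero g u U := fun φ hφ x hx hxφ h0 => h φ hφ x hx hxφ (by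
    have hy := φ.map_source hxφ
    rw [← (S.chart φ hφ).ip_comm hy]
    exact ip_zero_left h0)
  obtain ⟨ψ, hψ, hxψ, hψU, hc, ℓ, e, he, hα, -⟩ := S.exists_chart_log hU ha hx
  have S' := S.chart ψ hψ
  refine ⟨ψ.source, ψ.open_source, hxψ, hψU, fun ρ p => ?_⟩
  rw [S.isPerfectEnergyTensor_iff_isFluid hψ, image_source,
    isFluid_iff_of_rate_eq_zero S'.invariantForm hc he hα
      fun r q F y hy => S'.rate_eq_zero F hy (h.chart hψ hψU hy)]
  simp only [forall_source_iff (P := fun y => p y = _ ∧ ρ y = _)]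
  rfl

/-- The case `a ≠ 0`, `w ≠ 0`, `(w, a) = 0`. The form `-g(u, ·)` is closed on the level sets of `α`;
if `τ` is a primitive along these sets, `g(u, ·) + dτ` is a multiple `μ dα` of `dα`. -/
theorem exists_forall_iff_of_rotAcc_eq_zero (S : IsStationarySpacetime g ξ u α)
    (hU : IsOpen U) (ha : AccNeZero g u U) (hw : RotNeZero g u U) (h : RotAccZero g u U)
    {x : M} (hx : x ∈ U) :
    ∃ V : Set M, IsOpen V ∧ x ∈ V ∧ V ⊆ U ∧
      ∃ τ μ : M → ℝ, SmoothOn τ V ∧ SmoothOn μ V ∧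
        (∀ y ∈ V, ∀ X : TangentSpace (𝓡 4) y,
          g.val y (u y) X = -dAt τ y X + μ y * dAt α y X) ∧
        ∀ ρ p : M → ℝ, IsPerfectEnergyTensor g u V ρ p ↔
          (∃ (c₁ : ℝ) (p₁ : ℝ → ℝ), ContDiffOn ℝ ∞ p₁ (α '' V) ∧
            ∀ y ∈ V,
              p y = c₁ * τ y * Real.exp (-2 * α y) + p₁ (α y) ∧
              ρ y = c₁ * (τ y - μ y) * Real.exp (-2 * α y) - p₁ (α y) - deriv p₁ (α y)) ∧
          ∀ y ∈ V, ρ y + p y ≠ 0 := by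
  obtain ⟨ψ, hψ, hxψ, hψU, hc, ℓ, e, he, hα, hret⟩ := S.exists_chart_log hU ha hx
  have S' := S.chart ψ hψ
  have I := S'.invariantForm
  set χ := toForm (invForm (metricIn g ψ) (fieldIn u ψ) (α ∘ ψ.symm)) with hχ
  have hB := ψ.open_target
  have dα : ∀ y ∈ ψ.target, HasFDerivAt (α ∘ ψ.symm) ℓ y := fun y hy => by
    have := (I.smooth_log.differentiableAt_of_isOpen hB hy).hasFDerivAt
    rwa [fderiv_of_eqOn_linear hB hα hy] at this
  set η : Coord → Coord →L[ℝ] ℝ := fun y => -(Real.exp ((α ∘ ψ.symm) y) • χ y) with hη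
  have hηs : ContDiffOn ℝ ∞ η ψ.target := (I.smooth_log.exp.smul I.smooth_form).neg
  -- a primitive of `-g(u, ·)` along the level sets of `α`; the projection has range `ker ℓ`
  obtain ⟨f, hf, hfη⟩ := exists_primitive_along hB hc
    (ContinuousLinearMap.id ℝ Coord - ℓ.smulRight e) (fun y => by simp [he]) (c := ψ x)
    (fun y hy => by simpa using hret y hy) hηs (fun y hy v w hv hw => by
      have hker : ∀ v : Coord, (ContinuousLinearMap.id ℝ Coord - ℓ.smulRight e) v = v →
          ℓ v = 0 := fun v hv => by
        have := congrArg ℓ hv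
        simp [he] at this
        exact this.symm
      have h1 : HasFDerivAt η _ y := ((dα y hy).exp.smul
        (I.smooth_form.differentiableAt_of_isOpen hB hy).hasFDerivAt).neg
      have h2 := S'.form_symm_of_log hy (ha.chart hψ hψU hy) (h.chart hψ hψU hy)
        (v := v) (w := w) (by rw [(dα y hy).fderiv, hker v hv])
        (by rw [(dα y hy).fderiv, hker w hw])
      rw [h1.fderiv]
      simp [hker v hv, hker w hw, h2, hχ])
  have hfη' : ∀ y ∈ ψ.target, ∀ w, ℓ w = 0 → fderiv ℝ f y w = η y w := fun y hy w hw =>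
    hfη y hy w (by simp [hw])
  set m : Coord → ℝ := fun y => fderiv ℝ f y e - η y e with hm
  have hms : ContDiffOn ℝ ∞ m ψ.target :=
    ((hf.fderiv_of_isOpen hB (m := ∞) (by simp)).clm_apply contDiffOn_const).sub
      (hηs.clm_apply contDiffOn_const)
  obtain ⟨τ, hτs, hτ⟩ := exists_smoothOn hψ hf
  obtain ⟨μ, hμs, hμ⟩ := exists_smoothOn hψ hms
  have hform : ∀ y ∈ ψ.target, ∀ w, Real.exp ((α ∘ ψ.symm) y) * χ y w
      = -fderiv ℝ (τ ∘ ψ.symm) y w + (μ ∘ ψ.symm) y * fderiv ℝ (α ∘ ψ.symm) y w := by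
    intro y hy w
    have h1 := hfη' y hy (w - ℓ w • e) (by simp [he])
    rw [(dα y hy).fderiv, (hτ y hy).2, Function.comp_apply (f := μ), (hμ y hy).1]
    simp only [map_sub, map_smul, smul_eq_mul] at h1
    have h2 : ∀ w, η y w = -(Real.exp ((α ∘ ψ.symm) y) * χ y w) := fun w => rfl
    simp only [hm]
    linarith [h2 w]
  refine ⟨ψ.source, ψ.open_source, hxψ, hψU, τ, μ, hτs, hμs, ?_, fun ρ p => ?_⟩
  · rw [forall_source_iff]
    intro y hy X
    rw [← dSymm_dChart hψ hy X, val_unit_eq (α := α) hψ hy,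
      dAt_dSymm hψ hy (hτs.mdifferentiableAt ψ.open_source (ψ.map_target hy)),
      dAt_dSymm hψ hy (S.smooth_log.mdifferentiableAt isOpen_univ (Set.mem_univ _))]
    exact hform y hy _
  · rw [S.isPerfectEnergyTensor_iff_isFluid hψ, image_source,
      isFluid_iff_of_eq_add I hc he hα (contDiffOn_comp_symm hψ hτs subset_rfl)
        (contDiffOn_comp_symm hψ hμs subset_rfl) hform fun y hy => by
          by_contra! h1
          exact hw.chart hψ hψU hy ((S'.rot_eq_zero_iff_form hy).mpr h1)]
    simp only [forall_source_iff (P := fun y => p y = _ ∧ ρ y = _)]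
    rfl

/-! ### Irrotational velocities -/

/-- An irrotational velocity is locally `-e^α dτ`: the invariant form `e^{-α} g(u, ·)` is closed. -/
theorem exists_potential (S : IsStationarySpacetime g ξ u α) (hU : IsOpen U)
    (hw : RotZero g u U) {x : M} (hx : x ∈ U) :
    ∃ ψ ∈ IsManifold.maximalAtlas (𝓡 4) ∞ M, x ∈ ψ.source ∧ ψ.source ⊆ U ∧
      ∃ τ : M → ℝ, SmoothOn τ ψ.source ∧ ∀ y ∈ ψ.source, ∀ X : TangentSpace (𝓡 4) y,
        g.val y (u y) X = -(Real.exp (α y) * dAt τ y X) := by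
  obtain ⟨ψ, hψ, hxψ, hψU, hc⟩ := exists_chart_convex hU hx
  have S' := S.chart ψ hψ
  have I := S'.invariantForm
  set χ := toForm (invForm (metricIn g ψ) (fieldIn u ψ) (α ∘ ψ.symm)) with hχ
  have hB := ψ.open_target
  obtain ⟨f, hf, hfη⟩ := exists_primitive_along hB hc (ContinuousLinearMap.id ℝ Coord)
    (fun y => rfl) (c := ψ x) (fun y hy => by simpa using ψ.map_source hxψ) I.smooth_form
    (fun y hy v w _ _ => (S'.rot_eq_zero_iff_form hy).mp (hw.chart hψ hψU hy) v w)
  obtain ⟨τ, hτs, hτ⟩ := exists_smoothOn hψ hf.neg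
  refine ⟨ψ, hψ, hxψ, hψU, τ, hτs, ?_⟩
  rw [forall_source_iff]
  intro y hy X
  rw [← dSymm_dChart hψ hy X, val_unit_eq (α := α) hψ hy,
    dAt_dSymm hψ hy (hτs.mdifferentiableAt ψ.open_source (ψ.map_target hy)), (hτ y hy).2]
  have : fderiv ℝ (fun y => -f y) y = -fderiv ℝ f y := fderiv_fun_neg
  rw [this, neg_apply, hfη y hy _ rfl]
  ring

/-- The derivative of a potential along the Killing field. -/
theorem dAt_potential (S : IsStationarySpacetime g ξ u α) {τ : M → ℝ} {x : M}
    (h : ∀ X : TangentSpace (𝓡 4) x, g.val x (u x) X = -(Real.exp (α x) * dAt τ x X)) :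
    dAt τ x (ξ x) = 1 := by
  have h1 := h (u x)
  rw [S.unit] at h1
  have h2 := dAt_smul τ x (Real.exp (-α x)) (ξ x)
  rw [← S.unit_eq] at h2
  rw [h2, ← mul_assoc, ← Real.exp_add, add_neg_cancel, Real.exp_zero] at h1
  linarith

/-- The case `a ≠ 0`, `w = 0`. The potential `τ` and `α` are independent functions, because
`dτ(ξ) = 1` and `dα(ξ) = 0`, and are taken as linear coordinates. -/
theorem exists_forall_iff_of_acc_ne_zero_of_rot_eq_zero (S : IsStationarySpacetime g ξ u α)
    (hU : IsOpen U) (ha : AccNeZero g u U) (hw : RotZero g u U) {x : M} (hx : x ∈ U) :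
    ∃ V : Set M, IsOpen V ∧ x ∈ V ∧ V ⊆ U ∧
      ∃ τ : M → ℝ, SmoothOn τ V ∧
        (∀ y ∈ V, ∀ X : TangentSpace (𝓡 4) y,
          g.val y (u y) X = -(Real.exp (α y) * dAt τ y X)) ∧
        ∀ ρ p : M → ℝ, IsPerfectEnergyTensor g u V ρ p ↔
          (∃ p₀ p₁ : ℝ → ℝ, ContDiffOn ℝ ∞ p₀ (τ '' V) ∧ ContDiffOn ℝ ∞ p₁ (α '' V) ∧
            ∀ y ∈ V,
              p y = p₀ (τ y) * Real.exp (-α y) + p₁ (α y) ∧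
              ρ y = -p₁ (α y) - deriv p₁ (α y)) ∧
          ∀ y ∈ V, ρ y + p y ≠ 0 := by
  obtain ⟨φ, hφ, hxφ, hφU, τ, hτs, hτ⟩ := S.exists_potential hU hw hx
  have hy := φ.map_source hxφ
  set X := toField (fieldIn ξ φ) (φ x) with hX
  set A := fderiv ℝ (α ∘ φ.symm) (φ x) with hA
  set T := fderiv ℝ (τ ∘ φ.symm) (φ x) with hT
  have hAX : A X = 0 := (S.chart φ hφ).invariantForm.log_field _ hy
  have hTX : T X = 1 := by
    have h1 := S.dAt_potential (hτ _ (φ.map_target hy))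
    rwa [← dSymm_toField hφ ξ hy, dAt_dSymm hφ hy
      (hτs.mdifferentiableAt φ.open_source (φ.map_target hy))] at h1
  obtain ⟨e, he⟩ := exists_apply_eq_one (ℓ := A) fun h =>
    ha.chart hφ hφU hy (((S.chart φ hφ).fderiv_log_eq_zero_iff hy).mpr h)
  obtain ⟨ψ, hψ, hxψ, hψφ, hc, -, hlin⟩ := exists_chart_linear hφ hxφ φ.open_source hxφ
    (ι := Bool) (f := fun b => if b then α else τ)
    (Bool.forall_bool.mpr ⟨hτs, S.smooth_log.mono (Set.subset_univ _)⟩)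
    (v := fun b => if b then e - T e • X else X)
    (fun i j => by cases i <;> cases j <;> simp [← hA, ← hT, hAX, hTX, he]) 0 (fun y => by simp)
  have hα := hlin true
  have hτl := hlin false
  simp only [if_true, Bool.false_eq_true, if_false] at hα hτl
  have S' := S.chart ψ hψ
  have hτ' : ∀ z ∈ ψ.source, _ := fun z hz => hτ z (hψφ hz)
  have hτs' : SmoothOn τ ψ.source := hτs.mono hψφ
  refine ⟨ψ.source, ψ.open_source, hxψ, hψφ.trans hφU, τ, hτs', hτ', fun ρ p => ?_⟩
  have hAe : A (e - T e • X) = 1 := by simp [hAX, he]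
  rw [S.isPerfectEnergyTensor_iff_isFluid hψ, image_source, image_source,
    isFluid_iff_of_integrable S'.invariantForm hc hAe hα hTX hτl fun y hy w => by
      have h1 := hτ' _ (ψ.map_target hy) (dSymm ψ y w)
      rw [val_unit_eq (α := α) hψ hy, dAt_dSymm hψ hy
        (hτs'.mdifferentiableAt ψ.open_source (ψ.map_target hy)), ← mul_neg] at h1
      exact mul_left_cancel₀ (Real.exp_pos _).ne' h1]
  simp only [forall_source_iff (P := fun y => p y = _ ∧ ρ y = _)]
  rfl

/-- A geodesic irrotational velocity is locally `-dτ`: if `g(u, ·) = -e^α dσ`, take `τ = e^α σ`,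
where `α` is locally constant. -/
theorem exists_time (S : IsStationarySpacetime g ξ u α) (hU : IsOpen U)
    (ha : AccZero g u U) (hw : RotZero g u U) {x : M} (hx : x ∈ U) :
    ∃ ψ ∈ IsManifold.maximalAtlas (𝓡 4) ∞ M, x ∈ ψ.source ∧ ψ.source ⊆ U ∧
      ∃ τ : M → ℝ, SmoothOn τ ψ.source ∧ ∀ y ∈ ψ.source, ∀ X : TangentSpace (𝓡 4) y,
        g.val y (u y) X = -dAt τ y X := by
  obtain ⟨ψ, hψ, hxψ, hψU, τ, hτs, hτ⟩ := S.exists_potential hU hw hx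
  have S' := S.chart ψ hψ
  have hσ : SmoothOn (fun z => Real.exp (α z) * τ z) ψ.source :=
    (Real.contDiff_exp.contMDiff.comp_contMDiffOn
      (S.smooth_log.mono (Set.subset_univ _))).mul hτs
  refine ⟨ψ, hψ, hxψ, hψU, fun z => Real.exp (α z) * τ z, hσ, ?_⟩
  rw [forall_source_iff] at hτ ⊢
  intro y hy X
  have h1 := (S'.smooth_log.differentiableAt_of_isOpen ψ.open_target hy).hasFDerivAt
  have h2 := ((contDiffOn_comp_symm hψ hτs subset_rfl).differentiableAt_of_isOpen
    ψ.open_target hy).hasFDerivAt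
  have h3 : HasFDerivAt ((fun z => Real.exp (α z) * τ z) ∘ ψ.symm) _ y := h1.exp.mul h2
  rw [hτ y hy, ← dSymm_dChart hψ hy X,
    dAt_dSymm hψ hy (hτs.mdifferentiableAt ψ.open_source (ψ.map_target hy)),
    dAt_dSymm hψ hy (hσ.mdifferentiableAt ψ.open_source (ψ.map_target hy)), h3.fderiv,
    (S'.fderiv_log_eq_zero_iff hy).mp (ha.chart hψ hψU hy)]
  simp

/-- The case `a = 0`, `w = 0`. -/
theorem exists_forall_iff_of_acc_eq_zero_of_rot_eq_zero (S : IsStationarySpacetime g ξ u α)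
    (hU : IsOpen U) (ha : AccZero g u U) (hw : RotZero g u U) {x : M} (hx : x ∈ U) :
    ∃ V : Set M, IsOpen V ∧ x ∈ V ∧ V ⊆ U ∧
      ∃ τ : M → ℝ, SmoothOn τ V ∧
        (∀ y ∈ V, ∀ X : TangentSpace (𝓡 4) y, g.val y (u y) X = -dAt τ y X) ∧
        ∀ ρ p : M → ℝ, IsPerfectEnergyTensor g u V ρ p ↔
          (∃ f : ℝ → ℝ, ContDiffOn ℝ ∞ f (τ '' V) ∧ ∀ y ∈ V, p y = f (τ y)) ∧
          SmoothOn ρ V ∧ (∀ y ∈ V, dAt ρ y (u y) = 0) ∧ ∀ y ∈ V, ρ y + p y ≠ 0 := by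
  obtain ⟨φ, hφ, hxφ, hφU, τ, hτs, hτ⟩ := S.exists_time hU ha hw hx
  have hy := φ.map_source hxφ
  set T := fderiv ℝ (τ ∘ φ.symm) (φ x) with hT
  obtain ⟨e, he⟩ := exists_apply_eq_one (ℓ := T) fun h => by
    have h1 := hτ _ (φ.map_target hy) (u (φ.symm (φ x)))
    rw [S.unit, ← dSymm_toField hφ u hy, dAt_dSymm hφ hy
      (hτs.mdifferentiableAt φ.open_source (φ.map_target hy)), ← hT, h] at h1
    simp at h1
  obtain ⟨ψ, hψ, hxψ, hψφ, hc, -, hlin⟩ := exists_chart_linear hφ hxφ φ.open_source hxφ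
    (ι := Unit) (f := fun _ => τ) (fun _ => hτs) (v := fun _ => e)
    (fun _ _ => by simpa using he) 0 (fun y => by simp)
  have S' := S.chart ψ hψ
  have hψU := hψφ.trans hφU
  have hτ' : ∀ z ∈ ψ.source, _ := fun z hz => hτ z (hψφ hz)
  have hτs' : SmoothOn τ ψ.source := hτs.mono hψφ
  refine ⟨ψ.source, ψ.open_source, hxψ, hψU, τ, hτs', hτ', fun ρ p => ?_⟩
  rw [S.isPerfectEnergyTensor_iff_isFluid hψ, image_source,
    isFluid_iff_of_log_const S'.invariantForm hc he (hlin ())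
      (fun y hy => (S'.fderiv_log_eq_zero_iff hy).mp (ha.chart hψ hψU hy)) fun y hy w => by
      have h1 := hτ' _ (ψ.map_target hy) (dSymm ψ y w)
      rwa [val_unit_eq (α := α) hψ hy, dAt_dSymm hψ hy
        (hτs'.mdifferentiableAt ψ.open_source (ψ.map_target hy))] at h1,
    ← smoothOn_iff_contDiffOn hψ, and_assoc, and_assoc,
    forall_source_iff (P := fun z => dAt _ z _ = 0)]
  simp only [S.dAt_unit, forall_source_iff (P := fun y => p y = _)]
  refine and_congr_right fun _ => and_congr_right fun hρ => and_congr_left fun _ =>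
    forall₂_congr fun y hy => ?_
  rw [← dSymm_toField hψ ξ hy, dAt_dSymm hψ hy
    (SmoothOn.mdifferentiableAt hρ ψ.open_source (ψ.map_target hy))]

end IsStationarySpacetime
end LocalSolutions

end

end PerfectFluid

theorem mainTheorem12 {M : Type*} [TopologicalSpace M]
    [ChartedSpace (EuclideanSpace ℝ (Fin 4)) M] [IsManifold (𝓡 4) ∞ M]
    (g : PerfectFluid.LorentzMetric M) (ξ u : ∀ x : M, TangentSpace (𝓡 4) x) (α : M → ℝ)
    (hξ : PerfectFluid.SmoothField ξ) (htime : PerfectFluid.IsTimelike g ξ)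
    (hkill : PerfectFluid.IsKilling g ξ)
    (hu : u = PerfectFluid.unitField g ξ) (hα : α = PerfectFluid.logNorm g ξ) :
    -- `u` is always the unit velocity of a perfect energy tensor
    (∃ ρ p : M → ℝ, PerfectFluid.IsPerfectEnergyTensor g u Set.univ ρ p) ∧
    -- only the classes `C₁`, `C₂`, `C₁₅`, `C₁₈` occur
    (∀ U : Set M, IsOpen U → U.Nonempty → ∀ n : ℕ, PerfectFluid.IsOfClass g u U n →
      n = 1 ∨ n = 2 ∨ n = 15 ∨ n = 18) ∧
    -- they are given by the following four cases
    (∀ U : Set M, IsOpen U →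
      (PerfectFluid.IsOfClass g u U 1 ↔ PerfectFluid.AccZero g u U) ∧
      (PerfectFluid.IsOfClass g u U 2 ↔ PerfectFluid.RotAccNeZero g u U) ∧
      (PerfectFluid.IsOfClass g u U 15 ↔
        PerfectFluid.AccNeZero g u U ∧ PerfectFluid.RotNeZero g u U ∧
          PerfectFluid.RotAccZero g u U) ∧
      (PerfectFluid.IsOfClass g u U 18 ↔
        PerfectFluid.AccNeZero g u U ∧ PerfectFluid.RotZero g u U)) ∧
    -- case `a = 0`, `w ≠ 0`
    (∀ U : Set M, IsOpen U → IsPreconnected U →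
      PerfectFluid.AccZero g u U → PerfectFluid.RotNeZero g u U →
      ∀ ρ p : M → ℝ, PerfectFluid.IsPerfectEnergyTensor g u U ρ p ↔
        (∃ p₀ : ℝ, ∀ y ∈ U, p y = p₀) ∧
        PerfectFluid.SmoothOn ρ U ∧ (∀ y ∈ U, PerfectFluid.dAt ρ y (u y) = 0) ∧
        ∀ y ∈ U, ρ y + p y ≠ 0) ∧
    -- case `a = 0`, `w = 0`
    (∀ U : Set M, IsOpen U →
      PerfectFluid.AccZero g u U → PerfectFluid.RotZero g u U →
      ∀ x ∈ U, ∃ V : Set M, IsOpen V ∧ x ∈ V ∧ V ⊆ U ∧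
        ∃ τ : M → ℝ, PerfectFluid.SmoothOn τ V ∧
          (∀ y ∈ V, ∀ X : TangentSpace (𝓡 4) y,
            g.val y (u y) X = -PerfectFluid.dAt τ y X) ∧
          ∀ ρ p : M → ℝ, PerfectFluid.IsPerfectEnergyTensor g u V ρ p ↔
            (∃ f : ℝ → ℝ, ContDiffOn ℝ ∞ f (τ '' V) ∧ ∀ y ∈ V, p y = f (τ y)) ∧
            PerfectFluid.SmoothOn ρ V ∧ (∀ y ∈ V, PerfectFluid.dAt ρ y (u y) = 0) ∧
            ∀ y ∈ V, ρ y + p y ≠ 0) ∧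
    -- case `(w, a) ≠ 0`
    (∀ U : Set M, IsOpen U → PerfectFluid.RotAccNeZero g u U →
      ∀ x ∈ U, ∃ V : Set M, IsOpen V ∧ x ∈ V ∧ V ⊆ U ∧
        ∀ ρ p : M → ℝ, PerfectFluid.IsPerfectEnergyTensor g u V ρ p ↔
          (∃ f : ℝ → ℝ, ContDiffOn ℝ ∞ f (α '' V) ∧
            ∀ y ∈ V, p y = f (α y) ∧ ρ y = -f (α y) - deriv f (α y)) ∧
          ∀ y ∈ V, ρ y + p y ≠ 0) ∧
    -- case `a ≠ 0`, `w ≠ 0`, `(w, a) = 0`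
    (∀ U : Set M, IsOpen U → PerfectFluid.AccNeZero g u U → PerfectFluid.RotNeZero g u U →
      PerfectFluid.RotAccZero g u U →
      ∀ x ∈ U, ∃ V : Set M, IsOpen V ∧ x ∈ V ∧ V ⊆ U ∧
        ∃ τ μ : M → ℝ, PerfectFluid.SmoothOn τ V ∧ PerfectFluid.SmoothOn μ V ∧
          (∀ y ∈ V, ∀ X : TangentSpace (𝓡 4) y,
            g.val y (u y) X = -PerfectFluid.dAt τ y X + μ y * PerfectFluid.dAt α y X) ∧
          ∀ ρ p : M → ℝ, PerfectFluid.IsPerfectEnergyTensor g u V ρ p ↔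
            (∃ (c₁ : ℝ) (p₁ : ℝ → ℝ), ContDiffOn ℝ ∞ p₁ (α '' V) ∧
              ∀ y ∈ V,
                p y = c₁ * τ y * Real.exp (-2 * α y) + p₁ (α y) ∧
                ρ y = c₁ * (τ y - μ y) * Real.exp (-2 * α y) - p₁ (α y) - deriv p₁ (α y)) ∧
            ∀ y ∈ V, ρ y + p y ≠ 0) ∧
    -- case `a ≠ 0`, `w = 0`
    (∀ U : Set M, IsOpen U → PerfectFluid.AccNeZero g u U → PerfectFluid.RotZero g u U →
      ∀ x ∈ U, ∃ V : Set M, IsOpen V ∧ x ∈ V ∧ V ⊆ U ∧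
        ∃ τ : M → ℝ, PerfectFluid.SmoothOn τ V ∧
          (∀ y ∈ V, ∀ X : TangentSpace (𝓡 4) y,
            g.val y (u y) X = -(Real.exp (α y) * PerfectFluid.dAt τ y X)) ∧
          ∀ ρ p : M → ℝ, PerfectFluid.IsPerfectEnergyTensor g u V ρ p ↔
            (∃ p₀ p₁ : ℝ → ℝ, ContDiffOn ℝ ∞ p₀ (τ '' V) ∧ ContDiffOn ℝ ∞ p₁ (α '' V) ∧
              ∀ y ∈ V,
                p y = p₀ (τ y) * Real.exp (-α y) + p₁ (α y) ∧
                ρ y = -p₁ (α y) - deriv p₁ (α y)) ∧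
            ∀ y ∈ V, ρ y + p y ≠ 0) := by
  subst hu hα
  have S := PerfectFluid.isStationarySpacetime hξ htime hkill
  refine ⟨S.exists_isPerfectEnergyTensor, fun U _ hUn n hn => ?_, fun U _ => ?_,
    fun U hU hUc ha hw => S.isPerfectEnergyTensor_iff_of_rot_ne_zero hU hUc ha hw,
    fun U hU ha hw x hx => S.exists_forall_iff_of_acc_eq_zero_of_rot_eq_zero hU ha hw hx,
    fun U hU h x hx => S.exists_forall_iff_of_rotAcc_ne_zero hU h hx,
    fun U hU ha hw h x hx => S.exists_forall_iff_of_rotAcc_eq_zero hU ha hw h hx,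
    fun U hU ha hw x hx => S.exists_forall_iff_of_acc_ne_zero_of_rot_eq_zero hU ha hw hx⟩
  · obtain ⟨x, hx⟩ := hUn
    have hφ := IsManifold.chart_mem_maximalAtlas (I := 𝓡 4) (n := ∞) x
    have hxs := mem_chart_source (EuclideanSpace ℝ (Fin 4)) x
    exact (S.chart _ hφ).class_mem ((chartAt _ x).map_source hxs) (hn _ hφ x hx hxs)
  · refine ⟨Iff.rfl, ?_, ?_, ?_⟩
    · exact forall₂_congr fun φ hφ => forall₂_congr fun x _ => forall_congr' fun hxφ =>
        (S.chart φ hφ).class_two_iff (φ.map_source hxφ)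
    · refine ⟨fun h => ⟨?_, ?_, ?_⟩, fun h φ hφ x hx hxφ => ?_⟩
      · exact fun φ hφ x hx hxφ =>
          (((S.chart φ hφ).class_fifteen_iff (φ.map_source hxφ)).mp (h φ hφ x hx hxφ)).1
      · exact fun φ hφ x hx hxφ =>
          (((S.chart φ hφ).class_fifteen_iff (φ.map_source hxφ)).mp (h φ hφ x hx hxφ)).2.1
      · exact fun φ hφ x hx hxφ =>
          (((S.chart φ hφ).class_fifteen_iff (φ.map_source hxφ)).mp (h φ hφ x hx hxφ)).2.2
      · exact ((S.chart φ hφ).class_fifteen_iff (φ.map_source hxφ)).mpr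
          ⟨h.1 φ hφ x hx hxφ, h.2.1 φ hφ x hx hxφ, h.2.2 φ hφ x hx hxφ⟩
    · refine ⟨fun h => ⟨?_, ?_⟩, fun h φ hφ x hx hxφ => ?_⟩
      · exact fun φ hφ x hx hxφ =>
          (((S.chart φ hφ).class_eighteen_iff (φ.map_source hxφ)).mp (h φ hφ x hx hxφ)).1
      · exact fun φ hφ x hx hxφ =>
          (((S.chart φ hφ).class_eighteen_iff (φ.map_source hxφ)).mp (h φ hφ x hx hxφ)).2
      · exact ((S.chart φ hφ).class_eighteen_iff (φ.map_source hxφ)).mpr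
          ⟨h.1 φ hφ x hx hxφ, h.2 φ hφ x hx hxφ⟩
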